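/- Let $\mathbb N=\{1,2,3,\dots\}$. Let $\mathcal S_0$ be the family of subsets of $\mathbb N$ with at most one element, let $\mathcal S_1$ be the family of all finite $A\subseteq\mathbb N$ with $|A|\le\min A$, together with $\emptyset$, and for $n\ge 1$ let $\mathcal S_{n+1}$ be the family of all unions $G_1\cup\dots\cup G_k$ of nonempty sets $G_1<\dots<G_k$ in $\mathcal S_n$ with $\{\min G_1,\dots,\min G_k\}\in\mathcal S_1$ (here $G<H$ means $\max G<\min H$). Let $(\theta_n)_{n\ge1}$ be a null sequence in $(0,1)$, and let $\sigma_n\in\{U,M\}$ for $n\ge1$, with $\sigma_{p}=M$ for at least one $p$. A finite family $(E_i)_{i=1}^k$ of nonempty subsets of $\mathbb N$ is $(\mathcal S_n,\sigma_n)$-adapted if $\{\min E_1,\dots,\min E_k\}\in\mathcal S_n$ and the $E_i$ are pairwise disjoint (if $\sigma_n=M$), respectively $E_1<\dots<E_k$ (if $\sigma_n=U$). The partly modified mixed Tsirelson space $X=T[(\mathcal S_n,\sigma_n,\theta_n)_{n=1}^\infty]$ is the completion of the real vector space $c_{00}$ under the unique norm satisfying $$\|x\|=\max\Bigl\{\|x\|_{c_0},\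 \sup_n\theta_n\sup\sum_i\|E_ix\|\Bigr\}\qquad(x\in c_{00}),$$ where the inner supremum is over all $(\mathcal S_n,\sigma_n)$-adapted families $(E_i)$ and $E_ix$ is the restriction of $x$ to $E_i$. Let $(e_k)$ be the unit vectors of $c_{00}$. The space $X$ is subsequentially minimal if $(e_k)$ is a normalized Schauder basis of $X$ and for every normalized block basis $(x_k)$ of $(e_k)$ there are a normalized block basis $(y_k)$ of $(x_k)$ and a subsequence $(e_{p_k})$ of $(e_k)$ such that $(y_k)$ and $(e_{p_k})$ are equivalent, i.e. there is $K<\infty$ with $K^{-1}\|\sum a_ke_{p_k}\|\le\|\sum a_ky_k\|\le K\|\sum a_ke_{p_k}\|$ for all $(a_k)\in c_{00}$. **Statement.** 1. If there exists $\varepsilon>0$ such that $$\sup\Bigl\{\frac nm:\ n,m\in\mathbb N,\ \theta_n\ge\varepsilon^m\Bigr\}=\infty,\tag{1}$$ then $X$ is subsequentially minimal. 2. If $\sup_n\theta_n^{1/n}=1$, then (1) holds for some $\varepsilon>0$; hence $X$ is subsequentially minimal. -/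

import Mathlib

open Filter Topology

noncomputable section

namespace Tsirelson

/-! ## Schreier families on the positive integers -/

/-- `F < G` for finite sets of positive integers: every element of `F` is below every
element of `G` (in particular `∅ < G` and `F < ∅`). -/
def Precedes (F G : Finset ℕ+) : Prop := ∀ a ∈ F, ∀ b ∈ G, a < b

/-- The family `𝓕[𝓖]` of all unions `G₁ ∪ ⋯ ∪ G_k` with `G_i ∈ 𝓖` nonempty, `G₁ < ⋯ < G_k` and
`{min G₁, …, min G_k} ∈ 𝓕`. -/
def familyComp (𝓕 𝓖 : Set (Finset ℕ+)) : Set (Finset ℕ+) :=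
  {A | ∃ (k : ℕ) (G : Fin k → Finset ℕ+) (hG : ∀ i, (G i).Nonempty),
    (∀ i, G i ∈ 𝓖) ∧ (∀ i j, i < j → Precedes (G i) (G j)) ∧
    Finset.univ.image (fun i => (G i).min' (hG i)) ∈ 𝓕 ∧
    A = Finset.univ.biUnion G}

/-- The Schreier family `S₁`: the sets with `|A| ≤ min A`, together with the empty set. -/
def schreierOne : Set (Finset ℕ+) := {A | ∀ a ∈ A, A.card ≤ (a : ℕ)}

/-- The Schreier families `Sₙ` of finite order: `S₀` is the family of sets with at most one
element, `S₁` is as above, and `Sₙ₊₁ = S₁[Sₙ]` for `n ≥ 1`. -/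
def schreier : ℕ → Set (Finset ℕ+)
  | 0 => {A | A.card ≤ 1}
  | 1 => schreierOne
  | n + 2 => familyComp schreierOne (schreier (n + 1))

/-! ## Adapted families and the implicit norm -/

/-- `U`: unmodified (admissible families); `M`: modified (allowable families). -/
inductive Mode where
  | U : Mode
  | M : Mode

/-- A finite family `(E₁, …, E_k)` of (nonempty) subsets of `ℕ+` is `(Sₙ, σ)`-adapted if
`{min E₁, …, min E_k} ∈ Sₙ` and the sets are pairwise disjoint (if `σ = M`), respectively
successive, `E₁ < ⋯ < E_k` (if `σ = U`). -/
def Adapted (n : ℕ) (σ : Mode) {k : ℕ} (E : Fin k → Set ℕ+) : Prop :=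
  (∃ m : Fin k → ℕ+, (∀ i, IsLeast (E i) (m i)) ∧ Finset.univ.image m ∈ schreier n) ∧
  match σ with
  | Mode.M => ∀ i j, i ≠ j → Disjoint (E i) (E j)
  | Mode.U => ∀ i j, i < j → ∀ a ∈ E i, ∀ b ∈ E j, a < b

/-- The data of a partly modified mixed Tsirelson space: a null sequence `(θₙ)` in `(0,1)` and a
sequence `(σₙ)` in `{U, M}` which takes the value `M` at least once. -/
structure Params where
  θ : ℕ+ → ℝ
  σ : ℕ+ → Mode
  θ_pos : ∀ n, 0 < θ n
  θ_lt_one : ∀ n, θ n < 1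
  θ_null : Tendsto θ atTop (𝓝 0)
  exists_modified : ∃ p, σ p = Mode.M

open Classical in
/-- The restriction `E x` of a finitely supported vector `x` to a set `E` of coordinates. -/
def restrict (E : Set ℕ+) (x : ℕ+ →₀ ℝ) : ℕ+ →₀ ℝ := x.filter (fun k => k ∈ E)

/-- The `c₀`-norm on `c₀₀`. -/
def c0Norm (x : ℕ+ →₀ ℝ) : ℝ := ⨆ k, |x k|

/-- All the numbers `θₙ ∑ᵢ N (Eᵢ x)`, over `n ≥ 1` and `(Sₙ, σₙ)`-adapted families `(Eᵢ)`. -/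
def adaptedSums (P : Params) (N : (ℕ+ →₀ ℝ) → ℝ) (x : ℕ+ →₀ ℝ) : Set ℝ :=
  {r | ∃ (n : ℕ+) (k : ℕ) (E : Fin k → Set ℕ+),
    Adapted (n : ℕ) (P.σ n) E ∧ r = P.θ n * ∑ i, N (restrict (E i) x)}

/-- The right-hand side of the implicit equation of the norm. -/
def step (P : Params) (N : (ℕ+ →₀ ℝ) → ℝ) (x : ℕ+ →₀ ℝ) : ℝ :=
  max (c0Norm x) (sSup (adaptedSums P N x))

/-- The iterated norms `‖·‖₀ = ‖·‖_{c₀}`, `‖·‖ᵢ₊₁ = step ‖·‖ᵢ`. -/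
def iterNorm (P : Params) : ℕ → (ℕ+ →₀ ℝ) → ℝ
  | 0 => c0Norm
  | i + 1 => step P (iterNorm P i)

/-- The norm of the partly modified mixed Tsirelson space on `c₀₀`: the limit of the increasing
sequence of iterated norms. By `tnorm_eq` and `tnorm_unique` below, it is the only solution of
the implicit equation `‖x‖ = max {‖x‖_{c₀}, supₙ θₙ sup ∑ᵢ ‖Eᵢ x‖}`. -/
def tnorm (P : Params) (x : ℕ+ →₀ ℝ) : ℝ := ⨆ i, iterNorm P i x

/-! ### Basic facts: the implicit equation and the norm axioms -/

lemma schreier_empty (n : ℕ) : ∅ ∈ schreier n := by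
  match n with
  | 0 => simp [schreier]
  | 1 => simp [schreier, schreierOne]
  | n + 2 =>
    exact ⟨0, fun i => i.elim0, fun i => i.elim0, fun i => i.elim0, fun i => i.elim0,
      by simp [schreierOne], by simp⟩

lemma Adapted.disjoint {n : ℕ} {σ : Mode} {k : ℕ} {E : Fin k → Set ℕ+} (h : Adapted n σ E)
    {i j : Fin k} (hij : i ≠ j) : Disjoint (E i) (E j) := by
  obtain ⟨-, h⟩ := h
  cases σ with
  | M => exact h i j hij
  | U =>
    rw [Set.disjoint_left]
    intro a hi hj
    rcases lt_or_gt_of_ne hij with h1 | h1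
    · exact lt_irrefl _ (h i j h1 a hi a hj)
    · exact lt_irrefl _ (h j i h1 a hj a hi)

open Classical in
lemma restrict_apply (E : Set ℕ+) (x : ℕ+ →₀ ℝ) (k : ℕ+) :
    restrict E x k = if k ∈ E then x k else 0 := by
  simp [restrict, Finsupp.filter_apply]

lemma restrict_add (E : Set ℕ+) (x y : ℕ+ →₀ ℝ) :
    restrict E (x + y) = restrict E x + restrict E y := by
  ext k; by_cases h : k ∈ E <;> simp [restrict_apply, h]

lemma restrict_smul (E : Set ℕ+) (c : ℝ) (x : ℕ+ →₀ ℝ) :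
    restrict E (c • x) = c • restrict E x := by
  ext k; by_cases h : k ∈ E <;> simp [restrict_apply, h]

lemma support_restrict_subset (E : Set ℕ+) (x : ℕ+ →₀ ℝ) :
    (restrict E x).support ⊆ x.support := by
  intro k
  simp only [Finsupp.mem_support_iff, restrict_apply]
  split_ifs <;> simp

lemma bddAbove_c0 (x : ℕ+ →₀ ℝ) : BddAbove (Set.range fun k => |x k|) := by
  refine ⟨∑ k ∈ x.support, |x k|, ?_⟩
  rintro _ ⟨k, rfl⟩
  by_cases hk : k ∈ x.support
  · exact Finset.single_le_sum (f := fun k => |x k|) (fun _ _ => abs_nonneg _) hk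
  · have : x k = 0 := by simpa using hk
    simp only [this, abs_zero]
    exact Finset.sum_nonneg fun _ _ => abs_nonneg _

lemma abs_le_c0Norm (x : ℕ+ →₀ ℝ) (k : ℕ+) : |x k| ≤ c0Norm x := le_ciSup (bddAbove_c0 x) k

lemma c0Norm_nonneg (x : ℕ+ →₀ ℝ) : 0 ≤ c0Norm x := (abs_nonneg _).trans (abs_le_c0Norm x 1)

/-- The `ℓ¹`-norm on `c₀₀`. -/
def l1Norm (x : ℕ+ →₀ ℝ) : ℝ := ∑ k ∈ x.support, |x k|

lemma l1Norm_nonneg (x : ℕ+ →₀ ℝ) : 0 ≤ l1Norm x := Finset.sum_nonneg fun _ _ => abs_nonneg _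

lemma l1Norm_restrict (E : Set ℕ+) (x : ℕ+ →₀ ℝ) :
    l1Norm (restrict E x) = ∑ k ∈ x.support, |restrict E x k| := by
  refine Finset.sum_subset (support_restrict_subset E x) fun k _ hk => ?_
  simpa using hk

lemma sum_l1Norm_le {n : ℕ} {σ : Mode} {k : ℕ} {E : Fin k → Set ℕ+} (h : Adapted n σ E)
    (x : ℕ+ →₀ ℝ) : ∑ i, l1Norm (restrict (E i) x) ≤ l1Norm x := by
  classical
  simp only [l1Norm_restrict]
  rw [Finset.sum_comm]
  refine Finset.sum_le_sum fun a _ => ?_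
  by_cases ha : ∃ i, a ∈ E i
  · obtain ⟨i, hi⟩ := ha
    rw [Finset.sum_eq_single i]
    · simp [restrict_apply, hi]
    · intro j _ hj
      have : a ∉ E j := fun h' => Set.disjoint_left.1 (h.disjoint hj) h' hi
      simp [restrict_apply, this]
    · simp
  · push Not at ha
    simp [restrict_apply, ha]

/-- The properties shared by all iterated norms. -/
structure Good (N : (ℕ+ →₀ ℝ) → ℝ) : Prop where
  nonneg : ∀ x, 0 ≤ N x
  le_l1 : ∀ x, N x ≤ l1Norm x
  add_le : ∀ x y, N (x + y) ≤ N x + N y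
  smul_le : ∀ (c : ℝ) x, N (c • x) ≤ |c| * N x

lemma good_c0 : Good c0Norm where
  nonneg := c0Norm_nonneg
  le_l1 x := by
    refine ciSup_le fun k => ?_
    by_cases hk : k ∈ x.support
    · exact Finset.single_le_sum (f := fun k => |x k|) (fun _ _ => abs_nonneg _) hk
    · have : x k = 0 := by simpa using hk
      simpa [this] using l1Norm_nonneg x
  add_le x y := ciSup_le fun k => (abs_add_le (x k) (y k)).trans
    (add_le_add (abs_le_c0Norm x k) (abs_le_c0Norm y k))
  smul_le c x := ciSup_le fun k => by
    simpa [abs_mul] using mul_le_mul_of_nonneg_left (abs_le_c0Norm x k) (abs_nonneg c)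

lemma Good.adaptedSums_le {P : Params} {N : (ℕ+ →₀ ℝ) → ℝ} (hN : Good N) (x : ℕ+ →₀ ℝ)
    {r : ℝ} (hr : r ∈ adaptedSums P N x) : r ≤ l1Norm x := by
  obtain ⟨n, k, E, hE, rfl⟩ := hr
  calc P.θ n * ∑ i, N (restrict (E i) x) ≤ 1 * ∑ i, N (restrict (E i) x) :=
        mul_le_mul_of_nonneg_right (P.θ_lt_one n).le (Finset.sum_nonneg fun _ _ => hN.nonneg _)
    _ ≤ ∑ i, l1Norm (restrict (E i) x) := by
        rw [one_mul]; exact Finset.sum_le_sum fun _ _ => hN.le_l1 _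
    _ ≤ l1Norm x := sum_l1Norm_le hE x

lemma Good.bddAbove {P : Params} {N : (ℕ+ →₀ ℝ) → ℝ} (hN : Good N) (x : ℕ+ →₀ ℝ) :
    BddAbove (adaptedSums P N x) := ⟨l1Norm x, fun _ hr => hN.adaptedSums_le x hr⟩

lemma zero_mem_adaptedSums (P : Params) (N : (ℕ+ →₀ ℝ) → ℝ) (x : ℕ+ →₀ ℝ) :
    (0 : ℝ) ∈ adaptedSums P N x := by
  refine ⟨1, 0, fun i => i.elim0, ⟨⟨fun i => i.elim0, fun i => i.elim0, ?_⟩, ?_⟩, by simp⟩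
  · simpa using schreier_empty _
  · cases P.σ 1 <;> exact fun i => i.elim0

lemma c0Norm_le_step (P : Params) (N : (ℕ+ →₀ ℝ) → ℝ) (x : ℕ+ →₀ ℝ) :
    c0Norm x ≤ step P N x := le_max_left _ _

lemma step_le {P : Params} {N : (ℕ+ →₀ ℝ) → ℝ} {x : ℕ+ →₀ ℝ} {b : ℝ} (h0 : c0Norm x ≤ b)
    (h : ∀ r ∈ adaptedSums P N x, r ≤ b) : step P N x ≤ b :=
  max_le h0 (csSup_le ⟨0, zero_mem_adaptedSums P N x⟩ h)

lemma le_step {P : Params} {N : (ℕ+ →₀ ℝ) → ℝ} {x : ℕ+ →₀ ℝ}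
    (hb : BddAbove (adaptedSums P N x)) {r : ℝ} (hr : r ∈ adaptedSums P N x) :
    r ≤ step P N x := (le_csSup hb hr).trans (le_max_right _ _)

lemma Good.step {P : Params} {N : (ℕ+ →₀ ℝ) → ℝ} (hN : Good N) : Good (step P N) where
  nonneg x := (c0Norm_nonneg x).trans (c0Norm_le_step P N x)
  le_l1 x := step_le (good_c0.le_l1 x) fun _ hr => hN.adaptedSums_le x hr
  add_le x y := by
    refine step_le ((good_c0.add_le x y).trans
      (add_le_add (c0Norm_le_step P N x) (c0Norm_le_step P N y))) ?_
    rintro _ ⟨n, k, E, hE, rfl⟩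
    refine le_trans ?_ (add_le_add (le_step (hN.bddAbove x) ⟨n, k, E, hE, rfl⟩)
      (le_step (hN.bddAbove y) ⟨n, k, E, hE, rfl⟩))
    rw [← mul_add, ← Finset.sum_add_distrib]
    refine mul_le_mul_of_nonneg_left (Finset.sum_le_sum fun i _ => ?_) (P.θ_pos n).le
    rw [restrict_add]; exact hN.add_le _ _
  smul_le c x := by
    refine step_le ((good_c0.smul_le c x).trans
      (mul_le_mul_of_nonneg_left (c0Norm_le_step P N x) (abs_nonneg c))) ?_
    rintro _ ⟨n, k, E, hE, rfl⟩
    refine le_trans ?_ (mul_le_mul_of_nonneg_left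
      (le_step (hN.bddAbove x) ⟨n, k, E, hE, rfl⟩) (abs_nonneg c))
    rw [mul_left_comm, Finset.mul_sum Finset.univ _ |c|]
    refine mul_le_mul_of_nonneg_left (Finset.sum_le_sum fun i _ => ?_) (P.θ_pos n).le
    rw [restrict_smul]; exact hN.smul_le _ _

lemma good_iterNorm (P : Params) (i : ℕ) : Good (iterNorm P i) := by
  induction i with
  | zero => exact good_c0
  | succ i ih => exact ih.step

lemma step_mono {P : Params} {N N' : (ℕ+ →₀ ℝ) → ℝ} (h : ∀ x, N x ≤ N' x) (hN' : Good N')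
    (x : ℕ+ →₀ ℝ) : step P N x ≤ step P N' x := by
  refine step_le (c0Norm_le_step P N' x) ?_
  rintro _ ⟨n, k, E, hE, rfl⟩
  exact (mul_le_mul_of_nonneg_left (Finset.sum_le_sum fun i _ => h _) (P.θ_pos n).le).trans
    (le_step (hN'.bddAbove x) ⟨n, k, E, hE, rfl⟩)

lemma iterNorm_mono (P : Params) (x : ℕ+ →₀ ℝ) : Monotone fun i => iterNorm P i x := by
  have h : ∀ i x, iterNorm P i x ≤ iterNorm P (i + 1) x := by
    intro i
    induction i with
    | zero => exact fun x => c0Norm_le_step P _ x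
    | succ i ih => exact fun x => step_mono ih (good_iterNorm P (i + 1)) x
  exact monotone_nat_of_le_succ fun i => h i x

lemma bddAbove_iterNorm (P : Params) (x : ℕ+ →₀ ℝ) :
    BddAbove (Set.range fun i => iterNorm P i x) :=
  ⟨l1Norm x, by rintro _ ⟨i, rfl⟩; exact (good_iterNorm P i).le_l1 x⟩

lemma iterNorm_le_tnorm (P : Params) (i : ℕ) (x : ℕ+ →₀ ℝ) : iterNorm P i x ≤ tnorm P x :=
  le_ciSup (bddAbove_iterNorm P x) i

lemma tendsto_iterNorm (P : Params) (x : ℕ+ →₀ ℝ) :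
    Tendsto (fun i => iterNorm P i x) atTop (𝓝 (tnorm P x)) :=
  tendsto_atTop_ciSup (iterNorm_mono P x) (bddAbove_iterNorm P x)

lemma good_tnorm (P : Params) : Good (tnorm P) where
  nonneg x := ((good_iterNorm P 0).nonneg x).trans (iterNorm_le_tnorm P 0 x)
  le_l1 x := ciSup_le fun i => (good_iterNorm P i).le_l1 x
  add_le x y := ciSup_le fun i => ((good_iterNorm P i).add_le x y).trans
    (add_le_add (iterNorm_le_tnorm P i x) (iterNorm_le_tnorm P i y))
  smul_le c x := ciSup_le fun i => ((good_iterNorm P i).smul_le c x).trans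
    (mul_le_mul_of_nonneg_left (iterNorm_le_tnorm P i x) (abs_nonneg c))

/-- The implicit equation `‖x‖ = max {‖x‖_{c₀}, supₙ θₙ sup ∑ᵢ ‖Eᵢ x‖}`; the supremum is over a
set which is bounded above by `Good.bddAbove (good_tnorm P) x`. -/
theorem tnorm_eq (P : Params) (x : ℕ+ →₀ ℝ) :
    tnorm P x = max (c0Norm x) (sSup (adaptedSums P (tnorm P) x)) := by
  apply le_antisymm
  · refine ciSup_le fun i => ?_
    refine (iterNorm_mono P x (Nat.le_succ i)).trans ?_
    exact step_mono (iterNorm_le_tnorm P i) (good_tnorm P) x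
  · refine step_le (iterNorm_le_tnorm P 0 x) ?_
    rintro _ ⟨n, k, E, hE, rfl⟩
    have ht : Tendsto (fun j => P.θ n * ∑ i, iterNorm P j (restrict (E i) x)) atTop
        (𝓝 (P.θ n * ∑ i, tnorm P (restrict (E i) x))) :=
      (tendsto_finsetSum _ fun i _ => tendsto_iterNorm P _).const_mul _
    refine le_of_tendsto' ht fun j => ?_
    exact (le_step ((good_iterNorm P j).bddAbove x) ⟨n, k, E, hE, rfl⟩).trans
      (iterNorm_le_tnorm P (j + 1) x)

lemma Params.exists_bound (P : Params) : ∃ δ < 1, ∀ n, P.θ n ≤ δ := by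
  have h := P.θ_null.eventually (gt_mem_nhds (show (0 : ℝ) < 1 / 2 by norm_num))
  obtain ⟨M, hM⟩ := eventually_atTop.1 h
  obtain ⟨m, -, hm⟩ := (Finset.Iic M).exists_max_image P.θ ⟨M, by simp⟩
  refine ⟨max (P.θ m) (1 / 2), max_lt (P.θ_lt_one m) (by norm_num), fun n => ?_⟩
  rcases le_total n M with h1 | h1
  · exact (hm n (by simpa using h1)).trans (le_max_left _ _)
  · exact (hM n h1).le.trans (le_max_right _ _)

lemma le_of_fixed {P : Params} {p q : (ℕ+ →₀ ℝ) → ℝ} (p0 : p 0 = 0)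
    (hp : ∀ x, p x = step P p x)
    (bq : ∀ x, BddAbove (adaptedSums P q x)) (hq : ∀ x, q x = step P q x) (x : ℕ+ →₀ ℝ) :
    p x ≤ q x := by
  obtain ⟨δ, hδ, hθ⟩ := P.exists_bound
  have hp0 : ∀ x, 0 ≤ p x := fun x => by
    rw [hp]; exact (c0Norm_nonneg x).trans (c0Norm_le_step P p x)
  have hq0 : ∀ x, 0 ≤ q x := fun x => by
    rw [hq]; exact (c0Norm_nonneg x).trans (c0Norm_le_step P q x)
  induction hc : x.support.card using Nat.strong_induction_on generalizing x with
  | _ c ih =>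
    have key : p x ≤ max (q x) (δ * p x) := by
      conv_lhs => rw [hp]
      refine step_le ((c0Norm_le_step P q x).trans ((hq x).ge.trans (le_max_left _ _))) ?_
      rintro _ ⟨n, k, E, hE, rfl⟩
      by_cases hs : ∀ i, p (restrict (E i) x) ≤ q (restrict (E i) x)
      · refine le_trans ?_ (le_max_left _ _)
        rw [hq x]
        exact (mul_le_mul_of_nonneg_left (Finset.sum_le_sum fun i _ => hs i)
          (P.θ_pos n).le).trans (le_step (bq x) ⟨n, k, E, hE, rfl⟩)
      · refine le_trans ?_ (le_max_right _ _)
        push Not at hs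
        obtain ⟨i, hi⟩ := hs
        have hsupp : (restrict (E i) x).support = x.support := by
          by_contra hne
          have hlt := Finset.card_lt_card
            (Finset.ssubset_iff_subset_ne.2 ⟨support_restrict_subset (E i) x, hne⟩)
          exact absurd (ih _ (hc ▸ hlt) _ rfl) (not_le.2 hi)
        have hmem : ∀ a ∈ x.support, a ∈ E i := by
          intro a ha
          rw [← hsupp] at ha
          by_contra hna
          simp [restrict_apply, hna] at ha
        have h1 : restrict (E i) x = x := by
          ext a
          by_cases ha : a ∈ E i
          · simp [restrict_apply, ha]
          · have : x a = 0 := by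
              by_contra h'; exact ha (hmem a (by simpa using h'))
            simp [restrict_apply, this]
        have h2 : ∀ j, j ≠ i → restrict (E j) x = 0 := by
          intro j hj
          ext a
          by_cases ha : a ∈ E j
          · have : x a = 0 := by
              by_contra h'
              exact Set.disjoint_left.1 (hE.disjoint hj) ha (hmem a (by simpa using h'))
            simp [restrict_apply, this]
          · simp [restrict_apply, ha]
        rw [Finset.sum_eq_single i (fun j _ hj => by rw [h2 j hj, p0]) (by simp), h1]
        exact mul_le_mul_of_nonneg_right (hθ n) (hp0 x)
    rcases le_max_iff.1 key with h | h
    · exact h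
    · have : p x ≤ 0 := by nlinarith [hp0 x]
      exact this.trans (hq0 x)

lemma tnorm_zero (P : Params) : tnorm P 0 = 0 :=
  le_antisymm (by simpa [l1Norm] using (good_tnorm P).le_l1 0) ((good_tnorm P).nonneg 0)

/-- The implicit equation has no other solution. -/
theorem tnorm_unique (P : Params) (p : (ℕ+ →₀ ℝ) → ℝ) (p0 : p 0 = 0)
    (bp : ∀ x, BddAbove (adaptedSums P p x))
    (hp : ∀ x, p x = max (c0Norm x) (sSup (adaptedSums P p x))) : p = tnorm P := by
  funext x
  exact le_antisymm
    (le_of_fixed p0 hp (fun x => (good_tnorm P).bddAbove x) (tnorm_eq P) x)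
    (le_of_fixed (tnorm_zero P) (tnorm_eq P) bp hp x)

lemma tnorm_smul (P : Params) (c : ℝ) (x : ℕ+ →₀ ℝ) : tnorm P (c • x) = |c| * tnorm P x := by
  refine le_antisymm ((good_tnorm P).smul_le c x) ?_
  rcases eq_or_ne c 0 with rfl | hc
  · simpa using (good_tnorm P).nonneg _
  · have h := (good_tnorm P).smul_le c⁻¹ (c • x)
    rw [smul_smul, inv_mul_cancel₀ hc, one_smul, abs_inv] at h
    have hc' : 0 < |c| := abs_pos.2 hc
    calc |c| * tnorm P x ≤ |c| * (|c|⁻¹ * tnorm P (c • x)) :=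
          mul_le_mul_of_nonneg_left h hc'.le
      _ = tnorm P (c • x) := by field_simp

lemma tnorm_eq_zero_iff (P : Params) (x : ℕ+ →₀ ℝ) : tnorm P x = 0 ↔ x = 0 := by
  refine ⟨fun h => ?_, fun h => h ▸ tnorm_zero P⟩
  ext k
  have : |x k| ≤ 0 := h ▸ (abs_le_c0Norm x k).trans (iterNorm_le_tnorm P 0 x)
  simpa using this

/-! ## The space -/

/-- The vector space `c₀₀`, to be normed by `tnorm P`. -/
def C00 (_P : Params) : Type := ℕ+ →₀ ℝ

instance (P : Params) : AddCommGroup (C00 P) := inferInstanceAs (AddCommGroup (ℕ+ →₀ ℝ))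

instance (P : Params) : Module ℝ (C00 P) := inferInstanceAs (Module ℝ (ℕ+ →₀ ℝ))

instance (P : Params) : Norm (C00 P) := ⟨fun x => tnorm P x⟩

lemma C00.core (P : Params) : NormedSpace.Core ℝ (C00 P) where
  norm_nonneg x := (good_tnorm P).nonneg x
  norm_smul c x := tnorm_smul P c x
  norm_triangle x y := (good_tnorm P).add_le x y
  norm_eq_zero_iff x := tnorm_eq_zero_iff P x

instance (P : Params) : NormedAddCommGroup (C00 P) := NormedAddCommGroup.ofCore (C00.core P)

instance (P : Params) : NormedSpace ℝ (C00 P) := NormedSpace.ofCore (C00.core P)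

/-- The partly modified mixed Tsirelson space `T[(Sₙ, σₙ, θₙ)ₙ]`: the completion of `c₀₀` under
the norm `tnorm P`. -/
abbrev Space (P : Params) : Type := UniformSpace.Completion (C00 P)

/-- The unit vectors `(e_k)` of `c₀₀`, as elements of the space. -/
def unitVector (P : Params) (k : ℕ+) : Space P :=
  UniformSpace.Completion.coe' (α := C00 P) (Finsupp.single k (1 : ℝ) : ℕ+ →₀ ℝ)

/-! ## Block bases and subsequential minimality -/

section Sequences

variable {X Y : Type*} [NormedAddCommGroup X] [NormedSpace ℝ X]
  [NormedAddCommGroup Y] [NormedSpace ℝ Y]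

/-- `(x_k)` is a normalized block basis of `(e_k)`: unit vectors `x_k = ∑ i, c_k(i) e_i`, with
finitely supported nonzero `c_k` such that `supp c₁ < supp c₂ < ⋯`. -/
def IsNormalizedBlock (e x : ℕ+ → X) : Prop :=
  (∃ c : ℕ+ → (ℕ+ →₀ ℝ), (∀ k, c k ≠ 0) ∧
    (∀ k l, k < l → Precedes (c k).support (c l).support) ∧
    ∀ k, x k = ∑ i ∈ (c k).support, c k i • e i) ∧
  ∀ k, ‖x k‖ = 1

/-- `(x_n)` dominates `(y_n)`: `‖∑ aₙ yₙ‖ ≤ K ‖∑ aₙ xₙ‖` for all `(aₙ) ∈ c₀₀`. -/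
def Dominates (x : ℕ+ → X) (y : ℕ+ → Y) : Prop :=
  ∃ K : ℝ, ∀ a : ℕ+ →₀ ℝ,
    ‖∑ n ∈ a.support, a n • y n‖ ≤ K * ‖∑ n ∈ a.support, a n • x n‖

/-- Two sequences are equivalent if they dominate each other. -/
def IsEquivalent (x : ℕ+ → X) (y : ℕ+ → Y) : Prop := Dominates x y ∧ Dominates y x

/-- `(e_k)` is a normalized (Schauder) basis of the space, and every normalized block basis of
`(e_k)` has a further (normalized) block basis which is equivalent to a subsequence
of `(e_k)`. -/
structure IsSubsequentiallyMinimal (e : ℕ+ → X) : Prop where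
  basis : ∃ b : GeneralSchauderBasis ℕ+ ℝ X (SummationFilter.conditional ℕ+), b.basis = e
  norm_eq_one : ∀ k, ‖e k‖ = 1
  block : ∀ x : ℕ+ → X, IsNormalizedBlock e x →
    ∃ y : ℕ+ → X, IsNormalizedBlock x y ∧
      ∃ p : ℕ+ → ℕ+, StrictMono p ∧ IsEquivalent y (fun k => e (p k))

end Sequences

end Tsirelson

end

/-! Given a block basis, let `Y` be the span of its coefficient vectors in `c₀₀`. The aim is to find
unit vectors `y k` in `Y`, with large gaps between them, such that `(y k)` is equivalent to `(e_{p
k})` for suitable `p k` lying before the support of `y k`.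

That `(y k)` dominates `(e_{p k})` needs no special choice. An adapted family acting on the `e_{p
k}` lifts to unions of supports of the `y k`; the minima move to the right, and Schreier families
are spreading (`tnorm_mapDomain_le`).

For the converse, `y k` must not gain much from being split. Hypothesis (1) gives lower
`ℓ¹`-estimates with the constant `c = ε / 2` on `S_L`, for every `L` (`exists_lower_l1`). If
combinations over `S_L` could always be found with norm below `c`, then `r` normalizations would
lead to a unit vector with successive parts, admissible for `S_{rL}`, of total norm at least `c⁻ʳ`.
The norm forces `θₙ c⁻ʳ ≤ 1` for `n ≥ rL`, and (1) contradicts this. Now `y k` is a normalized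
special convex combination of order `l k` of vectors `z i` with this estimate. An adapted family of
order `j < l k` has sets starting strictly inside `z i` only for indices `i` of small total weight.
The sets that start no later than `z i` and act on it are at most `min supp (z i)` in number, and
because some `σ_s` is `M`, the sum of their norms on `z i` is at most `θ_s⁻¹`. The supremum of such
sums, `splitSup`, is superadditive, and its average over `i` is a superadditive set function `μ k`,
bounded uniformly in `k`, which controls all splittings of `y k` of order below `l k`
(`IsFastBlockSeq.isSplitBlock`).

The upper estimate is an induction over the tree of a norming functional `f`
(`SplitData.exists_isTransferable`). For an order `j`, a block is light (`j < l k`), or negligible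
because `θ j` is tiny compared with its `ℓ¹`-norm, or it is one single intermediate block. A
functional `g` acting on the `e_{p k}` is built so that `|f (y k)|` is bounded by a constant times
`g (p k)`, apart from two blocks and a summable error. At a node each child accounts for at most
four minima of the new family, and the gaps of ratio eight let a Schreier family absorb this factor
once the first light block is set aside (`schreier_sparse`). Superadditivity of `μ k` prevents the
constants from growing with the depth of the tree. -/

noncomputable section

namespace Tsirelson

/-! ## Combinatorics of the Schreier families -/

/-- `B` is the union of `m` successive (possibly empty) members of `𝓕`. -/
def IsChainOf (𝓕 : Set (Finset ℕ+)) : ℕ → Finset ℕ+ → Prop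
  | 0, B => B = ∅
  | m + 1, B => ∃ G H, G ∈ 𝓕 ∧ IsChainOf 𝓕 m H ∧ Precedes G H ∧ B = G ∪ H

lemma IsChainOf.exists_fin {𝓕 : Set (Finset ℕ+)} {m : ℕ} {B : Finset ℕ+}
    (h : IsChainOf 𝓕 m B) : ∃ k ≤ m, ∃ G : Fin k → Finset ℕ+, (∀ i, (G i).Nonempty) ∧
      (∀ i, G i ∈ 𝓕) ∧ (∀ i j, i < j → Precedes (G i) (G j)) ∧ B = Finset.univ.biUnion G := by
  induction m generalizing B with
  | zero =>
    refine ⟨0, le_rfl, fun i => i.elim0, fun i => i.elim0, fun i => i.elim0, fun i => i.elim0, ?_⟩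
    have h' : B = ∅ := h
    simp [h']
  | succ m ih =>
    obtain ⟨G, H, hG, hH, hGH, rfl⟩ := h
    obtain ⟨k, hk, E, h1, h2, h3, rfl⟩ := ih hH
    rcases G.eq_empty_or_nonempty with rfl | hne
    · exact ⟨k, hk.trans (Nat.le_succ m), E, h1, h2, h3, by simp⟩
    · refine ⟨k + 1, Nat.succ_le_succ hk, Fin.cons G E, ?_, ?_, ?_, ?_⟩
      · exact Fin.cases hne h1
      · exact Fin.cases hG h2
      · intro i j
        refine Fin.cases ?_ (fun i => ?_) i <;> refine Fin.cases ?_ (fun j => ?_) j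
        · intro h; exact absurd h (lt_irrefl _)
        · intro _ a ha b hb
          exact hGH a (by simpa using ha) b
            (Finset.mem_biUnion.2 ⟨j, Finset.mem_univ _, by simpa using hb⟩)
        · intro h; exact absurd h (by simp)
        · intro h; simpa using h3 i j (by simpa using h)
      · ext a
        simp [Fin.exists_fin_succ]

lemma isChainOf_fin {𝓕 : Set (Finset ℕ+)} {k : ℕ} {G : Fin k → Finset ℕ+}
    (h1 : ∀ i, G i ∈ 𝓕) (h2 : ∀ i j, i < j → Precedes (G i) (G j)) :
    IsChainOf 𝓕 k (Finset.univ.biUnion G) := by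
  induction k with
  | zero => simp [IsChainOf]
  | succ k ih =>
    refine ⟨G 0, Finset.univ.biUnion fun i : Fin k => G i.succ, h1 0,
      ih (fun i => h1 _) (fun i j hij => h2 _ _ (by simpa using hij)), ?_, ?_⟩
    · intro a ha b hb
      obtain ⟨i, -, hi⟩ := Finset.mem_biUnion.1 hb
      exact h2 0 i.succ (Fin.succ_pos i) a ha b hi
    · ext a
      simp [Fin.exists_fin_succ]

lemma isChainOf_schreier_zero (B : Finset ℕ+) : IsChainOf (schreier 0) B.card B := by
  induction B using Finset.induction_on_min with
  | empty => simp [IsChainOf]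
  | insert a s h ih =>
    have ha : a ∉ s := fun h' => lt_irrefl _ (h a h')
    rw [Finset.card_insert_of_notMem ha]
    refine ⟨{a}, s, by simp [schreier], ih, ?_, Finset.insert_eq _ _⟩
    intro b hb c hc
    obtain rfl : b = a := by simpa using hb
    exact h c hc

lemma IsChainOf.card_le {m : ℕ} {B : Finset ℕ+} (h : IsChainOf (schreier 0) m B) :
    B.card ≤ m := by
  induction m generalizing B with
  | zero => have h' : B = ∅ := h; simp [h']
  | succ m ih =>
    obtain ⟨G, H, hG, hH, -, rfl⟩ := h
    have : G.card ≤ 1 := hG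
    have := ih hH
    have := Finset.card_union_le G H
    omega

/-- The uniform description of the passage from `Sₙ` to `Sₙ₊₁`. -/
lemma mem_schreier_succ {n : ℕ} {B : Finset ℕ+} :
    B ∈ schreier (n + 1) ↔ ∃ m, IsChainOf (schreier n) m B ∧ ∀ b ∈ B, m ≤ (b : ℕ) := by
  cases n with
  | zero =>
    constructor
    · intro h
      exact ⟨B.card, isChainOf_schreier_zero B, h⟩
    · rintro ⟨m, h, hm⟩ b hb
      exact h.card_le.trans (hm b hb)
  | succ n =>
    constructor
    · rintro ⟨k, G, hG, h1, h2, h3, rfl⟩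
      refine ⟨k, isChainOf_fin h1 h2, ?_⟩
      intro b hb
      obtain ⟨i, -, hi⟩ := Finset.mem_biUnion.1 hb
      have hinj : Function.Injective fun i => (G i).min' (hG i) := by
        have : StrictMono fun i => (G i).min' (hG i) := fun i j hij =>
          h2 i j hij _ (Finset.min'_mem _ _) _ (Finset.min'_mem _ _)
        exact this.injective
      have hc := h3 ((G i).min' (hG i)) (Finset.mem_image_of_mem _ (Finset.mem_univ i))
      rw [Finset.card_image_of_injective _ hinj, Finset.card_univ, Fintype.card_fin] at hc
      exact hc.trans (PNat.coe_le_coe _ _ |>.2 (Finset.min'_le _ _ hi))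
    · rintro ⟨m, h, hm⟩
      obtain ⟨k, hk, G, h1, h2, h3, rfl⟩ := h.exists_fin
      refine ⟨k, G, h1, h2, h3, ?_, rfl⟩
      intro a ha
      obtain ⟨i, -, rfl⟩ := Finset.mem_image.1 ha
      refine (Finset.card_image_le.trans (by simp)).trans (hk.trans (hm _ ?_))
      exact Finset.mem_biUnion.2 ⟨i, Finset.mem_univ i, Finset.min'_mem _ _⟩

lemma isChainOf_empty (n m : ℕ) : IsChainOf (schreier n) m ∅ := by
  induction m with
  | zero => rfl
  | succ m ih => exact ⟨∅, ∅, schreier_empty n, ih, by simp [Precedes], by simp⟩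

lemma isChainOf_one {n : ℕ} {B : Finset ℕ+} (h : B ∈ schreier n) :
    IsChainOf (schreier n) 1 B :=
  ⟨B, ∅, h, rfl, by simp [Precedes], by simp⟩

lemma IsChainOf.mono {n m m' : ℕ} (hm : m ≤ m') {B : Finset ℕ+}
    (h : IsChainOf (schreier n) m B) : IsChainOf (schreier n) m' B := by
  induction m', hm using Nat.le_induction with
  | base => exact h
  | succ m' _ ih => exact ⟨∅, B, schreier_empty n, ih, by simp [Precedes], by simp⟩

lemma IsChainOf.union {𝓕 : Set (Finset ℕ+)} {m m' : ℕ} {A B : Finset ℕ+}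
    (hA : IsChainOf 𝓕 m A) (hB : IsChainOf 𝓕 m' B) (hAB : Precedes A B) :
    IsChainOf 𝓕 (m + m') (A ∪ B) := by
  induction m generalizing A with
  | zero => have h' : A = ∅ := hA; simpa [h'] using hB
  | succ m ih =>
    obtain ⟨G, H, hG, hH, hGH, rfl⟩ := hA
    rw [Nat.succ_add]
    refine ⟨G, H ∪ B, hG, ih hH fun a ha b hb => hAB a (by simp [ha]) b hb, ?_,
      Finset.union_assoc _ _ _⟩
    intro a ha b hb
    rcases Finset.mem_union.1 hb with hb | hb
    · exact hGH a ha b hb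
    · exact hAB a (by simp [ha]) b hb

lemma schreier_mono {n n' : ℕ} (h : n ≤ n') : schreier n ⊆ schreier n' := by
  induction n', h using Nat.le_induction with
  | base => exact le_rfl
  | succ n' _ ih =>
    exact ih.trans fun B hB => mem_schreier_succ.2 ⟨1, isChainOf_one hB, fun b _ => b.pos⟩

/-- A chain of sets in `𝓕` pulls back, along a monotone map, to a chain of blocks. -/
lemma IsChainOf.transfer {ι : Type*} [LinearOrder ι] {𝓕 𝓖 : Set (Finset ℕ+)} {d : ℕ}
    {C : Finset ι} {ψ : ι → ℕ+} (hψ : MonotoneOn ψ C) {U : ι → Finset ℕ+}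
    (hU : ∀ i ∈ C, ∀ j ∈ C, i < j → Precedes (U i) (U j))
    (hd : ∀ G ∈ 𝓕, ∀ D ⊆ C, (∀ i ∈ D, ψ i ∈ G) → IsChainOf 𝓖 d (D.biUnion U))
    {m : ℕ} {A : Finset ℕ+} (hA : IsChainOf 𝓕 m A) {D : Finset ι} (hD : D ⊆ C)
    (hDA : ∀ i ∈ D, ψ i ∈ A) : IsChainOf 𝓖 (d * m) (D.biUnion U) := by
  classical
  induction m generalizing A D with
  | zero =>
    have h' : A = ∅ := hA
    have : D = ∅ := Finset.eq_empty_of_forall_notMem fun i hi => by simpa [h'] using hDA i hi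
    simp [this, IsChainOf]
  | succ m ih =>
    obtain ⟨G, H, hG, hH, hGH, rfl⟩ := hA
    have h1 := hd G hG (D.filter fun i => ψ i ∈ G) ((Finset.filter_subset _ _).trans hD)
      (fun i hi => (Finset.mem_filter.1 hi).2)
    have hmem : ∀ i ∈ D.filter (fun i => ψ i ∉ G), ψ i ∈ H := fun i hi => by
      obtain ⟨hi, hi'⟩ := Finset.mem_filter.1 hi
      exact (Finset.mem_union.1 (hDA i hi)).resolve_left hi'
    have h2 := ih hH (D := D.filter fun i => ψ i ∉ G) ((Finset.filter_subset _ _).trans hD) hmem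
    have := h1.union h2 ?_
    · rw [← Finset.union_biUnion, Finset.filter_union_filter_not_eq] at this
      convert this using 1; ring
    · intro a ha b hb
      obtain ⟨i, hi, hai⟩ := Finset.mem_biUnion.1 ha
      obtain ⟨j, hj, hbj⟩ := Finset.mem_biUnion.1 hb
      have hi' := Finset.mem_filter.1 hi
      have hj' := Finset.mem_filter.1 hj
      refine hU i (hD hi'.1) j (hD hj'.1) ?_ a hai b hbj
      by_contra hij
      exact absurd (hψ (hD hj'.1) (hD hi'.1) (not_lt.1 hij))
        (not_le.2 (hGH _ hi'.2 _ (hmem j hj)))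

/-- A map into a finite set can be rearranged to a monotone one, keeping the fibres' sizes and
the bound by a monotone function. -/
lemma exists_monotone_rearrangement {ι κ : Type*} [LinearOrder ι] [LinearOrder κ] (C : Finset ι)
    (φ h : ι → κ) (hh : MonotoneOn h C) (hφ : ∀ c ∈ C, φ c ≤ h c) :
    ∃ ψ : ι → κ, MonotoneOn ψ C ∧ (∀ c ∈ C, ψ c ≤ h c) ∧
      ∀ a, (C.filter fun c => ψ c = a).card = (C.filter fun c => φ c = a).card := by
  classical
  induction C using Finset.induction_on_max generalizing φ with
  | empty => exact ⟨φ, by simp [MonotoneOn], by simp, fun a => rfl⟩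
  | insert M C hM ih =>
    have hMC : M ∉ C := fun h' => lt_irrefl _ (hM M h')
    -- The largest value is exchanged with the value at the largest index `M`. Both bounds survive,
    -- since `φ M ≤ φ c' ≤ h c' ≤ h M`.
    obtain ⟨c', hc', hmax⟩ := (insert M C).exists_max_image φ ⟨M, by simp⟩
    set σ := Equiv.swap c' M
    have hσmem : ∀ c, c ∈ insert M C ↔ σ c ∈ insert M C := by
      intro c
      by_cases h1 : c = c'
      · subst h1; simp [σ, hc']
      by_cases h2 : c = M
      · subst h2; simpa [σ] using hc'
      rw [Equiv.swap_apply_of_ne_of_ne h1 h2]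
    obtain ⟨ψ, h1, h2, h3⟩ := ih (φ ∘ σ) (hh.mono (by simp)) (by
      intro c hc
      have hcM : c ≠ M := fun h' => hMC (h' ▸ hc)
      by_cases h1 : c = c'
      · subst h1
        simp only [Function.comp, σ, Equiv.swap_apply_left]
        exact (hmax M (by simp)).trans (hφ c (by simp [hc]))
      · simp only [Function.comp, σ, Equiv.swap_apply_of_ne_of_ne h1 hcM]
        exact hφ c (by simp [hc]))
    have hψ : ∀ c ∈ C, ψ c ≤ φ c' := by
      intro c hc
      have : 0 < (C.filter fun d => ψ d = ψ c).card :=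
        Finset.card_pos.2 ⟨c, by simp [hc]⟩
      rw [h3] at this
      obtain ⟨d, hd⟩ := Finset.card_pos.1 this
      obtain ⟨hd1, hd2⟩ := Finset.mem_filter.1 hd
      rw [← hd2]
      exact hmax _ ((hσmem d).1 (by simp [hd1]))
    have hne : ∀ c ∈ C, c ≠ M := fun c hc h' => hMC (h' ▸ hc)
    refine ⟨Function.update ψ M (φ c'), ?_, ?_, ?_⟩
    · intro a ha b hb hab
      simp only [Finset.coe_insert, Set.mem_insert_iff, Finset.mem_coe] at ha hb
      rcases ha with rfl | ha <;> rcases hb with rfl | hb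
      · rfl
      · exact absurd (hM b hb) (not_lt.2 hab)
      · simpa [Function.update_of_ne (hne a ha)] using hψ a ha
      · simpa [Function.update_of_ne (hne a ha), Function.update_of_ne (hne b hb)]
          using h1 ha hb hab
    · intro c hc
      rcases Finset.mem_insert.1 hc with rfl | hc
      · simp only [Function.update_self]
        refine (hφ c' hc').trans (hh (by exact_mod_cast hc') (by simp) ?_)
        rcases Finset.mem_insert.1 hc' with rfl | h'
        · rfl
        · exact (hM _ h').le
      · rw [Function.update_of_ne (hne c hc)]
        exact h2 c hc
    · intro a
      have e1 : ((insert M C).filter fun c => φ c = a).card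
          = ((insert M C).filter fun c => (φ ∘ σ) c = a).card := by
        rw [Finset.card_filter, Finset.card_filter]
        exact (Finset.sum_equiv σ hσmem (fun c _ => rfl)).symm
      rw [e1, Finset.filter_insert, Finset.filter_insert]
      have e2 : (C.filter fun c => Function.update ψ M (φ c') c = a)
          = C.filter fun c => ψ c = a :=
        Finset.filter_congr fun c hc => by rw [Function.update_of_ne (hne c hc)]
      have e3 : (φ ∘ σ) M = φ c' := by simp [σ]
      rw [e2, e3, Function.update_self]
      have hn1 : M ∉ C.filter fun c => ψ c = a := fun h' => hMC (Finset.mem_filter.1 h').1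
      have hn2 : M ∉ C.filter fun c => (φ ∘ σ) c = a := fun h' => hMC (Finset.mem_filter.1 h').1
      by_cases ha : φ c' = a
      · rw [if_pos ha, if_pos ha, Finset.card_insert_of_notMem hn1,
          Finset.card_insert_of_notMem hn2, h3]
      · rw [if_neg ha, if_neg ha, h3]

lemma mem_of_fibre_card {ι κ : Type*} [DecidableEq κ] {C : Finset ι} {φ ψ : ι → κ}
    (h : ∀ a, (C.filter fun c => ψ c = a).card = (C.filter fun c => φ c = a).card)
    {c : ι} (hc : c ∈ C) : ∃ d ∈ C, φ d = ψ c := by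
  have : 0 < (C.filter fun d => ψ d = ψ c).card := Finset.card_pos.2 ⟨c, by simp [hc]⟩
  rw [h] at this
  obtain ⟨d, hd⟩ := Finset.card_pos.1 this
  exact ⟨d, Finset.mem_filter.1 hd⟩

/-- Induction on `n`: a monotone map pulls the pieces of a chain for `A` back to the pieces of a
chain for `C`, and `ψ c ≤ c` keeps the number of pieces below every element of `C`. -/
lemma schreier_spread_of_monotoneOn {n : ℕ} {A C : Finset ℕ+} (hA : A ∈ schreier n)
    {ψ : ℕ+ → ℕ+} (hψ : MonotoneOn ψ C) (hinj : Set.InjOn ψ C) (hmem : ∀ c ∈ C, ψ c ∈ A)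
    (hle : ∀ c ∈ C, ψ c ≤ c) : C ∈ schreier n := by
  classical
  induction n generalizing A C with
  | zero =>
    exact (Finset.card_le_card_of_injOn ψ hmem hinj).trans hA
  | succ n ih =>
    obtain ⟨m, hm, hb⟩ := mem_schreier_succ.1 hA
    have := hm.transfer (𝓖 := schreier n) (d := 1) hψ (U := fun c => {c})
      (by intro i _ j _ hij; simpa [Precedes] using hij)
      (by
        intro G hG D hD hDG
        rw [Finset.biUnion_singleton_eq_self]
        exact isChainOf_one (ih hG (hψ.mono (by exact_mod_cast hD))
          (hinj.mono (by exact_mod_cast hD)) hDG fun c hc => hle c (hD hc)))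
      (Finset.Subset.refl C) hmem
    rw [Finset.biUnion_singleton_eq_self, one_mul] at this
    exact mem_schreier_succ.2 ⟨m, this, fun c hc => (hb _ (hmem c hc)).trans (hle c hc)⟩

/-- The Schreier families are spreading and hereditary. -/
lemma schreier_spread {n : ℕ} {A C : Finset ℕ+} (hA : A ∈ schreier n)
    {φ : ℕ+ → ℕ+} (hinj : Set.InjOn φ C) (hmem : ∀ c ∈ C, φ c ∈ A)
    (hle : ∀ c ∈ C, φ c ≤ c) : C ∈ schreier n := by
  classical
  -- `φ` is injective but perhaps not monotone. The rearrangement is monotone, and its fibres still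
  -- have at most one point.
  obtain ⟨ψ, h1, h2, h3⟩ := exists_monotone_rearrangement C φ id (monotone_id.monotoneOn _) hle
  refine schreier_spread_of_monotoneOn hA h1 ?_ ?_ h2
  · intro a ha b hb hab
    have h4 : (C.filter fun c => φ c = ψ a).card ≤ 1 := by
      refine Finset.card_le_one.2 fun x hx y hy => ?_
      simp only [Finset.mem_filter] at hx hy
      exact hinj (by exact_mod_cast hx.1) (by exact_mod_cast hy.1) (hx.2.trans hy.2.symm)
    rw [← h3] at h4
    exact Finset.card_le_one.1 h4 a (by simpa using ha) b (by simpa [hab] using hb)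
  · intro c hc
    obtain ⟨d, hd, hd'⟩ := mem_of_fibre_card h3 hc
    exact hd' ▸ hmem d hd

lemma schreier_subset {n : ℕ} {A C : Finset ℕ+} (hA : A ∈ schreier n) (h : C ⊆ A) :
    C ∈ schreier n :=
  schreier_spread (φ := id) hA (Set.injOn_id _) (fun _ hc => h hc) fun _ _ => le_rfl

lemma IsChainOf.subset {n m : ℕ} {A C : Finset ℕ+} (hA : IsChainOf (schreier n) m A)
    (h : C ⊆ A) : IsChainOf (schreier n) m C := by
  have := hA.transfer (𝓖 := schreier n) (d := 1) (C := C) (ψ := id) (monotone_id.monotoneOn _)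
    (U := fun c => {c}) (by intro i _ j _ hij; simpa [Precedes] using hij)
    (by
      intro G hG D _ hDG
      rw [Finset.biUnion_singleton_eq_self]
      exact isChainOf_one (schreier_subset hG hDG))
    (Finset.Subset.refl C) (fun c hc => h hc)
  rwa [Finset.biUnion_singleton_eq_self, one_mul] at this

/-- `S_a[S_b] ⊆ S_{b+a}`. -/
lemma schreier_biUnion_mem {ι : Type*} [LinearOrder ι] {a b : ℕ} {J : Finset ι} {m : ι → ℕ+}
    (hm : StrictMonoOn m J) (hJ : J.image m ∈ schreier a) {A : ι → Finset ℕ+}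
    (hA : ∀ i ∈ J, A i ∈ schreier b) (hmA : ∀ i ∈ J, ∀ x ∈ A i, m i ≤ x)
    (hAA : ∀ i ∈ J, ∀ j ∈ J, i < j → Precedes (A i) (A j)) :
    J.biUnion A ∈ schreier (b + a) := by
  classical
  induction a generalizing J with
  | zero =>
    have h1 : J.card ≤ 1 := by
      rw [← Finset.card_image_of_injOn hm.injOn]; exact hJ
    rcases J.eq_empty_or_nonempty with rfl | ⟨i, hi⟩
    · simpa using schreier_empty _
    · obtain rfl : J = {i} := Finset.eq_singleton_iff_unique_mem.2
        ⟨hi, fun j hj => Finset.card_le_one.1 h1 j hj i hi⟩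
      simpa using hA i hi
  | succ a ih =>
    obtain ⟨M, hM, hb⟩ := mem_schreier_succ.1 hJ
    have := hM.transfer (𝓖 := schreier (b + a)) (d := 1) hm.monotoneOn (U := A) hAA
      (by
        intro G hG D hD hDG
        refine isChainOf_one (ih (hm.mono (by exact_mod_cast hD)) (schreier_subset hG ?_)
          (fun i hi => hA i (hD hi)) (fun i hi => hmA i (hD hi))
          fun i hi j hj => hAA i (hD hi) j (hD hj))
        intro x hx
        obtain ⟨i, hi, rfl⟩ := Finset.mem_image.1 hx
        exact hDG i hi)
      (Finset.Subset.refl J) (fun i hi => Finset.mem_image_of_mem m hi)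
    rw [one_mul] at this
    refine mem_schreier_succ.2 ⟨M, this, fun x hx => ?_⟩
    obtain ⟨i, hi, hx⟩ := Finset.mem_biUnion.1 hx
    exact (hb _ (Finset.mem_image_of_mem m hi)).trans (hmA i hi x hx)

/-- For `S₁` the count `|C| ≤ 4 |A| ≤ 4 a` suffices. In the induction step, the indices over one
piece of the chain of `A` lose their first index `k`; the others satisfy `8 ψ k ≤ 8 q k ≤ p c`, so
they inherit `hfar` with `a = ψ k`. Each piece thus costs two, and `2 M ≤ 8 a ≤ p c` admits them
all. -/
lemma schreier_sparse_of_monotoneOn {ι : Type*} [LinearOrder ι] {n : ℕ} {p q ψ : ι → ℕ+}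
    {A : Finset ℕ+} (hA : A ∈ schreier (n + 1)) {C : Finset ι}
    (hpq : ∀ i ∈ C, p i ≤ q i) (hqp : ∀ i ∈ C, ∀ j ∈ C, i < j → 8 * q i ≤ p j)
    (hψ : MonotoneOn ψ C) (hfib : ∀ a, (C.filter fun c => ψ c = a).card ≤ 4)
    (hψA : ∀ c ∈ C, ψ c ∈ A) (hψq : ∀ c ∈ C, ψ c ≤ q c)
    (hfar : ∀ c ∈ C, ∃ a ∈ A, 8 * a ≤ p c) : C.image p ∈ schreier (n + 1) := by
  classical
  have hlt : ∀ i ∈ C, ∀ j ∈ C, i < j → p i < p j := fun i hi j hj hij => by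
    have h1 := hqp i hi j hj hij
    have h2 := hpq i hi
    rw [← PNat.coe_le_coe] at h1 h2
    rw [← PNat.coe_lt_coe]
    push_cast at h1
    have := (q i).pos
    have : ((8 : ℕ+) : ℕ) = 8 := rfl
    omega
  induction n generalizing A C with
  | zero =>
    intro x hx
    obtain ⟨c, hc, rfl⟩ := Finset.mem_image.1 hx
    obtain ⟨a, ha, hac⟩ := hfar c hc
    have h1 : A.card ≤ a := hA a ha
    have h2 : C.card ≤ 4 * A.card := Finset.card_le_mul_card_image_of_maps_to hψA 4
      fun a _ => hfib a
    have h3 : (C.image p).card ≤ C.card := Finset.card_image_le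
    rw [← PNat.coe_le_coe] at hac
    push_cast at hac
    have : ((8 : ℕ+) : ℕ) = 8 := rfl
    omega
  | succ n ih =>
    obtain ⟨M, hM, hb⟩ := mem_schreier_succ.1 hA
    have := hM.transfer (𝓖 := schreier (n + 1)) (d := 2) hψ (U := fun c => {p c})
      (by intro i hi j hj hij; simpa [Precedes] using hlt i hi j hj hij)
      (by
        intro G hG D hD hDG
        rw [Finset.biUnion_singleton]
        rcases D.eq_empty_or_nonempty with rfl | hne
        · simpa using isChainOf_empty _ _
        set k := D.min' hne
        have hk : k ∈ D := Finset.min'_mem _ _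
        have hlt' : ∀ j ∈ D.erase k, k < j := fun j hj =>
          lt_of_le_of_ne (Finset.min'_le _ _ (Finset.mem_of_mem_erase hj))
            (Finset.ne_of_mem_erase hj).symm
        have hsub : D.erase k ⊆ C := (Finset.erase_subset _ _).trans hD
        have h1 : (D.erase k).image p ∈ schreier (n + 1) := by
          refine ih hG (fun i hi => hpq i (hsub hi))
            (fun i hi j hj => hqp i (hsub hi) j (hsub hj))
            (hψ.mono (by exact_mod_cast hsub))
            (fun a => (Finset.card_le_card (Finset.filter_subset_filter _ hsub)).trans (hfib a))
            (fun c hc => hDG c (Finset.mem_of_mem_erase hc)) (fun c hc => hψq c (hsub hc))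
            (fun c hc => ⟨ψ k, hDG k hk, ?_⟩)
            (fun i hi j hj => hlt i (hsub hi) j (hsub hj))
          exact (mul_le_mul_right (hψq k (hD hk)) 8).trans
            (hqp k (hD hk) c (hsub hc) (hlt' c hc))
        refine ⟨{p k}, (D.erase k).image p, ?_, isChainOf_one h1, ?_, ?_⟩
        · exact schreier_mono (Nat.zero_le _) (by simp [schreier])
        · intro a ha b hb
          obtain rfl : a = p k := by simpa using ha
          obtain ⟨j, hj, rfl⟩ := Finset.mem_image.1 hb
          exact hlt k (hD hk) j (hsub hj) (hlt' j hj)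
        · rw [← Finset.insert_eq, ← Finset.image_insert, Finset.insert_erase hk])
      (Finset.Subset.refl C) hψA
    rw [Finset.biUnion_singleton] at this
    refine mem_schreier_succ.2 ⟨2 * M, this, fun x hx => ?_⟩
    obtain ⟨c, hc, rfl⟩ := Finset.mem_image.1 hx
    obtain ⟨a, ha, hac⟩ := hfar c hc
    have := hb a ha
    rw [← PNat.coe_le_coe] at hac
    push_cast at hac
    have : ((8 : ℕ+) : ℕ) = 8 := rfl
    omega

/-- Along a sparse sequence, the Schreier families absorb at most four points for each point of a
member, apart from the first ones. -/
lemma schreier_sparse {ι : Type*} [LinearOrder ι] {n : ℕ} (hn : n ≠ 0) {p q φ : ι → ℕ+}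
    {A : Finset ℕ+} (hA : A ∈ schreier n) {C : Finset ι}
    (hpq : ∀ i ∈ C, p i ≤ q i) (hqp : ∀ i ∈ C, ∀ j ∈ C, i < j → 8 * q i ≤ p j)
    (hfib : ∀ a, (C.filter fun c => φ c = a).card ≤ 4)
    (hφA : ∀ c ∈ C, φ c ∈ A) (hφq : ∀ c ∈ C, φ c ≤ q c)
    (hfar : ∀ c ∈ C, ∃ a ∈ A, 8 * a ≤ p c) : C.image p ∈ schreier n := by
  classical
  obtain ⟨n, rfl⟩ := Nat.exists_eq_succ_of_ne_zero hn
  have hq : MonotoneOn q C := by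
    intro i hi j hj hij
    rcases hij.eq_or_lt with rfl | hij
    · rfl
    · refine le_trans ?_ ((hqp i hi j hj hij).trans (hpq j hj))
      rw [← PNat.coe_le_coe]
      push_cast
      have : ((8 : ℕ+) : ℕ) = 8 := rfl
      omega
  obtain ⟨ψ, h1, h2, h3⟩ := exists_monotone_rearrangement C φ q hq hφq
  refine schreier_sparse_of_monotoneOn hA hpq hqp h1 (fun a => h3 a ▸ hfib a) ?_ h2 hfar
  intro c hc
  obtain ⟨d, hd, hd'⟩ := mem_of_fibre_card h3 hc
  exact hd' ▸ hφA d hd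

/-! ### Special convex combinations -/

lemma IsChainOf.sum_le {n M : ℕ} {m : ℕ → ℕ+} {b : ℕ → ℝ} {η : ℝ} {J : Finset ℕ}
    (hη : ∀ B ⊆ J, B.image m ∈ schreier n → ∑ i ∈ B, b i ≤ η)
    {B : Finset ℕ} (hB : B ⊆ J) (h : IsChainOf (schreier n) M (B.image m)) :
    ∑ i ∈ B, b i ≤ M * η := by
  induction M generalizing B with
  | zero =>
    have h' : B.image m = ∅ := h
    simp [Finset.image_eq_empty.1 h']
  | succ M ih =>
    obtain ⟨G, H, hG, hH, -, hu⟩ := h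
    rw [← Finset.sum_filter_add_sum_filter_not B fun i => m i ∈ G]
    have h1 := hη (B.filter fun i => m i ∈ G) ((Finset.filter_subset _ _).trans hB)
      (schreier_subset hG (by
        intro x hx
        obtain ⟨i, hi, rfl⟩ := Finset.mem_image.1 hx
        exact (Finset.mem_filter.1 hi).2))
    have h2 := ih (B := B.filter fun i => m i ∉ G) ((Finset.filter_subset _ _).trans hB)
      (hH.subset (by
        intro x hx
        obtain ⟨i, hi, rfl⟩ := Finset.mem_image.1 hx
        obtain ⟨hi, hi'⟩ := Finset.mem_filter.1 hi
        have : m i ∈ G ∪ H := hu ▸ Finset.mem_image_of_mem m hi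
        exact (Finset.mem_union.1 this).resolve_left hi'))
    push_cast
    linarith

/-- `b` is a convex combination on `J`, whose index set lies in `Sₗ₊₁`, and which is small on
members of `Sₗ`. -/
structure IsSpecialConvex (m : ℕ → ℕ+) (l : ℕ) (η : ℝ) (J : Finset ℕ) (b : ℕ → ℝ) : Prop where
  nonneg : ∀ i, 0 ≤ b i
  sum_eq : ∑ i ∈ J, b i = 1
  mem : J.image m ∈ schreier (l + 1)
  small : ∀ B ⊆ J, B.image m ∈ schreier l → ∑ i ∈ B, b i ≤ η

/-- A member of `Sₗ₊₁` that meets the first piece has its minimum at most `m K`, hence is a chain of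
at most `m K` members of `Sₗ`. The later pieces are chosen small on such chains, so a member of
`Sₗ₊₁` sees essentially one piece. The clause about chains of length `M` carries this smallness
through the recursion. -/
lemma exists_specialConvex_pieces {m : ℕ → ℕ+} (hm : StrictMono m) {l : ℕ}
    (ih : ∀ (η : ℝ), 0 < η → ∀ N : ℕ, ∃ J b, (∀ i ∈ J, N ≤ i) ∧ IsSpecialConvex m l η J b)
    (r : ℕ) (η : ℝ) (hη : 0 < η) (N M : ℕ) :
    ∃ (J : Finset ℕ) (b : ℕ → ℝ), (∀ i ∈ J, N ≤ i) ∧ (∀ i, 0 ≤ b i) ∧ ∑ i ∈ J, b i = r ∧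
      IsChainOf (schreier (l + 1)) r (J.image m) ∧
      (∀ B ⊆ J, IsChainOf (schreier l) M (B.image m) → ∑ i ∈ B, b i ≤ η) ∧
      (∀ B ⊆ J, B.image m ∈ schreier (l + 1) → ∑ i ∈ B, b i ≤ 1 + η) := by
  classical
  induction r generalizing η N M with
  | zero =>
    refine ⟨∅, 0, by simp, by simp, by simp, rfl, ?_, ?_⟩
    · intro B hB _; simp [Finset.subset_empty.1 hB, hη.le]
    · intro B hB _; simp [Finset.subset_empty.1 hB]; linarith
  | succ r ihr =>
    obtain ⟨J₁, b₁, hN₁, hJ₁⟩ := ih (η / (2 * (M + 1))) (by positivity) N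
    have hne : J₁.Nonempty := by
      rw [Finset.nonempty_iff_ne_empty]
      rintro rfl
      simpa using hJ₁.sum_eq
    set K := J₁.max' hne
    have hK : ∀ i ∈ J₁, i ≤ K := fun i hi => Finset.le_max' _ _ hi
    obtain ⟨J₂, b₂, hN₂, h0, hsum, hch, hi, hii⟩ := ihr (η / 2) (by positivity) (max N (K + 1))
      (max M (m K))
    have hJJ : ∀ i ∈ J₁, ∀ j ∈ J₂, i < j := fun i hi j hj => by
      have h1 := hK i hi
      have h2 := (le_max_right _ _).trans (hN₂ j hj)
      omega
    have hdisj : Disjoint J₁ J₂ := Finset.disjoint_left.2 fun i h1 h2 => lt_irrefl _ (hJJ i h1 i h2)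
    set b : ℕ → ℝ := fun i => if i ∈ J₁ then b₁ i else b₂ i
    have e1 : ∀ B ⊆ J₁, ∑ i ∈ B, b i = ∑ i ∈ B, b₁ i := fun B hB =>
      Finset.sum_congr rfl fun i hi => by simp [b, hB hi]
    have e2 : ∀ B ⊆ J₂, ∑ i ∈ B, b i = ∑ i ∈ B, b₂ i := fun B hB =>
      Finset.sum_congr rfl fun i hi => by
        have : i ∉ J₁ := fun h' => lt_irrefl _ (hJJ i h' i (hB hi))
        simp [b, this]
    have split : ∀ B ⊆ J₁ ∪ J₂, ∑ i ∈ B, b i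
        = ∑ i ∈ B.filter (· ∈ J₁), b₁ i + ∑ i ∈ B.filter (· ∉ J₁), b₂ i := by
      intro B hB
      rw [← Finset.sum_filter_add_sum_filter_not B (· ∈ J₁), e1, e2]
      · intro i hi
        obtain ⟨hi, hi'⟩ := Finset.mem_filter.1 hi
        exact (Finset.mem_union.1 (hB hi)).resolve_left hi'
      · intro i hi; exact (Finset.mem_filter.1 hi).2
    have sub1 : ∀ B : Finset ℕ, B.filter (· ∈ J₁) ⊆ J₁ := fun B i hi => (Finset.mem_filter.1 hi).2
    have sub2 : ∀ B ⊆ J₁ ∪ J₂, B.filter (· ∉ J₁) ⊆ J₂ := fun B hB i hi => by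
      obtain ⟨hi, hi'⟩ := Finset.mem_filter.1 hi
      exact (Finset.mem_union.1 (hB hi)).resolve_left hi'
    have himg : ∀ (B : Finset ℕ) (p : ℕ → Prop) [DecidablePred p],
        (B.filter p).image m ⊆ B.image m :=
      fun B p _ => Finset.image_subset_image (Finset.filter_subset _ _)
    refine ⟨J₁ ∪ J₂, b, ?_, ?_, ?_, ?_, ?_, ?_⟩
    · intro i hi
      rcases Finset.mem_union.1 hi with h | h
      · exact hN₁ i h
      · exact (le_max_left _ _).trans (hN₂ i h)
    · intro i; simp only [b]; split_ifs
      · exact hJ₁.nonneg i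
      · exact h0 i
    · rw [Finset.sum_union hdisj, e1 _ subset_rfl, e2 _ subset_rfl, hJ₁.sum_eq, hsum]
      push_cast; ring
    · rw [Finset.image_union]
      refine ⟨J₁.image m, J₂.image m, hJ₁.mem, hch, ?_, rfl⟩
      intro x hx y hy
      obtain ⟨i, hi, rfl⟩ := Finset.mem_image.1 hx
      obtain ⟨j, hj, rfl⟩ := Finset.mem_image.1 hy
      exact hm (hJJ i hi j hj)
    · intro B hB hch
      rw [split B hB]
      have h1 := IsChainOf.sum_le hJ₁.small (sub1 B) (hch.subset (himg B _))
      have h2 := hi _ (sub2 B hB) ((hch.subset (himg B _)).mono (le_max_left _ _))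
      have h3 : (M : ℝ) * (η / (2 * (M + 1))) ≤ η / 2 := by
        rw [mul_div_assoc', div_le_div_iff₀ (by positivity) (by positivity)]
        nlinarith
      linarith
    · intro B hB hmem
      rw [split B hB]
      have hle1 : ∑ i ∈ B.filter (· ∈ J₁), b₁ i ≤ 1 := by
        rw [← hJ₁.sum_eq]
        exact Finset.sum_le_sum_of_subset_of_nonneg (sub1 B) fun i _ _ => hJ₁.nonneg i
      rcases (B.filter (· ∈ J₁)).eq_empty_or_nonempty with he | ⟨i, hiB⟩
      · rw [he, Finset.sum_empty, zero_add]
        have := hii _ (sub2 B hB) (schreier_subset hmem (himg B _))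
        linarith
      · obtain ⟨M', hM', hb⟩ := mem_schreier_succ.1 hmem
        have h1 : M' ≤ m K := (hb (m i) (Finset.mem_image_of_mem m (Finset.mem_filter.1 hiB).1)).trans
          (PNat.coe_le_coe _ _ |>.2 (hm.monotone (hK i (Finset.mem_filter.1 hiB).2)))
        have h2 := hi _ (sub2 B hB) ((hM'.subset (himg B _)).mono (h1.trans (le_max_right _ _)))
        linarith

lemma le_of_strictMono_pnat {m : ℕ → ℕ+} (hm : StrictMono m) (i : ℕ) : i ≤ m i :=
  (show StrictMono fun i => (m i : ℕ) from fun _ _ h => PNat.coe_lt_coe _ _ |>.2 (hm h)).le_apply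

/-- In the step from `l` to `l + 1`, `n + 1` pieces are averaged: a member of `Sₗ₊₁` has weight at
most `1 + 1` in their sum, hence at most `2 / (n + 1) < η` in the average. Starting at index `n + 1`
makes the number of pieces admissible. -/
lemma exists_specialConvex {m : ℕ → ℕ+} (hm : StrictMono m) (l : ℕ) (η : ℝ) (hη : 0 < η)
    (N : ℕ) : ∃ J b, (∀ i ∈ J, N ≤ i) ∧ IsSpecialConvex m l η J b := by
  classical
  induction l generalizing η N with
  | zero =>
    obtain ⟨n, hn⟩ := exists_nat_one_div_lt hη
    refine ⟨Finset.Ico (N + (n + 1)) (N + (n + 1) + (n + 1)), fun _ => 1 / ((n : ℝ) + 1), ?_, ?_⟩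
    · intro i hi
      have := (Finset.mem_Ico.1 hi).1
      omega
    · refine ⟨fun i => by positivity, ?_, ?_, ?_⟩
      · simp; field_simp
      · intro x hx
        obtain ⟨i, hi, rfl⟩ := Finset.mem_image.1 hx
        refine Finset.card_image_le.trans ?_
        have h1 := (Finset.mem_Ico.1 hi).1
        have h2 := le_of_strictMono_pnat hm i
        simp only [Nat.card_Ico]
        omega
      · intro B _ hB
        have h1 : B.card ≤ 1 := by
          rw [← Finset.card_image_of_injective B hm.injective]; exact hB
        rw [Finset.sum_const, nsmul_eq_mul]
        have h2 : (B.card : ℝ) ≤ 1 := by exact_mod_cast h1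
        have h3 : 0 < 1 / ((n : ℝ) + 1) := by positivity
        nlinarith
  | succ l ih =>
    obtain ⟨n, hn⟩ := exists_nat_one_div_lt (half_pos hη)
    obtain ⟨J, b, hN, h0, hsum, hch, -, hii⟩ :=
      exists_specialConvex_pieces hm ih (n + 1) 1 one_pos (max N (n + 1)) 0
    have hn0 : (0 : ℝ) < n + 1 := by positivity
    refine ⟨J, fun i => b i / (n + 1), fun i hi => (le_max_left _ _).trans (hN i hi), ?_, ?_, ?_, ?_⟩
    · intro i; have := h0 i; positivity
    · rw [← Finset.sum_div, hsum]; push_cast; field_simp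
    · refine mem_schreier_succ.2 ⟨n + 1, hch, fun x hx => ?_⟩
      obtain ⟨i, hi, rfl⟩ := Finset.mem_image.1 hx
      exact ((le_max_right _ _).trans (hN i hi)).trans (le_of_strictMono_pnat hm i)
    · intro B hB hmem
      rw [← Finset.sum_div, div_le_iff₀ hn0]
      have h1 := hii B hB hmem
      rw [div_lt_iff₀ hn0] at hn
      linarith

/-! ## Adapted families over arbitrary index sets -/

/-- The relation required between the members of an adapted family. -/
def Separated : Mode → Set ℕ+ → Set ℕ+ → Prop
  | Mode.M, E, F => Disjoint E F
  | Mode.U, E, F => (∀ a ∈ E, ∀ b ∈ F, a < b) ∨ ∀ a ∈ E, ∀ b ∈ F, b < a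

lemma Separated.disjoint {σ : Mode} {E F : Set ℕ+} (h : Separated σ E F) : Disjoint E F := by
  cases σ with
  | M => exact h
  | U =>
    rw [Set.disjoint_left]
    intro a ha hb
    rcases h with h | h <;> exact lt_irrefl _ (h a ha a hb)

lemma Separated.mono {σ : Mode} {E F E' F' : Set ℕ+} (h : Separated σ E F) (hE : E' ⊆ E)
    (hF : F' ⊆ F) : Separated σ E' F' := by
  cases σ with
  | M => exact Disjoint.mono hE hF h
  | U =>
    rcases h with h | h
    · exact Or.inl fun a ha b hb => h a (hE ha) b (hF hb)
    · exact Or.inr fun a ha b hb => h a (hE ha) b (hF hb)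

lemma Separated.of_unmodified {σ : Mode} {E F : Set ℕ+} (h : Separated Mode.U E F) :
    Separated σ E F := by
  cases σ with
  | M => exact h.disjoint
  | U => exact h

/-- A finite family is adapted if the minima of its nonempty members lie in a member of `Sₙ` and
its members are pairwise separated. -/
def AdaptedOn (n : ℕ) (σ : Mode) {ι : Type*} (T : Finset ι) (E : ι → Set ℕ+) : Prop :=
  (∃ A ∈ schreier n, ∀ i ∈ T, ∀ m, IsLeast (E i) m → m ∈ A) ∧
  ∀ i ∈ T, ∀ j ∈ T, i ≠ j → Separated σ (E i) (E j)

lemma exists_isLeast_pnat {E : Set ℕ+} (h : E.Nonempty) : ∃ m, IsLeast E m :=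
  ⟨WellFounded.min wellFounded_lt E h, WellFounded.min_mem _ _ h, fun _ ha =>
    WellFounded.min_le _ ha⟩

lemma Adapted.adaptedOn {n : ℕ} {σ : Mode} {k : ℕ} {E : Fin k → Set ℕ+} (h : Adapted n σ E) :
    AdaptedOn n σ Finset.univ E := by
  obtain ⟨⟨m, hm, hA⟩, hsep⟩ := h
  refine ⟨⟨_, hA, fun i _ a ha => ?_⟩, fun i _ j _ hij => ?_⟩
  · rw [ha.unique (hm i)]; exact Finset.mem_image_of_mem m (Finset.mem_univ i)
  · cases σ with
    | M => exact hsep i j hij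
    | U =>
      rcases lt_or_gt_of_ne hij with h1 | h1
      · exact Or.inl (hsep i j h1)
      · exact Or.inr fun a ha b hb => hsep j i h1 b hb a ha

lemma AdaptedOn.subset {n : ℕ} {σ : Mode} {ι : Type*} {T T' : Finset ι} {E : ι → Set ℕ+}
    (h : AdaptedOn n σ T E) (hT : T' ⊆ T) : AdaptedOn n σ T' E := by
  obtain ⟨⟨A, hA, hmin⟩, hsep⟩ := h
  exact ⟨⟨A, hA, fun i hi => hmin i (hT hi)⟩, fun i hi j hj => hsep i (hT hi) j (hT hj)⟩

/-- Distinct anchors `φ i ∈ A` to the left of the sets are enough: the true minima form a spread of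
a subset of `A`. -/
lemma adaptedOn_of_spread {n : ℕ} {σ : Mode} {ι : Type*} {T : Finset ι} {E : ι → Set ℕ+}
    {A : Finset ℕ+} (hA : A ∈ schreier n) (φ : ι → ℕ+)
    (hinj : ∀ i ∈ T, ∀ j ∈ T, (E i).Nonempty → (E j).Nonempty → φ i = φ j → i = j)
    (hmem : ∀ i ∈ T, (E i).Nonempty → φ i ∈ A) (hle : ∀ i ∈ T, ∀ x ∈ E i, φ i ≤ x)
    (hsep : ∀ i ∈ T, ∀ j ∈ T, i ≠ j → Separated σ (E i) (E j)) : AdaptedOn n σ T E := by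
  classical
  rcases T.eq_empty_or_nonempty with rfl | ⟨i₀, -⟩
  · exact ⟨⟨∅, schreier_empty n, by simp⟩, by simp⟩
  have hex : ∀ i, (E i).Nonempty → ∃ m, IsLeast (E i) m := fun i h => exists_isLeast_pnat h
  choose! m hm using hex
  refine ⟨⟨(T.filter fun i => (E i).Nonempty).image m, ?_, ?_⟩, hsep⟩
  · have hex2 : ∀ c ∈ (T.filter fun i => (E i).Nonempty).image m,
        ∃ i, i ∈ T ∧ (E i).Nonempty ∧ m i = c := by
      intro c hc
      obtain ⟨i, hi, rfl⟩ := Finset.mem_image.1 hc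
      exact ⟨i, (Finset.mem_filter.1 hi).1, (Finset.mem_filter.1 hi).2, rfl⟩
    have : Nonempty ι := ⟨i₀⟩
    choose! i hi using hex2
    refine schreier_spread hA (φ := fun c => φ (i c)) ?_ ?_ ?_
    · intro c hc d hd hcd
      obtain ⟨h1, h2, h3⟩ := hi c hc
      obtain ⟨h1', h2', h3'⟩ := hi d hd
      rw [← h3, ← h3', hinj _ h1 _ h1' h2 h2' hcd]
    · intro c hc
      obtain ⟨h1, h2, h3⟩ := hi c hc
      exact hmem _ h1 h2
    · intro c hc
      obtain ⟨h1, h2, h3⟩ := hi c hc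
      exact (hle _ h1 _ (hm _ h2).1).trans h3.le
  · intro i hi a ha
    have h1 : (E i).Nonempty := ⟨a, ha.1⟩
    rw [ha.unique (hm i h1)]
    exact Finset.mem_image_of_mem m (by simp [hi, h1])

lemma AdaptedOn.mono_sets {n : ℕ} {σ : Mode} {ι : Type*} {T : Finset ι} {E E' : ι → Set ℕ+}
    (h : AdaptedOn n σ T E) (hE : ∀ i ∈ T, E' i ⊆ E i) : AdaptedOn n σ T E' := by
  obtain ⟨⟨A, hA, hmin⟩, hsep⟩ := h
  have hex : ∀ i, (E i).Nonempty → ∃ m, IsLeast (E i) m := fun i h => exists_isLeast_pnat h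
  choose! m hm using hex
  have hne : ∀ i ∈ T, (E' i).Nonempty → (E i).Nonempty := fun i hi h => h.mono (hE i hi)
  refine adaptedOn_of_spread hA m ?_ (fun i hi h => hmin i hi _ (hm i (hne i hi h)))
    (fun i hi x hx => (hm i (hne i hi ⟨x, hx⟩)).2 (hE i hi hx))
    (fun i hi j hj hij => (hsep i hi j hj hij).mono (hE i hi) (hE j hj))
  intro i hi j hj h1 h2 hij
  by_contra hne'
  refine Set.disjoint_left.1 (hsep i hi j hj hne').disjoint (hm i (hne i hi h1)).1 ?_
  rw [hij]
  exact (hm j (hne j hj h2)).1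

/-- Empty sets are dropped and the others are listed by increasing minimum. In mode `U` this turns
the two-sided separation into `E₁ < E₂ < ⋯`. -/
lemma AdaptedOn.exists_adapted {n : ℕ} {σ : Mode} {ι : Type*} {T : Finset ι} {E : ι → Set ℕ+}
    (h : AdaptedOn n σ T E) : ∃ (k : ℕ) (e : Fin k → ι), Function.Injective e ∧
      (∀ r, e r ∈ T) ∧ (∀ i ∈ T, (E i).Nonempty → ∃ r, e r = i) ∧
      Adapted n σ fun r => E (e r) := by
  classical
  obtain ⟨⟨A, hA, hmin⟩, hsep⟩ := h
  have hex : ∀ i, (E i).Nonempty → ∃ m, IsLeast (E i) m := fun i h => exists_isLeast_pnat h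
  choose! m hm using hex
  set S := (T.filter fun i => (E i).Nonempty).image m
  have hex2 : ∀ r : Fin S.card, ∃ i, i ∈ T ∧ (E i).Nonempty ∧ m i = S.orderEmbOfFin rfl r := by
    intro r
    obtain ⟨i, hi, hir⟩ := Finset.mem_image.1 (Finset.orderEmbOfFin_mem S rfl r)
    exact ⟨i, (Finset.mem_filter.1 hi).1, (Finset.mem_filter.1 hi).2, hir⟩
  choose e h1 h2 h3 using hex2
  have hinj : Function.Injective e := fun r s hrs => by
    have := (h3 r).symm.trans ((congrArg m hrs).trans (h3 s))
    exact (S.orderEmbOfFin rfl).injective this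
  refine ⟨S.card, e, hinj, h1, ?_, ⟨fun r => m (e r), fun r => hm _ (h2 r), ?_⟩, ?_⟩
  · intro i hi hne
    have hiS : m i ∈ S := Finset.mem_image_of_mem m (by simp [hi, hne])
    have : m i ∈ Set.range (S.orderEmbOfFin rfl) := by
      rw [Finset.range_orderEmbOfFin]; exact_mod_cast hiS
    obtain ⟨r, hr⟩ := this
    refine ⟨r, ?_⟩
    by_contra hne'
    refine Set.disjoint_left.1 (hsep _ (h1 r) i hi hne').disjoint (hm _ (h2 r)).1 ?_
    rw [h3, hr]
    exact (hm i hne).1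
  · refine schreier_subset hA fun a ha => ?_
    obtain ⟨r, -, rfl⟩ := Finset.mem_image.1 ha
    exact hmin _ (h1 r) _ (hm _ (h2 r))
  · cases σ with
    | M => exact fun r s hrs => hsep _ (h1 r) _ (h1 s) fun h => hrs (hinj h)
    | U =>
      intro r s hrs
      refine (hsep _ (h1 r) _ (h1 s) fun h => hrs.ne (hinj h)).resolve_right fun h => ?_
      have := h _ (hm _ (h2 r)).1 _ (hm _ (h2 s)).1
      rw [h3, h3] at this
      exact absurd ((S.orderEmbOfFin rfl).lt_iff_lt.1 this) (not_lt.2 hrs.le)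

/-! ### Elementary properties of the norm -/

lemma restrict_restrict (E F : Set ℕ+) (x : ℕ+ →₀ ℝ) :
    restrict E (restrict F x) = restrict (E ∩ F) x := by
  ext k
  by_cases h1 : k ∈ E <;> by_cases h2 : k ∈ F <;> simp [restrict_apply, h1, h2]

lemma restrict_eq_self {E : Set ℕ+} {x : ℕ+ →₀ ℝ} (h : ∀ k ∈ x.support, k ∈ E) :
    restrict E x = x := by
  ext k
  by_cases hk : k ∈ E
  · simp [restrict_apply, hk]
  · have : x k = 0 := by by_contra h'; exact hk (h k (by simpa using h'))
    simp [restrict_apply, this]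

lemma restrict_eq_zero {E : Set ℕ+} {x : ℕ+ →₀ ℝ} (h : ∀ k ∈ x.support, k ∉ E) :
    restrict E x = 0 := by
  ext k
  by_cases hk : k ∈ E
  · have : x k = 0 := by by_contra h'; exact h k (by simpa using h') hk
    simp [restrict_apply, this]
  · simp [restrict_apply, hk]

lemma restrict_inter_support (E : Set ℕ+) (x : ℕ+ →₀ ℝ) :
    restrict (E ∩ x.support) x = restrict E x := by
  rw [← restrict_restrict, restrict_eq_self (E := (x.support : Set ℕ+)) fun k hk => hk]

lemma restrict_sum {ι : Type*} (E : Set ℕ+) (T : Finset ι) (x : ι → ℕ+ →₀ ℝ) :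
    restrict E (∑ i ∈ T, x i) = ∑ i ∈ T, restrict E (x i) := by
  classical
  induction T using Finset.induction_on with
  | empty => simp only [Finset.sum_empty]; exact restrict_eq_zero (by simp)
  | insert a s ha ih => rw [Finset.sum_insert ha, Finset.sum_insert ha, restrict_add, ih]

lemma tnorm_sum_le (P : Params) {ι : Type*} (T : Finset ι) (x : ι → ℕ+ →₀ ℝ) :
    tnorm P (∑ i ∈ T, x i) ≤ ∑ i ∈ T, tnorm P (x i) := by
  classical
  induction T using Finset.induction_on with
  | empty => simp [tnorm_zero]
  | insert a s ha ih =>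
    rw [Finset.sum_insert ha, Finset.sum_insert ha]
    exact ((good_tnorm P).add_le _ _).trans (by linarith)

lemma tnorm_nonneg (P : Params) (x : ℕ+ →₀ ℝ) : 0 ≤ tnorm P x := (good_tnorm P).nonneg x

lemma c0Norm_le_tnorm (P : Params) (x : ℕ+ →₀ ℝ) : c0Norm x ≤ tnorm P x :=
  iterNorm_le_tnorm P 0 x

lemma c0Norm_restrict_le (E : Set ℕ+) (x : ℕ+ →₀ ℝ) : c0Norm (restrict E x) ≤ c0Norm x := by
  refine ciSup_le fun k => le_trans ?_ (abs_le_c0Norm x k)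
  rw [restrict_apply]
  split_ifs <;> simp

lemma iterNorm_restrict_le (P : Params) (i : ℕ) (E : Set ℕ+) (x : ℕ+ →₀ ℝ) :
    iterNorm P i (restrict E x) ≤ iterNorm P i x := by
  induction i generalizing x with
  | zero => exact c0Norm_restrict_le E x
  | succ i ih =>
    refine step_le ((c0Norm_restrict_le E x).trans (c0Norm_le_step P _ x)) ?_
    rintro _ ⟨n, k, F, hF, rfl⟩
    refine le_trans ?_ (le_step ((good_iterNorm P i).bddAbove x) ⟨n, k, F, hF, rfl⟩)
    refine mul_le_mul_of_nonneg_left (Finset.sum_le_sum fun s _ => ?_) (P.θ_pos n).le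
    rw [restrict_restrict, Set.inter_comm, ← restrict_restrict]
    exact ih _

lemma tnorm_restrict_le (P : Params) (E : Set ℕ+) (x : ℕ+ →₀ ℝ) :
    tnorm P (restrict E x) ≤ tnorm P x :=
  ciSup_le fun i => (iterNorm_restrict_le P i E x).trans (iterNorm_le_tnorm P i x)

lemma Adapted.norm_le (P : Params) {n : ℕ+} {k : ℕ} {E : Fin k → Set ℕ+}
    (h : Adapted n (P.σ n) E) (x : ℕ+ →₀ ℝ) :
    P.θ n * ∑ i, tnorm P (restrict (E i) x) ≤ tnorm P x := by
  rw [tnorm_eq P x]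
  exact le_step ((good_tnorm P).bddAbove x) ⟨n, k, E, h, rfl⟩

lemma AdaptedOn.norm_le (P : Params) {n : ℕ+} {ι : Type*} {T : Finset ι} {E : ι → Set ℕ+}
    (h : AdaptedOn n (P.σ n) T E) (x : ℕ+ →₀ ℝ) :
    P.θ n * ∑ i ∈ T, tnorm P (restrict (E i) x) ≤ tnorm P x := by
  obtain ⟨k, e, hinj, h1, h2, had⟩ := h.exists_adapted
  refine le_trans (le_of_eq ?_) (had.norm_le P x)
  congr 1
  symm
  refine Finset.sum_of_injOn e hinj.injOn (fun r _ => h1 r) (fun i hi hni => ?_) fun r _ => rfl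
  have : E i = ∅ := by
    by_contra hne
    obtain ⟨r, hr⟩ := h2 i hi (Set.nonempty_iff_ne_empty.2 hne)
    exact hni ⟨r, by simp, hr⟩
  rw [this, restrict_eq_zero (by simp), tnorm_zero]

/-! ### The norming functionals -/

/-- The action of a functional, given by its coefficients, on `c₀₀`. -/
def pairing (f : ℕ+ → ℝ) (x : ℕ+ →₀ ℝ) : ℝ := Finsupp.linearCombination ℝ f x

lemma pairing_eq_sum (f : ℕ+ → ℝ) (x : ℕ+ →₀ ℝ) :
    pairing f x = ∑ n ∈ x.support, x n * f n := by
  simp [pairing, Finsupp.linearCombination_apply, Finsupp.sum]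

lemma pairing_smul_sum {ι : Type*} (c : ℝ) (T : Finset ι) (f : ι → ℕ+ → ℝ) (x : ℕ+ →₀ ℝ) :
    pairing (c • ∑ i ∈ T, f i) x = c * ∑ i ∈ T, pairing (f i) x := by
  simp only [pairing_eq_sum, Pi.smul_apply, Finset.sum_apply, smul_eq_mul, Finset.mul_sum]
  rw [Finset.sum_comm]
  exact Finset.sum_congr rfl fun i _ => Finset.sum_congr rfl fun n _ => by ring

lemma pairing_restrict {f : ℕ+ → ℝ} {E : Set ℕ+} (h : Function.support f ⊆ E) (x : ℕ+ →₀ ℝ) :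
    pairing f (restrict E x) = pairing f x := by
  rw [pairing_eq_sum, pairing_eq_sum, Finset.sum_subset (support_restrict_subset E x)]
  · refine Finset.sum_congr rfl fun n _ => ?_
    by_cases hn : n ∈ E
    · simp [restrict_apply, hn]
    · have : f n = 0 := by by_contra h'; exact hn (h h')
      simp [this]
  · intro n _ hn
    have : restrict E x n = 0 := by simpa using hn
    simp [this]

/-- The standard norming set of the space. -/
inductive Norming (P : Params) : (ℕ+ → ℝ) → Prop
  | leaf (n : ℕ+) (c : ℝ) (hc : |c| ≤ 1) : Norming P (Pi.single n c)
  | node (j : ℕ+) (k : ℕ) (f : Fin k → ℕ+ → ℝ) (hf : ∀ i, Norming P (f i))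
      (had : Adapted j (P.σ j) fun i => Function.support (f i)) : Norming P (P.θ j • ∑ i, f i)

lemma norming_zero (P : Params) : Norming P 0 := by
  simpa using Norming.leaf (P := P) 1 0 (by simp)

lemma norming_node (P : Params) (j : ℕ+) {ι : Type*} {T : Finset ι} {f : ι → ℕ+ → ℝ}
    (hf : ∀ i ∈ T, Norming P (f i))
    (had : AdaptedOn j (P.σ j) T fun i => Function.support (f i)) :
    Norming P (P.θ j • ∑ i ∈ T, f i) := by
  obtain ⟨k, e, hinj, h1, h2, had'⟩ := had.exists_adapted
  have : ∑ r, f (e r) = ∑ i ∈ T, f i := by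
    refine Finset.sum_of_injOn e hinj.injOn (fun r _ => h1 r) (fun i hi hni => ?_) fun r _ => rfl
    by_contra hne
    obtain ⟨r, hr⟩ := h2 i hi (Function.support_nonempty_iff.2 hne)
    exact hni ⟨r, by simp, hr⟩
  rw [← this]
  exact Norming.node j k _ (fun r => hf _ (h1 r)) had'

/-- Multipliers bounded by one cover both restriction to a set and change of signs. The supports of
the children can only shrink, which preserves adaptedness. -/
lemma Norming.mul {P : Params} {f : ℕ+ → ℝ} (hf : Norming P f) {s : ℕ+ → ℝ}
    (hs : ∀ n, |s n| ≤ 1) : Norming P (s * f) := by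
  induction hf with
  | leaf n c hc =>
    have : s * Pi.single n c = Pi.single n (s n * c) := by
      ext k
      by_cases hk : k = n
      · subst hk; simp
      · simp [hk]
    rw [this]
    refine Norming.leaf n _ ?_
    rw [abs_mul]
    exact mul_le_one₀ (hs n) (abs_nonneg _) hc
  | node j k f hf had ih =>
    rw [mul_smul_comm, Finset.mul_sum]
    exact norming_node P j (fun i _ => ih i) (had.adaptedOn.mono_sets fun i _ n hn hn' =>
      hn (by simp [hn']))

lemma Norming.indicator {P : Params} {f : ℕ+ → ℝ} (hf : Norming P f) (E : Set ℕ+) :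
    Norming P (E.indicator f) := by
  have := hf.mul (s := E.indicator 1) fun n => by
    by_cases h : n ∈ E <;> simp [h]
  convert this using 1
  ext n
  by_cases h : n ∈ E <;> simp [h]

lemma Norming.abs_pairing_le {P : Params} {f : ℕ+ → ℝ} (hf : Norming P f) (x : ℕ+ →₀ ℝ) :
    |pairing f x| ≤ tnorm P x := by
  induction hf generalizing x with
  | leaf n c hc =>
    have : pairing (Pi.single n c) x = x n * c := by
      rw [pairing_eq_sum]
      by_cases hn : n ∈ x.support
      · rw [Finset.sum_eq_single n]
        · simp
        · intro b _ hb; simp [hb]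
        · intro h; exact absurd hn h
      · rw [Finset.sum_eq_zero]
        · simp at hn; simp [hn]
        · intro b hb
          have : b ≠ n := fun h => hn (h ▸ hb)
          simp [this]
    rw [this, abs_mul]
    exact (mul_le_of_le_one_right (abs_nonneg _) hc).trans
      ((abs_le_c0Norm x n).trans (c0Norm_le_tnorm P x))
  | node j k f hf had ih =>
    rw [pairing_smul_sum, abs_mul, abs_of_pos (P.θ_pos j)]
    refine le_trans (mul_le_mul_of_nonneg_left ?_ (P.θ_pos j).le) (had.norm_le P x)
    refine (Finset.abs_sum_le_sum_abs _ _).trans (Finset.sum_le_sum fun i _ => ?_)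
    rw [← pairing_restrict (subset_refl _) x]
    exact ih i _

lemma Norming.abs_pairing_le_restrict {P : Params} {f : ℕ+ → ℝ} (hf : Norming P f)
    (x : ℕ+ →₀ ℝ) : |pairing f x| ≤ tnorm P (restrict (Function.support f) x) := by
  rw [← pairing_restrict (subset_refl _) x]
  exact hf.abs_pairing_le _

/-- Induction on the level: half of `ε` pays for choosing an almost optimal adapted family, and the
other half is divided among its members. -/
lemma exists_norming_iterNorm (P : Params) (i : ℕ) (x : ℕ+ →₀ ℝ) (ε : ℝ) (hε : 0 < ε) :
    ∃ f, Norming P f ∧ iterNorm P i x ≤ pairing f x + ε := by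
  have hc0 : ∀ x : ℕ+ →₀ ℝ, ∀ ε > 0, ∃ f, Norming P f ∧ c0Norm x ≤ pairing f x + ε := by
    intro x ε hε
    obtain ⟨n, hn⟩ := exists_lt_of_lt_ciSup (show c0Norm x - ε < ⨆ k, |x k| by
      simpa [c0Norm] using hε)
    refine ⟨Pi.single n (SignType.sign (x n) : ℝ), Norming.leaf n _ ?_, ?_⟩
    · rcases lt_trichotomy (x n) 0 with h | h | h <;> simp [h]
    · have : pairing (Pi.single n (SignType.sign (x n) : ℝ)) x = |x n| := by
        rw [pairing_eq_sum]
        by_cases hx : n ∈ x.support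
        · rw [Finset.sum_eq_single n]
          · simp
          · intro b _ hb; simp [hb]
          · intro h; exact absurd hx h
        · rw [Finset.sum_eq_zero]
          · simp at hx; simp [hx]
          · intro b hb
            have : b ≠ n := fun h => hx (h ▸ hb)
            simp [this]
      rw [this]; linarith
  induction i generalizing x ε with
  | zero => exact hc0 x ε hε
  | succ i ih =>
    rcases le_total (sSup (adaptedSums P (iterNorm P i) x)) (c0Norm x) with h | h
    · obtain ⟨f, hf, hle⟩ := hc0 x ε hε
      refine ⟨f, hf, ?_⟩
      rw [show iterNorm P (i + 1) x = c0Norm x from max_eq_left h]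
      exact hle
    · obtain ⟨r, ⟨n, k, E, hE, rfl⟩, hr⟩ := exists_lt_of_lt_csSup
        ⟨0, zero_mem_adaptedSums P (iterNorm P i) x⟩
        (show sSup (adaptedSums P (iterNorm P i) x) - ε / 2 < _ by linarith)
      have hk : (0 : ℝ) < k + 1 := by positivity
      choose f hf hle using fun s => ih (restrict (E s) x) (ε / (2 * (k + 1))) (by positivity)
      have had : AdaptedOn n (P.σ n) Finset.univ
          fun s => Function.support ((E s).indicator (f s)) :=
        hE.adaptedOn.mono_sets fun s _ => Set.support_indicator_subset
      refine ⟨_, norming_node P n (fun s _ => (hf s).indicator (E s)) had, ?_⟩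
      rw [show iterNorm P (i + 1) x = _ from max_eq_right h, pairing_smul_sum]
      have h1 : ∀ s, iterNorm P i (restrict (E s) x)
          ≤ pairing ((E s).indicator (f s)) x + ε / (2 * (k + 1)) := by
        intro s
        refine (hle s).trans (le_of_eq ?_)
        congr 1
        rw [← pairing_restrict (E := E s) Set.support_indicator_subset, pairing_eq_sum,
          pairing_eq_sum]
        refine Finset.sum_congr rfl fun m _ => ?_
        by_cases hm : m ∈ E s <;> simp [restrict_apply, hm]
      have h2 := Finset.sum_le_sum fun s (_ : s ∈ Finset.univ) => h1 s
      rw [Finset.sum_add_distrib, Finset.sum_const, Finset.card_univ, Fintype.card_fin,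
        nsmul_eq_mul] at h2
      have h3 : (k : ℝ) * (ε / (2 * (k + 1))) ≤ ε / 2 := by
        rw [mul_div_assoc', div_le_div_iff₀ (by positivity) (by positivity)]
        nlinarith
      have h4 := P.θ_lt_one n
      have h5 := P.θ_pos n
      have h6 := mul_le_mul_of_nonneg_left h2 h5.le
      nlinarith

lemma tnorm_le_of_norming {P : Params} {x : ℕ+ →₀ ℝ} {B : ℝ}
    (h : ∀ f, Norming P f → pairing f x ≤ B) : tnorm P x ≤ B := by
  refine ciSup_le fun i => le_of_forall_pos_le_add fun ε hε => ?_
  obtain ⟨f, hf, hle⟩ := exists_norming_iterNorm P i x ε hε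
  linarith [h f hf]

/-! ## The upper estimate -/

/-- A sparse block sequence `(y k)` together with superadditive set functions `μ k` controlling
the way in which `y k` can be split. -/
structure SplitData (P : Params) (y : ℕ+ → ℕ+ →₀ ℝ) (p q : ℕ+ → ℕ+) (l : ℕ+ → ℕ)
    (μ : ℕ+ → Set ℕ+ → ℝ) (η τ : ℕ+ → ℝ) : Prop where
  supp : ∀ k, ∀ n ∈ (y k).support, p k < n ∧ n ≤ q k
  p_le_q : ∀ k, p k ≤ q k
  sparse : ∀ k k', k < k' → 8 * q k ≤ p k'
  l_mono : Monotone l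
  -- Orders at or beyond the level of a later block see `y k` only through its `ℓ¹`-norm. So for
  -- each `j` at most one block is neither light nor negligible.
  heavy : ∀ k k' (j : ℕ+), k < k' → l k' ≤ j → P.θ j * l1Norm (y k) ≤ τ k
  μ_nonneg : ∀ k E, 0 ≤ μ k E
  μ_super : ∀ k (K : ℕ) (E : Fin K → Set ℕ+) (F : Set ℕ+) (T : Finset (Fin K)),
    (∀ i ∈ T, E i ⊆ F) → (∀ i ∈ T, ∀ j ∈ T, i ≠ j → Disjoint (E i) (E j)) →
    ∑ i ∈ T, μ k (E i) ≤ μ k F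
  norm_le : ∀ k E, (∃ e ∈ E, e ≤ p k) → tnorm P (restrict E (y k)) ≤ μ k E
  light : ∀ k (j : ℕ+) (K : ℕ) (E : Fin K → Set ℕ+) (T : Finset (Fin K)), (j : ℕ) < l k →
    AdaptedOn j (P.σ j) T E → (∀ i ∈ T, ∀ e ∈ E i, p k < e) →
    ∑ i ∈ T, tnorm P (restrict (E i) (y k)) ≤ ∑ i ∈ T, μ k (E i) + η k
  η_nonneg : ∀ k, 0 ≤ η k
  τ_nonneg : ∀ k, 0 ≤ τ k

/-- The number of points of `E` up to `n`. -/
def countUpTo (n : ℕ+) (E : Set ℕ+) : ℝ :=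
  open Classical in (((Finset.Iic n).filter fun a => a ∈ E).card : ℝ)

lemma countUpTo_nonneg (n : ℕ+) (E : Set ℕ+) : 0 ≤ countUpTo n E := Nat.cast_nonneg _

lemma countUpTo_le (n : ℕ+) (E : Set ℕ+) : countUpTo n E ≤ (n : ℕ) := by
  classical
  refine Nat.cast_le.2 ((Finset.card_filter_le _ _).trans ?_)
  have : (Finset.Iic n).card ≤ (Finset.Icc 1 (n : ℕ)).card :=
    Finset.card_le_card_of_injOn (fun a => (a : ℕ))
      (fun a ha => Finset.mem_coe.2 (Finset.mem_Icc.2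
        ⟨a.pos, PNat.coe_le_coe _ _ |>.2 (Finset.mem_Iic.1 ha)⟩))
      (PNat.coe_injective.injOn)
  simpa using this

lemma one_le_countUpTo {n : ℕ+} {E : Set ℕ+} (h : ∃ e ∈ E, e ≤ n) : 1 ≤ countUpTo n E := by
  classical
  obtain ⟨e, he, hen⟩ := h
  have : 0 < ((Finset.Iic n).filter fun a => a ∈ E).card :=
    Finset.card_pos.2 ⟨e, by simp [he, hen]⟩
  exact Nat.one_le_cast.2 this

/-- The count weighs the error terms: it is superadditive like `μ`, and at least one on sets
starting by `n`, so the additive error of a node can be charged to it. -/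
lemma sum_countUpTo_le (n : ℕ+) {ι : Type*} {E : ι → Set ℕ+} {F : Set ℕ+} {T : Finset ι}
    (hE : ∀ i ∈ T, E i ⊆ F) (hd : ∀ i ∈ T, ∀ j ∈ T, i ≠ j → Disjoint (E i) (E j)) :
    ∑ i ∈ T, countUpTo n (E i) ≤ countUpTo n F := by
  classical
  simp only [countUpTo]
  rw [← Nat.cast_sum, ← Finset.card_biUnion]
  · refine Nat.cast_le.2 (Finset.card_le_card fun a ha => ?_)
    obtain ⟨i, hi, ha⟩ := Finset.mem_biUnion.1 ha
    obtain ⟨h1, h2⟩ := Finset.mem_filter.1 ha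
    exact Finset.mem_filter.2 ⟨h1, hE i hi h2⟩
  · intro i hi j hj hij
    rw [Function.onFun, Finset.disjoint_left]
    intro a ha hb
    exact Set.disjoint_left.1 (hd i hi j hj hij) (Finset.mem_filter.1 ha).2
      (Finset.mem_filter.1 hb).2

/-- `E` starts before the block `y k` and meets it. -/
def Active (y : ℕ+ → ℕ+ →₀ ℝ) (p : ℕ+ → ℕ+) (k : ℕ+) (E : Set ℕ+) : Prop :=
  (∃ e ∈ E, e ≤ p k) ∧ ∃ e ∈ E, e ∈ (y k).support

lemma Active.mono {y : ℕ+ → ℕ+ →₀ ℝ} {p : ℕ+ → ℕ+} {k : ℕ+} {E F : Set ℕ+}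
    (h : Active y p k E) (hEF : E ⊆ F) : Active y p k F := by
  obtain ⟨⟨e, he, h1⟩, ⟨e', he', h2⟩⟩ := h
  exact ⟨⟨e, hEF he, h1⟩, ⟨e', hEF he', h2⟩⟩

/-- The inductive claim of the upper estimate: on the blocks which start after `f` does, `f` is
controlled by a norming functional acting on the `e_{p k}`, up to two exceptional blocks and a
summable error. -/
def IsTransferable (P : Params) (y : ℕ+ → ℕ+ →₀ ℝ) (p : ℕ+ → ℕ+) (μ : ℕ+ → Set ℕ+ → ℝ)
    (η τ : ℕ+ → ℝ) (δ : ℝ) (f g : ℕ+ → ℝ) (X : Finset ℕ+) : Prop :=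
  Norming P g ∧ (∀ n, 0 ≤ g n) ∧ (∀ n, g n ≤ δ) ∧ X.card ≤ 2 ∧
  (∀ k ∈ X, Active y p k (Function.support f)) ∧
  -- That `g` lives strictly after `X` prevents an exceptional block from being counted twice, and
  -- in mode `U` prevents it from separating two points used by the same child.
  (∀ n, g n ≠ 0 → ∃ k, n = p k ∧ Active y p k (Function.support f) ∧ ∀ x ∈ X, x < k) ∧
  ∀ k, (∃ e ∈ Function.support f, e ≤ p k) →
    |pairing f (y k)| ≤ (if k ∈ X then μ k (Function.support f) else 0) +
      g (p k) * (μ k (Function.support f) +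
        η k / (1 - δ) * countUpTo (p k) (Function.support f)) +
      countUpTo (p k) (Function.support f) * τ k

/-! ### Estimates for one block at one node of a norming functional -/

section

variable {P : Params} {y : ℕ+ → ℕ+ →₀ ℝ} {p q : ℕ+ → ℕ+} {l : ℕ+ → ℕ}
  {μ : ℕ+ → Set ℕ+ → ℝ} {η τ : ℕ+ → ℝ} {δ : ℝ}

lemma SplitData.q_lt_p (D : SplitData P y p q l μ η τ) {k k' : ℕ+} (h : k < k') : q k < p k' := by
  refine lt_of_lt_of_le ?_ (D.sparse k k' h)
  rw [← PNat.coe_lt_coe]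
  push_cast
  have := (q k).pos
  have : ((8 : ℕ+) : ℕ) = 8 := rfl
  omega

lemma SplitData.p_strictMono (D : SplitData P y p q l μ η τ) : StrictMono p := fun k _ h =>
  (D.p_le_q k).trans_lt (D.q_lt_p h)

lemma abs_pairing_eq_zero {f : ℕ+ → ℝ} {x : ℕ+ →₀ ℝ}
    (h : ∀ n ∈ x.support, f n = 0) : pairing f x = 0 := by
  rw [pairing_eq_sum]
  exact Finset.sum_eq_zero fun n hn => by rw [h n hn, mul_zero]

lemma pairing_eq_zero_of_not_active {f : ℕ+ → ℝ} {k : ℕ+}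
    (hold : ∃ e ∈ Function.support f, e ≤ p k) (h : ¬ Active y p k (Function.support f)) :
    pairing f (y k) = 0 := by
  refine abs_pairing_eq_zero fun n hn => ?_
  by_contra hne
  exact h ⟨hold, n, hne, hn⟩

lemma support_smul_sum_of_disjoint {K : ℕ} {f : Fin K → ℕ+ → ℝ} {c : ℝ} (hc : c ≠ 0)
    (hd : ∀ i j, i ≠ j → Disjoint (Function.support (f i)) (Function.support (f j))) :
    Function.support (c • ∑ i, f i) = ⋃ i, Function.support (f i) := by
  ext n
  simp only [Function.mem_support, Pi.smul_apply, Finset.sum_apply, smul_eq_mul, Set.mem_iUnion,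
    ne_eq, mul_eq_zero, hc, false_or]
  constructor
  · intro h
    by_contra! h'
    exact h (Finset.sum_eq_zero fun i _ => h' i)
  · rintro ⟨i, hi⟩
    rw [Finset.sum_eq_single i]
    · exact hi
    · intro j _ hj
      by_contra h'
      exact Set.disjoint_left.1 (hd j i hj) h' hi
    · simp

lemma abs_pairing_node_le {K : ℕ} {f : Fin K → ℕ+ → ℝ} (j : ℕ+) (x : ℕ+ →₀ ℝ) :
    |pairing (P.θ j • ∑ i, f i) x| ≤ P.θ j * ∑ i, |pairing (f i) x| := by
  rw [pairing_smul_sum, abs_mul, abs_of_pos (P.θ_pos j)]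
  exact mul_le_mul_of_nonneg_left (Finset.abs_sum_le_sum_abs _ _) (P.θ_pos j).le

variable {K : ℕ} {f g : Fin K → ℕ+ → ℝ} {X : Fin K → Finset ℕ+} {j : ℕ+} {S : Set ℕ+}

/-- A light node some of whose children start inside the block, or have it as an exception. -/
lemma SplitData.node_bound_of_new (D : SplitData P y p q l μ η τ) (hδ : 0 < δ) (hδ1 : δ < 1)
    (had : Adapted j (P.σ j) fun i => Function.support (f i)) (hf : ∀ i, Norming P (f i))
    (hT : ∀ i, IsTransferable P y p μ η τ δ (f i) (g i) (X i))
    (hS : ∀ i, Function.support (f i) ⊆ S) {k : ℕ+} (hk : (j : ℕ) < l k)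
    (hold : ∃ e ∈ S, e ≤ p k) :
    |pairing (P.θ j • ∑ i, f i) (y k)| ≤
      P.θ j * (μ k S + η k / (1 - δ) * countUpTo (p k) S) + countUpTo (p k) S * τ k := by
  classical
  set E : Fin K → Set ℕ+ := fun i => Function.support (f i)
  set O : Finset (Fin K) := Finset.univ.filter fun i => ∃ e ∈ E i, e ≤ p k
  set N : Finset (Fin K) := Finset.univ.filter fun i => ¬ ∃ e ∈ E i, e ≤ p k
  have hd : ∀ i j, i ≠ j → Disjoint (E i) (E j) := fun i j hij => had.disjoint hij
  have hη' : 0 ≤ η k / (1 - δ) := div_nonneg (D.η_nonneg k) (by linarith)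
  have h1 : ∀ i ∈ O, |pairing (f i) (y k)| ≤
      μ k (E i) + (δ * (η k / (1 - δ)) + τ k) * countUpTo (p k) (E i) := by
    intro i hi
    obtain ⟨-, h0, hδ', -, -, hX, hb⟩ := hT i
    have hb := hb k (Finset.mem_filter.1 hi).2
    have hμ := D.μ_nonneg k (E i)
    have hc := countUpTo_nonneg (p k) (E i)
    have hcη : 0 ≤ η k / (1 - δ) * countUpTo (p k) (E i) := mul_nonneg hη' hc
    by_cases hkX : k ∈ X i
    · have hg : g i (p k) = 0 := by
        by_contra h'
        obtain ⟨k', hk', -, hlt⟩ := hX _ h'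
        rw [D.p_strictMono.injective hk'] at hkX
        exact lt_irrefl _ (hlt _ hkX)
      rw [if_pos hkX, hg] at hb
      refine hb.trans ?_
      have := mul_nonneg hδ.le hcη
      change μ k (E i) + 0 * _ + countUpTo (p k) (E i) * τ k ≤ _
      linarith
    · rw [if_neg hkX] at hb
      refine hb.trans ?_
      have h2 : g i (p k) * μ k (E i) ≤ μ k (E i) :=
        mul_le_of_le_one_left hμ ((hδ' _).trans hδ1.le)
      have h3 := mul_le_mul_of_nonneg_right (hδ' (p k)) hcη
      change 0 + g i (p k) * (μ k (E i) + η k / (1 - δ) * countUpTo (p k) (E i)) +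
        countUpTo (p k) (E i) * τ k ≤ _
      linarith
  have h2 : ∑ i ∈ N, |pairing (f i) (y k)| ≤ ∑ i ∈ N, μ k (E i) + η k := by
    refine (Finset.sum_le_sum fun i _ => (hf i).abs_pairing_le_restrict (y k)).trans ?_
    refine D.light k j K E N hk (had.adaptedOn.subset (Finset.subset_univ _)) fun i hi e he => ?_
    have := (Finset.mem_filter.1 hi).2
    push Not at this
    exact this e he
  have h3 : ∑ i ∈ O, μ k (E i) + ∑ i ∈ N, μ k (E i) ≤ μ k S := by
    rw [Finset.sum_filter_add_sum_filter_not]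
    exact D.μ_super k K E S _ (fun i _ => hS i) fun i _ j _ => hd i j
  have h4 : ∑ i ∈ O, countUpTo (p k) (E i) ≤ countUpTo (p k) S :=
    sum_countUpTo_le _ (fun i _ => hS i) fun i _ j _ => hd i j
  have h5 := Finset.sum_le_sum h1
  rw [Finset.sum_add_distrib, ← Finset.mul_sum] at h5
  have h6 : 1 ≤ countUpTo (p k) S := one_le_countUpTo hold
  have h7 : ∑ i, |pairing (f i) (y k)| ≤
      μ k S + η k / (1 - δ) * countUpTo (p k) S + countUpTo (p k) S * τ k := by
    rw [← Finset.sum_filter_add_sum_filter_not Finset.univ fun i => ∃ e ∈ E i, e ≤ p k]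
    have h8 : (δ * (η k / (1 - δ)) + τ k) * ∑ i ∈ O, countUpTo (p k) (E i) ≤
        (δ * (η k / (1 - δ)) + τ k) * countUpTo (p k) S :=
      mul_le_mul_of_nonneg_left h4 (add_nonneg (mul_nonneg hδ.le hη') (D.τ_nonneg k))
    have h9 : η k ≤ η k * countUpTo (p k) S := le_mul_of_one_le_right (D.η_nonneg k) h6
    -- The old children contribute `δ` times the error constant and the sets starting inside the
    -- block add `η k`; the constant `η k / (1 - δ)` is the fixed point of this recursion.
    have h10 : δ * (η k / (1 - δ)) + η k = η k / (1 - δ) := by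
      have : 1 - δ ≠ 0 := by linarith
      field_simp; ring
    have h11 : (δ * (η k / (1 - δ))) * countUpTo (p k) S + η k * countUpTo (p k) S
        = η k / (1 - δ) * countUpTo (p k) S := by rw [← add_mul, h10]
    linarith
  refine (abs_pairing_node_le j _).trans ((mul_le_mul_of_nonneg_left h7 (P.θ_pos j).le).trans ?_)
  have h12 : P.θ j * (countUpTo (p k) S * τ k) ≤ countUpTo (p k) S * τ k :=
    mul_le_of_le_one_left (mul_nonneg (countUpTo_nonneg _ _) (D.τ_nonneg k)) (P.θ_lt_one j).le
  linarith

/-- A light node none of whose children starts inside the block or has it as an exception. -/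
lemma SplitData.node_bound_of_old (D : SplitData P y p q l μ η τ) (hδ1 : δ < 1)
    (had : Adapted j (P.σ j) fun i => Function.support (f i))
    (hT : ∀ i, IsTransferable P y p μ η τ δ (f i) (g i) (X i))
    (hS : ∀ i, Function.support (f i) ⊆ S) {k : ℕ+} {G : ℝ} (hG1 : 0 ≤ G) (hG : ∀ i, g i (p k) ≤ G)
    (hX : ∀ i, k ∉ X i)
    (hnew : ∀ i, (∃ e ∈ Function.support (f i), e ≤ p k) ∨
      ∀ e ∈ Function.support (f i), q k < e) :
    |pairing (P.θ j • ∑ i, f i) (y k)| ≤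
      P.θ j * G * (μ k S + η k / (1 - δ) * countUpTo (p k) S) + countUpTo (p k) S * τ k := by
  classical
  set E : Fin K → Set ℕ+ := fun i => Function.support (f i)
  have hd : ∀ i j, i ≠ j → Disjoint (E i) (E j) := fun i j hij => had.disjoint hij
  have hη' : 0 ≤ η k / (1 - δ) := div_nonneg (D.η_nonneg k) (by linarith)
  have hpos : ∀ i, 0 ≤ μ k (E i) + η k / (1 - δ) * countUpTo (p k) (E i) := fun i =>
    add_nonneg (D.μ_nonneg _ _) (mul_nonneg hη' (countUpTo_nonneg _ _))
  have h1 : ∀ i, |pairing (f i) (y k)| ≤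
      G * (μ k (E i) + η k / (1 - δ) * countUpTo (p k) (E i)) + τ k * countUpTo (p k) (E i) := by
    intro i
    have hτ := mul_nonneg (D.τ_nonneg k) (countUpTo_nonneg (p k) (E i))
    rcases hnew i with h | h
    · have hb := (hT i).2.2.2.2.2.2 k h
      rw [if_neg (hX i), zero_add] at hb
      refine hb.trans ?_
      have := mul_le_mul_of_nonneg_right (hG i) (hpos i)
      change g i (p k) * (μ k (E i) + η k / (1 - δ) * countUpTo (p k) (E i)) +
        countUpTo (p k) (E i) * τ k ≤ _
      linarith
    · rw [abs_pairing_eq_zero fun n hn => ?_]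
      · rw [abs_zero]
        have := mul_nonneg hG1 (hpos i)
        linarith
      · by_contra hne
        exact absurd (h n hne) (not_lt.2 (D.supp k n hn).2)
  have h3 : ∑ i, μ k (E i) ≤ μ k S :=
    D.μ_super k K E S _ (fun i _ => hS i) fun i _ j _ => hd i j
  have h4 : ∑ i, countUpTo (p k) (E i) ≤ countUpTo (p k) S :=
    sum_countUpTo_le _ (fun i _ => hS i) fun i _ j _ => hd i j
  have h5 := Finset.sum_le_sum fun i (_ : i ∈ Finset.univ) => h1 i
  rw [Finset.sum_add_distrib, ← Finset.mul_sum, ← Finset.mul_sum, Finset.sum_add_distrib,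
    ← Finset.mul_sum] at h5
  have h6 := mul_le_mul_of_nonneg_left (add_le_add h3 (mul_le_mul_of_nonneg_left h4 hη')) hG1
  have h7 := mul_le_mul_of_nonneg_left h4 (D.τ_nonneg k)
  have h8 := mul_le_mul_of_nonneg_left (h5.trans (add_le_add h6 h7)) (P.θ_pos j).le
  refine (abs_pairing_node_le j _).trans (h8.trans ?_)
  have h12 : P.θ j * (countUpTo (p k) S * τ k) ≤ countUpTo (p k) S * τ k :=
    mul_le_of_le_one_left (mul_nonneg (countUpTo_nonneg _ _) (D.τ_nonneg k)) (P.θ_lt_one j).le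
  linarith

end

lemma exists_finset_of_subsingleton {α : Type*} {s : Set α} (hs : s.Subsingleton) :
    ∃ N : Finset α, N.card ≤ 1 ∧ ∀ k, k ∈ N ↔ k ∈ s := by
  rcases hs.eq_empty_or_singleton with rfl | ⟨a, rfl⟩
  · exact ⟨∅, by simp, by simp⟩
  · exact ⟨{a}, by simp, by simp⟩

/-! ### Adaptedness of the transferred family -/

section

variable {P : Params} {y : ℕ+ → ℕ+ →₀ ℝ} {p q : ℕ+ → ℕ+} {l : ℕ+ → ℕ}
  {μ : ℕ+ → Set ℕ+ → ℝ} {η τ : ℕ+ → ℝ} {δ : ℝ}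
  {K : ℕ} {f g : Fin K → ℕ+ → ℝ} {X : Fin K → Finset ℕ+} {j : ℕ+}

/-- `Z` collects the blocks that receive a leaf, and `G i` the points left to child `i`. Each
minimum is charged to a child that starts no later than the end of that block, at most four minima
per child, so `schreier_sparse` applies. In mode `M` the assignment `t` makes the `G i` disjoint. In
mode `U` the order of the children passes to the `G i`, and points of `Z` do not fall between points
of one `G i`. -/
lemma SplitData.adaptedOn_node (D : SplitData P y p q l μ η τ)
    (had : Adapted j (P.σ j) fun i => Function.support (f i))
    (hT : ∀ i, IsTransferable P y p μ η τ δ (f i) (g i) (X i))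
    {t : ℕ+ → Fin K} {Z : Finset ℕ+} {G : Fin K → Set ℕ+}
    (hZ : ∀ k ∈ Z, ∃ i, k ∈ X i ∨ ∃ a, IsLeast (Function.support (f i)) a ∧ p k < a ∧ a ≤ q k)
    (hG : ∀ i, ∀ n ∈ G i, ∃ k, n = p k ∧ k ∉ Z ∧ t k = i ∧ g i (p k) ≠ 0)
    (hfar : ∀ k, (k ∈ Z ∨ ∃ i, p k ∈ G i) →
      ∃ i, ∃ a, IsLeast (Function.support (f i)) a ∧ 8 * a ≤ p k) :
    AdaptedOn j (P.σ j) (Z.disjSum Finset.univ)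
      (Sum.elim (fun k => ({p k} : Set ℕ+)) G) := by
  classical
  have hsep := had.adaptedOn.2
  have hinj := D.p_strictMono.injective
  obtain ⟨⟨a, ha, hA⟩, -⟩ := had
  have ha_inj : Function.Injective a := fun i i' h => by
    by_contra hne
    refine Set.disjoint_left.1 (hsep i (by simp) i' (by simp) hne).disjoint (ha i).1 ?_
    rw [h]
    exact (ha i').1
  have hact : ∀ i k, g i (p k) ≠ 0 → Active y p k (Function.support (f i)) ∧ ∀ x ∈ X i, x < k := by
    intro i k h
    obtain ⟨k', hk', h1, h2⟩ := (hT i).2.2.2.2.2.1 _ h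
    rw [hinj hk']
    exact ⟨h1, h2⟩
  have hXact : ∀ i, ∀ k ∈ X i, Active y p k (Function.support (f i)) := fun i =>
    (hT i).2.2.2.2.1
  have hle_of_act : ∀ i k, Active y p k (Function.support (f i)) → a i ≤ p k := by
    rintro i k ⟨⟨e, he, hek⟩, -⟩
    exact ((ha i).2 he).trans hek
  refine ⟨?_, ?_⟩
  · have hN : ∀ i, ({k | p k < a i ∧ a i ≤ q k} : Set ℕ+).Subsingleton := by
      intro i k hk k' hk'
      by_contra hne
      rcases lt_or_gt_of_ne hne with h | h
      · exact lt_irrefl _ ((hk.2.trans_lt (D.q_lt_p h)).trans hk'.1)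
      · exact lt_irrefl _ ((hk'.2.trans_lt (D.q_lt_p h)).trans hk.1)
    choose N hN1 hN2 using fun i => exists_finset_of_subsingleton (hN i)
    -- Only the least point of each `G i` enters the Schreier condition.
    have hM : ∀ i, ({k | IsLeast (G i) (p k)} : Set ℕ+).Subsingleton := fun i k hk k' hk' =>
      hinj (hk.unique hk')
    choose M hM1 hM2 using fun i => exists_finset_of_subsingleton (hM i)
    set C : Finset ℕ+ := Z ∪ Finset.univ.biUnion M
    set B : Fin K → Finset ℕ+ := fun i => X i ∪ (N i ∪ M i)
    -- At most two exceptional blocks, the block in which child `i` starts, and the least point of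
    -- `G i`.
    have hB : ∀ i, (B i).card ≤ 4 := fun i => by
      have h1 := Finset.card_union_le (X i) (N i ∪ M i)
      have h2 := Finset.card_union_le (N i) (M i)
      have h3 := (hT i).2.2.2.1
      have := hN1 i
      have := hM1 i
      simp only [B]
      omega
    have hBq : ∀ i, ∀ k ∈ B i, a i ≤ q k := by
      intro i k hk
      rcases Finset.mem_union.1 hk with hk | hk
      · exact (hle_of_act i k (hXact i k hk)).trans (D.p_le_q k)
      rcases Finset.mem_union.1 hk with hk | hk
      · exact ((hN2 i k).1 hk).2
      · obtain ⟨k', hk', -, -, hne⟩ := hG i _ ((hM2 i k).1 hk).1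
        rw [← hk'] at hne
        exact (hle_of_act i k (hact i k hne).1).trans (D.p_le_q k)
    have hC : ∀ k ∈ C, ∃ i, k ∈ B i := by
      intro k hk
      rcases Finset.mem_union.1 hk with hk | hk
      · obtain ⟨i, h | ⟨a', ha', h⟩⟩ := hZ k hk
        · exact ⟨i, Finset.mem_union_left _ h⟩
        · rw [ha'.unique (ha i)] at h
          exact ⟨i, Finset.mem_union_right _ (Finset.mem_union_left _ ((hN2 i k).2 h))⟩
      · obtain ⟨i, -, hi⟩ := Finset.mem_biUnion.1 hk
        exact ⟨i, Finset.mem_union_right _ (Finset.mem_union_right _ hi)⟩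
    rcases isEmpty_or_nonempty (Fin K) with hE | hE
    · refine ⟨∅, schreier_empty _, ?_⟩
      rintro (k | i) hs m hm
      · obtain ⟨i, -⟩ := hZ k (by simpa using hs)
        exact hE.elim i
      · exact hE.elim i
    choose! ι hι using hC
    refine ⟨C.image p, ?_, ?_⟩
    · refine schreier_sparse (q := q) (φ := fun k => a (ι k)) j.ne_zero hA
        (fun k _ => D.p_le_q k) (fun k _ k' _ => D.sparse k k') ?_ ?_ ?_ ?_
      · intro b
        by_cases hb : ∃ i, a i = b
        · obtain ⟨i, rfl⟩ := hb
          refine (Finset.card_le_card fun k hk => ?_).trans (hB i)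
          obtain ⟨hk1, hk2⟩ := Finset.mem_filter.1 hk
          rw [← ha_inj hk2]
          exact hι k hk1
        · rw [Finset.filter_false_of_mem]
          · simp
          · exact fun k _ h => hb ⟨_, h⟩
      · exact fun k _ => Finset.mem_image_of_mem a (Finset.mem_univ _)
      · exact fun k hk => hBq _ k (hι k hk)
      · intro k hk
        have : k ∈ Z ∨ ∃ i, p k ∈ G i := by
          rcases Finset.mem_union.1 hk with hk | hk
          · exact Or.inl hk
          · obtain ⟨i, -, hi⟩ := Finset.mem_biUnion.1 hk
            exact Or.inr ⟨i, ((hM2 i k).1 hi).1⟩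
        obtain ⟨i, a', ha', h8⟩ := hfar k this
        rw [ha'.unique (ha i)] at h8
        exact ⟨a i, Finset.mem_image_of_mem a (Finset.mem_univ _), h8⟩
    · rintro (k | i) hs m hm
      · have hk : k ∈ Z := by simpa using hs
        obtain rfl : m = p k := by simpa using hm.1
        exact Finset.mem_image_of_mem p (Finset.mem_union_left _ hk)
      · have hm' : IsLeast (G i) m := hm
        obtain ⟨k, rfl, -⟩ := hG i m hm'.1
        exact Finset.mem_image_of_mem p (Finset.mem_union_right _
          (Finset.mem_biUnion.2 ⟨i, Finset.mem_univ _, (hM2 i k).2 hm'⟩))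
  · cases hσ : P.σ j with
    | M =>
      rintro (k | i) hs (k' | i') hs' hne
      · simp only [Separated, Sum.elim_inl, Set.disjoint_singleton]
        exact fun h => hne (by rw [hinj h])
      · simp only [Separated, Sum.elim_inl, Sum.elim_inr, Set.disjoint_singleton_left]
        intro h
        obtain ⟨k', hk', hZ', -⟩ := hG i' _ h
        rw [← hinj hk'] at hZ'
        exact hZ' (by simpa using hs)
      · simp only [Separated, Sum.elim_inl, Sum.elim_inr, Set.disjoint_singleton_right]
        intro h
        obtain ⟨k, hk, hZ', -⟩ := hG i _ h
        rw [← hinj hk] at hZ'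
        exact hZ' (by simpa using hs')
      · simp only [Separated, Sum.elim_inr]
        rw [Set.disjoint_left]
        intro n h h'
        obtain ⟨k, rfl, -, ht, -⟩ := hG i n h
        obtain ⟨k', hk', -, ht', -⟩ := hG i' _ h'
        rw [← hinj hk', ht] at ht'
        exact hne (by rw [ht'])
    | U =>
      rw [hσ] at hsep
      -- two points of the same `G i` are not separated by a point of `Z`
      have hconv : ∀ k ∈ Z, ∀ i, ∀ k₁ k₂, p k₁ ∈ G i → p k₂ ∈ G i → k₁ < k → ¬ k < k₂ := by
        intro k hk i k₁ k₂ h1 h2 hlt1 hlt2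
        obtain ⟨k₁', e1, -, -, hg1⟩ := hG i _ h1
        obtain ⟨k₂', e2, -, -, hg2⟩ := hG i _ h2
        rw [← e1] at hg1
        rw [← e2] at hg2
        obtain ⟨⟨⟨c, hc, hck⟩, -⟩, hX1⟩ := hact i k₁ hg1
        obtain ⟨⟨-, ⟨d, hd, hdk⟩⟩, -⟩ := hact i k₂ hg2
        have hd' : q k < d := (D.q_lt_p hlt2).trans (D.supp k₂ d hdk).1
        have hck' : c < p k := hck.trans_lt (D.p_strictMono hlt1)
        -- Child `i` starts before block `k` and still acts after it, so in mode `U` no other child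
        -- can meet block `k`. But child `i` does not start in that block, and `k` is not in `X i`
        -- because all of `X i` lies before `k₁`.
        obtain ⟨i', hi'⟩ := hZ k hk
        have key : ∃ b ∈ Function.support (f i'), p k < b ∧ b ≤ q k := by
          rcases hi' with h | ⟨b, hb, hb1, hb2⟩
          · obtain ⟨-, ⟨b, hb, hbk⟩⟩ := hXact i' k h
            exact ⟨b, hb, D.supp k b hbk⟩
          · exact ⟨b, hb.1, hb1, hb2⟩
        obtain ⟨b, hb, hb1, hb2⟩ := key
        by_cases hii : i' = i
        · subst hii
          rcases hi' with h | ⟨b, hb, hb1, hb2⟩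
          · exact lt_asymm hlt1 (hX1 k h)
          · exact absurd (hb.2 hc) (not_le.2 (hck'.trans hb1))
        · rcases hsep i' (by simp) i (by simp) hii with h | h
          · exact absurd (h b hb c hc) (not_lt.2 (hck'.trans hb1).le)
          · exact absurd (h b hb d hd) (not_lt.2 (hb2.trans hd'.le))
      have hZG : ∀ k ∈ Z, ∀ i, Separated Mode.U {p k} (G i) := by
        intro k hk i
        have hne : ∀ n ∈ G i, n ≠ p k := by
          rintro n hn rfl
          obtain ⟨k', hk', hZ', -⟩ := hG i _ hn
          rw [← hinj hk'] at hZ'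
          exact hZ' hk
        by_cases h : ∃ k₁, p k₁ ∈ G i ∧ k₁ < k
        · obtain ⟨k₁, h1, hlt⟩ := h
          refine Or.inr ?_
          rintro _ rfl n hn
          obtain ⟨k₂, rfl, -⟩ := hG i n hn
          have := hconv k hk i k₁ k₂ h1 hn hlt
          exact lt_of_le_of_ne (D.p_strictMono.monotone (not_lt.1 this)) (hne _ hn)
        · push Not at h
          refine Or.inl ?_
          rintro _ rfl n hn
          obtain ⟨k₂, rfl, -⟩ := hG i n hn
          exact lt_of_le_of_ne (D.p_strictMono.monotone (h k₂ hn)) (hne _ hn).symm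
      have hGG : ∀ i i', (∀ c ∈ Function.support (f i), ∀ d ∈ Function.support (f i'), c < d) →
          ∀ m ∈ G i, ∀ n ∈ G i', m < n := by
        intro i i' h m hm n hn
        obtain ⟨k, rfl, -, -, hg1⟩ := hG i m hm
        obtain ⟨k', rfl, -, -, hg2⟩ := hG i' n hn
        obtain ⟨⟨-, ⟨d, hd, hdk⟩⟩, -⟩ := hact i k hg1
        obtain ⟨⟨⟨c, hc, hck⟩, -⟩, -⟩ := hact i' k' hg2
        exact ((D.supp k d hdk).1.trans (h d hd c hc)).trans_le hck
      rintro (k | i) hs (k' | i') hs' hne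
      · rcases lt_trichotomy k k' with h | h | h
        · exact Or.inl (by simpa using D.p_strictMono h)
        · exact absurd (by rw [h]) hne
        · exact Or.inr (by simpa using D.p_strictMono h)
      · exact hZG k (by simpa using hs) i'
      · rcases hZG k' (by simpa using hs') i with h | h
        · exact Or.inr fun a ha b hb => h b hb a ha
        · exact Or.inl fun a ha b hb => h b hb a ha
      · rcases hsep i (by simp) i' (by simp) (fun h => hne (by rw [h])) with h | h
        · exact Or.inl (hGG i i' h)
        · exact Or.inr fun m hm n hn => hGG i' i (fun c hc d hd => h d hd c hc) n hn m hm

end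

/-! ### The induction over the tree and the resulting domination -/

section

variable {P : Params} {y : ℕ+ → ℕ+ →₀ ℝ} {p q : ℕ+ → ℕ+} {l : ℕ+ → ℕ}
  {μ : ℕ+ → Set ℕ+ → ℝ} {η τ : ℕ+ → ℝ} {δ : ℝ}
  {K : ℕ} {f g : Fin K → ℕ+ → ℝ} {X : Fin K → Finset ℕ+} {j : ℕ+}

/-- The new exceptions are the intermediate block for the order `j` and the first light block on
which something happens. After these, an active light block in which a child starts, or which is
exceptional for a child, gets a leaf of weight `θ j`; any other light block keeps `θ j` times the
value of its best child. The remaining heavy blocks go into the `τ`-error. -/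
lemma SplitData.isTransferable_node (D : SplitData P y p q l μ η τ) (hδ : 0 < δ) (hδ1 : δ < 1)
    (hθ : ∀ n, P.θ n ≤ δ) (had : Adapted j (P.σ j) fun i => Function.support (f i))
    (hf : ∀ i, Norming P (f i))
    (hT : ∀ i, IsTransferable P y p μ η τ δ (f i) (g i) (X i)) :
    ∃ g' X', IsTransferable P y p μ η τ δ (P.θ j • ∑ i, f i) g' X' := by
  classical
  have hinj := D.p_strictMono.injective
  have hd : ∀ i i', i ≠ i' → Disjoint (Function.support (f i)) (Function.support (f i')) :=
    fun i i' h => had.disjoint h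
  set u : ℕ+ → ℝ := P.θ j • ∑ i, f i with hu
  set S : Set ℕ+ := Function.support u with hSdef
  have hSU : S = ⋃ i, Function.support (f i) :=
    support_smul_sum_of_disjoint (P.θ_pos j).ne' hd
  have hS : ∀ i, Function.support (f i) ⊆ S := fun i => hSU ▸ Set.subset_iUnion (fun i => Function.support (f i)) i
  have hu' : Norming P u := Norming.node j K f hf had
  rcases isEmpty_or_nonempty (Fin K) with hE | hE
  · have hu0 : u = 0 := by simp [hu]
    have hS0 : S = ∅ := by rw [hSU]; simp
    refine ⟨0, ∅, norming_zero P, by simp, fun _ => hδ.le, by simp, by simp, by simp, ?_⟩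
    rintro k ⟨e, he, -⟩
    change e ∈ S at he
    simp [hS0] at he
  obtain ⟨a, ha, -⟩ := had.1
  have hact : ∀ i k, g i (p k) ≠ 0 → Active y p k (Function.support (f i)) ∧ ∀ x ∈ X i, x < k := by
    intro i k h
    obtain ⟨k', hk', h1, h2⟩ := (hT i).2.2.2.2.2.1 _ h
    rw [hinj hk']
    exact ⟨h1, h2⟩
  have hXact : ∀ i, ∀ k ∈ X i, Active y p k (Function.support (f i)) := fun i =>
    (hT i).2.2.2.2.1
  have hg0 : ∀ i n, 0 ≤ g i n := fun i => (hT i).2.1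
  -- the blocks in which a child starts, and the exceptional blocks of the children
  have hN : ∀ i, ({k | p k < a i ∧ a i ≤ q k} : Set ℕ+).Subsingleton := by
    intro i k hk k' hk'
    by_contra hne
    rcases lt_or_gt_of_ne hne with h | h
    · exact lt_irrefl _ ((hk.2.trans_lt (D.q_lt_p h)).trans hk'.1)
    · exact lt_irrefl _ ((hk'.2.trans_lt (D.q_lt_p h)).trans hk.1)
  choose N hN1 hN2 using fun i => exists_finset_of_subsingleton (hN i)
  set Kf : Finset ℕ+ := (Finset.univ.biUnion fun i => X i ∪ N i).filter fun k => Active y p k S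
    with hKf
  have hKf' : ∀ k, k ∈ Kf ↔ (∃ i, k ∈ X i ∨ k ∈ N i) ∧ Active y p k S := by
    intro k; simp [hKf]
  -- the heavy exceptional block
  have hX0 : ({k | l k ≤ j ∧ (∀ k', k < k' → (j : ℕ) < l k') ∧ Active y p k S} :
      Set ℕ+).Subsingleton := by
    rintro k ⟨h1, h2, -⟩ k' ⟨h1', h2', -⟩
    by_contra hne
    rcases lt_or_gt_of_ne hne with h | h
    · exact absurd h1' (not_le.2 (h2 _ h))
    · exact absurd h1 (not_le.2 (h2' _ h))
  obtain ⟨X0, hX01, hX02⟩ := exists_finset_of_subsingleton hX0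
  -- the first light block which is not negligible
  set Q : Set ℕ+ := {k | (j : ℕ) < l k ∧ (k ∈ Kf ∨ ∃ i, g i (p k) ≠ 0)} with hQ
  have hX1 : ({k | IsLeast Q k} : Set ℕ+).Subsingleton := fun k hk k' hk' => hk.unique hk'
  obtain ⟨X1, hX11, hX12⟩ := exists_finset_of_subsingleton hX1
  have hQact : ∀ k ∈ Q, Active y p k S := by
    rintro k ⟨-, h | ⟨i, h⟩⟩
    · exact ((hKf' k).1 h).2
    · exact (hact i k h).1.mono (hS i)
  have hQcase : ∀ k ∈ Q, k ∈ X1 ∨ ∃ x ∈ X1, x < k := by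
    intro k hk
    obtain ⟨x, hx⟩ := exists_isLeast_pnat ⟨k, hk⟩
    rcases (hx.2 hk).eq_or_lt with rfl | h
    · exact Or.inl ((hX12 _).2 hx)
    · exact Or.inr ⟨x, (hX12 x).2 hx, h⟩
  have hQa : ∀ k ∈ Q, ∃ i, a i ≤ q k := by
    have : ∀ i k, Active y p k (Function.support (f i)) → a i ≤ q k := by
      rintro i k ⟨⟨e, he, hek⟩, -⟩
      exact (((ha i).2 he).trans hek).trans (D.p_le_q k)
    rintro k ⟨-, h | ⟨i, h⟩⟩
    · obtain ⟨⟨i, h | h⟩, -⟩ := (hKf' k).1 h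
      · exact ⟨i, this i k (hXact i k h)⟩
      · exact ⟨i, ((hN2 i k).1 h).2⟩
    · exact ⟨i, this i k (hact i k h).1⟩
  -- the child which acts on a block
  have ht : ∀ k, ∃ s, ∀ i, g i (p k) ≤ g s (p k) := fun k => by
    obtain ⟨s, -, hs⟩ := Finset.univ.exists_max_image (fun i => g i (p k)) Finset.univ_nonempty
    exact ⟨s, fun i => hs i (Finset.mem_univ i)⟩
  choose t ht using ht
  set Z : Finset ℕ+ := Kf.filter fun k => (j : ℕ) < l k ∧ ∃ x ∈ X1, x < k with hZ
  -- In mode `M` several children may act on one block. It is given to the child with the largest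
  -- value there, and superadditivity of `μ` pays for the others.
  set E' : Fin K → Set ℕ+ := fun i =>
    {n | ∃ k, n = p k ∧ (j : ℕ) < l k ∧ (∃ x ∈ X1, x < k) ∧ k ∉ Kf ∧ t k = i} with hE'
  set F : ℕ+ ⊕ Fin K → ℕ+ → ℝ :=
    Sum.elim (fun k => Pi.single (p k) 1) fun i => (E' i).indicator (g i) with hF
  set G : Fin K → Set ℕ+ := fun i => E' i ∩ Function.support (g i) with hG
  have hfam : AdaptedOn j (P.σ j) (Z.disjSum Finset.univ) fun s => Function.support (F s) := by
    refine AdaptedOn.mono_sets (E := Sum.elim (fun k => ({p k} : Set ℕ+)) G)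
      (D.adaptedOn_node (t := t) had hT ?_ ?_ ?_) ?_
    · intro k hk
      obtain ⟨⟨i, h⟩, -⟩ := (hKf' k).1 (Finset.mem_filter.1 hk).1
      exact ⟨i, h.imp_right fun h => ⟨a i, ha i, (hN2 i k).1 h⟩⟩
    · rintro i _ ⟨⟨k, rfl, -, -, hk, htk⟩, hgk⟩
      exact ⟨k, rfl, fun h => hk (Finset.mem_filter.1 h).1, htk, hgk⟩
    -- The reason for setting `X1` aside: some child starts in or before that block, so every later
    -- block satisfies `8 * a i ≤ p k`.
    · intro k hk
      have : ∃ x ∈ X1, x < k := by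
        rcases hk with hk | ⟨i, ⟨k', hk', -, h, -⟩, -⟩
        · exact (Finset.mem_filter.1 hk).2.2
        · rwa [hinj hk']
      obtain ⟨x, hx, hxk⟩ := this
      obtain ⟨i, hi⟩ := hQa x ((hX12 x).1 hx).1
      exact ⟨i, a i, ha i, (mul_le_mul_right hi 8).trans (D.sparse x k hxk)⟩
    · rintro (k | i) -
      · intro n hn
        by_contra hne
        exact hn (Pi.single_eq_of_ne hne _)
      · intro n hn
        simp only [hF, Sum.elim_inr, Set.support_indicator] at hn
        exact hn
  set g' : ℕ+ → ℝ := P.θ j • ∑ s ∈ Z.disjSum Finset.univ, F s with hg'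
  have hg'N : Norming P g' := by
    refine norming_node P j (fun s _ => ?_) hfam
    rcases s with k | i
    · exact Norming.leaf _ _ (by simp)
    · exact Norming.indicator (hT i).1 _
  have hval : ∀ n, g' n = P.θ j * (∑ k ∈ Z, (Pi.single (p k) (1 : ℝ) : ℕ+ → ℝ) n +
      ∑ i, (E' i).indicator (g i) n) := by
    intro n
    simp [hg', hF, Finset.sum_disjSum, mul_add]
  have hvalZ : ∀ k ∈ Z, g' (p k) = P.θ j := by
    intro k hk
    rw [hval, Finset.sum_eq_single k, Finset.sum_eq_zero]
    · simp
    · intro i _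
      refine Set.indicator_of_notMem ?_ _
      rintro ⟨k', hk', -, -, h, -⟩
      rw [← hinj hk'] at h
      exact h (Finset.mem_filter.1 hk).1
    · intro b _ hb
      exact Pi.single_eq_of_ne (fun h => hb (hinj h).symm) _
    · intro h; exact absurd hk h
  have hvalG : ∀ k, (j : ℕ) < l k → (∃ x ∈ X1, x < k) → k ∉ Kf →
      g' (p k) = P.θ j * g (t k) (p k) := by
    intro k h1 h2 h3
    rw [hval, Finset.sum_eq_zero, Finset.sum_eq_single (t k)]
    · rw [Set.indicator_of_mem, zero_add]
      exact ⟨k, rfl, h1, h2, h3, rfl⟩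
    · intro i _ hi
      refine Set.indicator_of_notMem ?_ _
      rintro ⟨k', hk', -, -, -, h⟩
      rw [← hinj hk'] at h
      exact hi h.symm
    · simp
    · intro b hb
      refine Pi.single_eq_of_ne (fun h => ?_) _
      rw [← hinj h] at hb
      exact h3 (Finset.mem_filter.1 hb).1
  have hval0 : ∀ n, g' n ≠ 0 → ∃ k, n = p k ∧ k ∈ Q ∧ ∃ x ∈ X1, x < k := by
    intro n hn
    rw [hval] at hn
    by_contra! hcon
    refine hn ?_
    rw [Finset.sum_eq_zero, Finset.sum_eq_zero]
    · simp
    · intro i _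
      by_contra hne
      have hmem : n ∈ E' i := Set.mem_of_indicator_ne_zero hne
      rw [Set.indicator_of_mem hmem] at hne
      obtain ⟨k, rfl, h1, ⟨x, hx, hxk⟩, -⟩ := hmem
      exact absurd (hcon k rfl ⟨h1, Or.inr ⟨i, hne⟩⟩ x hx) (not_le.2 hxk)
    · intro k hk
      refine Pi.single_eq_of_ne ?_ _
      rintro rfl
      obtain ⟨h1, h2, x, hx, hxk⟩ := Finset.mem_filter.1 hk
      exact absurd (hcon k rfl ⟨h2, Or.inl h1⟩ x hx) (not_le.2 hxk)
  have hg'0 : ∀ n, 0 ≤ g' n := by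
    intro n
    rw [hval]
    refine mul_nonneg (P.θ_pos j).le (add_nonneg (Finset.sum_nonneg fun k _ => ?_)
      (Finset.sum_nonneg fun i _ => Set.indicator_nonneg (fun n _ => hg0 i n) n))
    by_cases h : n = p k
    · subst h; simp
    · rw [Pi.single_eq_of_ne h]
  have hη' : ∀ k, 0 ≤ η k / (1 - δ) := fun k => div_nonneg (D.η_nonneg k) (by linarith)
  refine ⟨g', X0 ∪ X1, hg'N, hg'0, ?_, ?_, ?_, ?_, ?_⟩
  · intro n
    by_cases hn : g' n = 0
    · rw [hn]; exact hδ.le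
    · obtain ⟨k, rfl, ⟨h1, h2⟩, h3⟩ := hval0 n hn
      by_cases hk : k ∈ Kf
      · rw [hvalZ k (Finset.mem_filter.2 ⟨hk, h1, h3⟩)]; exact hθ j
      · rw [hvalG k h1 h3 hk]
        exact (mul_le_of_le_one_right (P.θ_pos j).le (((hT _).2.2.1 _).trans hδ1.le)).trans (hθ j)
  · have := Finset.card_union_le X0 X1
    omega
  · intro k hk
    rcases Finset.mem_union.1 hk with hk | hk
    · exact ((hX02 k).1 hk).2.2
    · exact hQact k ((hX12 k).1 hk).1
  · intro n hn
    obtain ⟨k, rfl, hkQ, x, hx, hxk⟩ := hval0 n hn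
    refine ⟨k, rfl, hQact k hkQ, fun z hz => ?_⟩
    rcases Finset.mem_union.1 hz with hz | hz
    -- A block of `X0` has `l z ≤ j`, whereas `j < l k`; monotonicity of `l` gives `z < k`.
    · by_contra hzk
      exact absurd (((D.l_mono (not_lt.1 hzk)).trans ((hX02 z).1 hz).1)) (not_le.2 hkQ.1)
    · rw [(hX1 ((hX12 z).1 hz) ((hX12 x).1 hx) : z = x)]
      exact hxk
  · intro k hold
    change ∃ e ∈ S, e ≤ p k at hold
    change |pairing u (y k)| ≤ (if k ∈ X0 ∪ X1 then μ k S else 0) +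
      g' (p k) * (μ k S + η k / (1 - δ) * countUpTo (p k) S) + countUpTo (p k) S * τ k
    have hμ := D.μ_nonneg k S
    have hc : 0 ≤ countUpTo (p k) S := countUpTo_nonneg _ _
    have hcτ : 0 ≤ countUpTo (p k) S * τ k := mul_nonneg hc (D.τ_nonneg k)
    have hmain : 0 ≤ μ k S + η k / (1 - δ) * countUpTo (p k) S :=
      add_nonneg hμ (mul_nonneg (hη' k) hc)
    have hgm : 0 ≤ g' (p k) * (μ k S + η k / (1 - δ) * countUpTo (p k) S) :=
      mul_nonneg (hg'0 _) hmain
    have hif : 0 ≤ if k ∈ X0 ∪ X1 then μ k S else 0 := by split_ifs <;> simp [hμ]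
    by_cases hak : Active y p k S
    swap
    · rw [pairing_eq_zero_of_not_active (p := p) hold hak, abs_zero]
      positivity
    by_cases hkX : k ∈ X0 ∪ X1
    · rw [if_pos hkX]
      have := (hu'.abs_pairing_le_restrict (y k)).trans (D.norm_le k S hold)
      linarith
    by_cases hlk : (j : ℕ) < l k
    · by_cases hkQ : k ∈ Q
      · have hafter : ∃ x ∈ X1, x < k := (hQcase k hkQ).resolve_left fun h =>
          hkX (Finset.mem_union_right _ h)
        by_cases hkK : k ∈ Kf
        · rw [hvalZ k (Finset.mem_filter.2 ⟨hkK, hlk, hafter⟩)]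
          have := D.node_bound_of_new hδ hδ1 had hf hT hS hlk hold
          linarith
        · rw [hvalG k hlk hafter hkK]
          have := D.node_bound_of_old hδ1 had hT hS (hg0 (t k) (p k)) (ht k)
            (fun i h => hkK ((hKf' k).2 ⟨⟨i, Or.inl h⟩, hak⟩))
            (fun i => by
              by_contra! hcon
              obtain ⟨h1, e, he, heq⟩ := hcon
              exact hkK ((hKf' k).2 ⟨⟨i, Or.inr ((hN2 i k).2
                ⟨h1 _ (ha i).1, ((ha i).2 he).trans heq⟩)⟩, hak⟩))
          linarith
      · have hkK : k ∉ Kf := fun h => hkQ ⟨hlk, Or.inl h⟩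
        -- `le_rfl` instantiates `G = 0`: every `g i` vanishes at `p k`, and only the `τ`-error
        -- survives.
        have := D.node_bound_of_old hδ1 had hT hS le_rfl
          (fun i => le_of_eq (by by_contra h; exact hkQ ⟨hlk, Or.inr ⟨i, h⟩⟩))
          (fun i h => hkK ((hKf' k).2 ⟨⟨i, Or.inl h⟩, hak⟩))
          (fun i => by
            by_contra! hcon
            obtain ⟨h1, e, he, heq⟩ := hcon
            exact hkK ((hKf' k).2 ⟨⟨i, Or.inr ((hN2 i k).2
              ⟨h1 _ (ha i).1, ((ha i).2 he).trans heq⟩)⟩, hak⟩))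
        linarith
    · have hex : ∃ k', k < k' ∧ l k' ≤ j := by
        by_contra! hcon
        exact hkX (Finset.mem_union_left _ ((hX02 k).2 ⟨not_lt.1 hlk, hcon, hak⟩))
      obtain ⟨k', hkk', hlk'⟩ := hex
      have h1 := D.heavy k k' j hkk' hlk'
      have h2 : |pairing u (y k)| ≤ P.θ j * l1Norm (y k) := by
        refine (abs_pairing_node_le j _).trans (mul_le_mul_of_nonneg_left ?_ (P.θ_pos j).le)
        exact (Finset.sum_le_sum fun i _ => ((hf i).abs_pairing_le_restrict (y k)).trans
          ((good_tnorm P).le_l1 _)).trans (sum_l1Norm_le had _)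
      have h3 : τ k ≤ countUpTo (p k) S * τ k :=
        le_mul_of_one_le_left (D.τ_nonneg k) (one_le_countUpTo hold)
      linarith

/-- A leaf at `n ≤ p k` does not see `y k`, which is supported after `p k`; hence the zero
functional transfers it. -/
lemma SplitData.exists_isTransferable (D : SplitData P y p q l μ η τ) (hδ : 0 < δ) (hδ1 : δ < 1)
    (hθ : ∀ n, P.θ n ≤ δ) {f : ℕ+ → ℝ} (hf : Norming P f) :
    ∃ g X, IsTransferable P y p μ η τ δ f g X := by
  induction hf with
  | leaf n c hc =>
    refine ⟨0, ∅, norming_zero P, by simp, fun _ => hδ.le, by simp, by simp, by simp, ?_⟩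
    rintro k ⟨e, he, hek⟩
    have hsub : Function.support (Pi.single n c : ℕ+ → ℝ) ⊆ {n} := Pi.support_single_subset
    obtain rfl : e = n := hsub he
    rw [abs_pairing_eq_zero, abs_zero]
    · have := mul_nonneg (countUpTo_nonneg (p k) (Function.support (Pi.single e c : ℕ+ → ℝ)))
        (D.τ_nonneg k)
      simpa using this
    · intro m hm
      refine Pi.single_eq_of_ne ?_ _
      rintro rfl
      exact absurd hek (not_le.2 (D.supp k m hm).1)
  | node j K f hf had ih =>
    choose g X hT using ih
    exact D.isTransferable_node hδ hδ1 hθ had hf hT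

/-- The upper estimate: `(e_{p k})` dominates the blocks `(y k)`. -/
theorem SplitData.tnorm_sum_le (D : SplitData P y p q l μ η τ) (hδ : 0 < δ) (hδ1 : δ < 1)
    (hθ : ∀ n, P.θ n ≤ δ) {C : ℝ} (hC : ∀ k E, μ k E ≤ C) (hy : ∀ k, tnorm P (y k) ≤ 1)
    (hη : ∀ k, η k / (1 - δ) * (p k : ℕ) ≤ 1)
    (hτ : ∀ T : Finset ℕ+, ∑ k ∈ T, ((p k : ℕ) : ℝ) * τ k ≤ 1) (a : ℕ+ →₀ ℝ) :
    tnorm P (∑ k ∈ a.support, a k • y k) ≤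
      (4 * (C + 1) + 1) * tnorm P (Finsupp.mapDomain p a) := by
  classical
  have hinj := D.p_strictMono.injective
  set N := tnorm P (Finsupp.mapDomain p a) with hN
  have hN0 : 0 ≤ N := tnorm_nonneg P _
  have haN : ∀ k, |a k| ≤ N := fun k => by
    have := (abs_le_c0Norm (Finsupp.mapDomain p a) (p k)).trans (c0Norm_le_tnorm P _)
    rwa [Finsupp.mapDomain_apply hinj] at this
  have hC0 : 0 ≤ C := (D.μ_nonneg 1 ∅).trans (hC 1 ∅)
  refine tnorm_le_of_norming fun f hf => ?_
  obtain ⟨g, X, hg, hg0, -, hX, -, -, hb⟩ := D.exists_isTransferable hδ hδ1 hθ hf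
  set S := Function.support f
  -- Transferability says nothing about a block in which `f` itself starts. There is at most one,
  -- and it becomes the third exceptional block.
  have hY : ({k | ∃ m, IsLeast S m ∧ p k < m ∧ m ≤ q k} : Set ℕ+).Subsingleton := by
    rintro k ⟨m, hm, h1, h2⟩ k' ⟨m', hm', h1', h2'⟩
    obtain rfl := hm.unique hm'
    by_contra hne
    rcases lt_or_gt_of_ne hne with h | h
    · exact lt_irrefl _ ((h2.trans_lt (D.q_lt_p h)).trans h1')
    · exact lt_irrefl _ ((h2'.trans_lt (D.q_lt_p h)).trans h1)
  obtain ⟨Y, hY1, hY2⟩ := exists_finset_of_subsingleton hY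
  have hk : ∀ k, |pairing f (y k)| ≤ (if k ∈ X ∪ Y then C + 1 else 0) + (C + 1) * g (p k) +
      (p k : ℕ) * τ k := by
    intro k
    have hpτ : 0 ≤ ((p k : ℕ) : ℝ) * τ k := mul_nonneg (Nat.cast_nonneg _) (D.τ_nonneg k)
    have hg1 := hg0 (p k)
    by_cases hold : ∃ e ∈ S, e ≤ p k
    · refine (hb k hold).trans ?_
      have h1 : (if k ∈ X then μ k S else 0) ≤ if k ∈ X ∪ Y then C + 1 else 0 := by
        by_cases h : k ∈ X
        · rw [if_pos h, if_pos (Finset.mem_union_left _ h)]; linarith [hC k S]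
        · rw [if_neg h]; split_ifs <;> linarith
      have hc := countUpTo_le (p k) S
      have h2 : η k / (1 - δ) * countUpTo (p k) S ≤ 1 :=
        (mul_le_mul_of_nonneg_left hc (div_nonneg (D.η_nonneg k) (by linarith))).trans (hη k)
      have h3 : g (p k) * (μ k S + η k / (1 - δ) * countUpTo (p k) S) ≤ g (p k) * (C + 1) :=
        mul_le_mul_of_nonneg_left (add_le_add (hC k S) h2) hg1
      have h4 := mul_le_mul_of_nonneg_right hc (D.τ_nonneg k)
      change (if k ∈ X then μ k S else 0) + g (p k) * (μ k S + η k / (1 - δ) * countUpTo (p k) S) +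
        countUpTo (p k) S * τ k ≤ _
      linarith
    · push Not at hold
      have h5 : 0 ≤ (C + 1) * g (p k) := mul_nonneg (by linarith) hg1
      by_cases hkY : k ∈ Y
      · rw [if_pos (Finset.mem_union_right _ hkY)]
        have := (hf.abs_pairing_le (y k)).trans (hy k)
        linarith
      · rw [abs_pairing_eq_zero, abs_zero]
        · have : (0 : ℝ) ≤ if k ∈ X ∪ Y then C + 1 else 0 := by split_ifs <;> linarith
          linarith
        · intro n hn
          by_contra hne
          obtain ⟨m, hm⟩ := exists_isLeast_pnat (E := S) ⟨n, hne⟩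
          exact hkY ((hY2 k).2 ⟨m, hm, hold m hm.1, (hm.2 hne).trans (D.supp k n hn).2⟩)
  have hlin : pairing f (∑ k ∈ a.support, a k • y k) = ∑ k ∈ a.support, a k * pairing f (y k) := by
    simp [pairing, map_sum]
  -- Since `g ≥ 0`, giving it the signs of the coefficients yields a norming functional with the
  -- value `∑ |a k| g (p k)`.
  have hgsum : ∑ k ∈ a.support, |a k| * g (p k) ≤ N := by
    have h1 := (hg.mul (s := fun n => (SignType.sign (Finsupp.mapDomain p a n) : ℝ)) fun n => by
      rcases lt_trichotomy (Finsupp.mapDomain p a n) 0 with h | h | h <;> simp [h]).abs_pairing_le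
      (Finsupp.mapDomain p a)
    refine le_trans (le_of_eq ?_) ((le_abs_self _).trans h1)
    rw [pairing, Finsupp.linearCombination_mapDomain, Finsupp.linearCombination_apply,
      Finsupp.sum]
    refine Finset.sum_congr rfl fun k _ => ?_
    simp only [Function.comp, Pi.mul_apply, smul_eq_mul, Finsupp.mapDomain_apply hinj]
    rw [← mul_assoc, self_mul_sign]
  rw [hlin]
  calc ∑ k ∈ a.support, a k * pairing f (y k)
      ≤ ∑ k ∈ a.support, (N * (if k ∈ X ∪ Y then C + 1 else 0) + (C + 1) * (|a k| * g (p k)) +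
          N * ((p k : ℕ) * τ k)) := by
        refine Finset.sum_le_sum fun k _ => (le_abs_self _).trans ?_
        rw [abs_mul]
        refine (mul_le_mul_of_nonneg_left (hk k) (abs_nonneg _)).trans ?_
        have h1 : |a k| * (if k ∈ X ∪ Y then C + 1 else 0) ≤
            N * (if k ∈ X ∪ Y then C + 1 else 0) :=
          mul_le_mul_of_nonneg_right (haN k) (by split_ifs <;> linarith)
        have h2 : |a k| * ((p k : ℕ) * τ k) ≤ N * ((p k : ℕ) * τ k) :=
          mul_le_mul_of_nonneg_right (haN k) (mul_nonneg (Nat.cast_nonneg _) (D.τ_nonneg k))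
        linarith
    _ ≤ N * (3 * (C + 1)) + (C + 1) * N + N * 1 := by
        rw [Finset.sum_add_distrib, Finset.sum_add_distrib, ← Finset.mul_sum, ← Finset.mul_sum,
          ← Finset.mul_sum]
        have h1 : ∑ k ∈ a.support, (if k ∈ X ∪ Y then C + 1 else 0) ≤ 3 * (C + 1) := by
          rw [← Finset.sum_filter, Finset.sum_const, nsmul_eq_mul]
          refine mul_le_mul_of_nonneg_right ?_ (by linarith)
          have h2 : (a.support.filter fun k => k ∈ X ∪ Y).card ≤ (X ∪ Y).card :=
            Finset.card_le_card fun k hk => (Finset.mem_filter.1 hk).2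
          have h3 := Finset.card_union_le X Y
          exact_mod_cast (show _ ≤ 3 by omega)
        have h2 := mul_le_mul_of_nonneg_left h1 hN0
        have h3 := mul_le_mul_of_nonneg_left hgsum (show 0 ≤ C + 1 by linarith)
        have h4 := mul_le_mul_of_nonneg_left (hτ a.support) hN0
        linarith
    _ = (4 * (C + 1) + 1) * N := by ring

end

/-! ## The lower estimate -/

lemma restrict_blocks {y : ℕ+ → ℕ+ →₀ ℝ}
    (hy : ∀ k k', k ≠ k' → ∀ n ∈ (y k).support, n ∉ (y k').support) (B : Set ℕ+) (a : ℕ+ →₀ ℝ) :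
    restrict {n | ∃ k ∈ B, n ∈ (y k).support} (∑ k ∈ a.support, a k • y k) =
      ∑ k ∈ (restrict B a).support, restrict B a k • y k := by
  rw [restrict_sum, Finset.sum_subset (support_restrict_subset B a)
    (f := fun k => restrict B a k • y k)]
  · refine Finset.sum_congr rfl fun k _ => ?_
    rw [restrict_smul]
    by_cases hk : k ∈ B
    · rw [restrict_eq_self (E := {n | ∃ k ∈ B, n ∈ (y k).support}) fun n hn => ⟨k, hk, hn⟩]
      simp [restrict_apply, hk]
    · rw [restrict_eq_zero]
      · simp [restrict_apply, hk]
      · rintro n hn ⟨k', hk', hn'⟩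
        exact hy k k' (fun h => hk (h ▸ hk')) n hn hn'
  · intro k _ hk
    have : restrict B a k = 0 := by simpa using hk
    rw [this, zero_smul]

lemma restrict_mapDomain {p : ℕ+ → ℕ+} (hp : Function.Injective p) (E : Set ℕ+) (a : ℕ+ →₀ ℝ) :
    restrict E (Finsupp.mapDomain p a) = Finsupp.mapDomain p (restrict (p ⁻¹' E) a) := by
  ext n
  by_cases hn : n ∈ Set.range p
  · obtain ⟨k, rfl⟩ := hn
    by_cases hk : p k ∈ E <;> simp [restrict_apply, Finsupp.mapDomain_apply hp, hk]
  · rw [Finsupp.mapDomain_of_notMem_range _ _ hn, restrict_apply, Finsupp.mapDomain_of_notMem_range _ _ hn,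
      ite_self]

/-- Normalized blocks `y k` supported after `p k` dominate the unit vectors `e_{p k}`. -/
theorem tnorm_mapDomain_le (P : Params) {y : ℕ+ → ℕ+ →₀ ℝ} {p : ℕ+ → ℕ+} (hp : StrictMono p)
    (hpy : ∀ k, ∀ n ∈ (y k).support, p k ≤ n)
    (hy : ∀ k k', k < k' → Precedes (y k).support (y k').support)
    (hy1 : ∀ k, tnorm P (y k) = 1) (a : ℕ+ →₀ ℝ) :
    tnorm P (Finsupp.mapDomain p a) ≤ tnorm P (∑ k ∈ a.support, a k • y k) := by
  have hdisj : ∀ k k', k ≠ k' → ∀ n ∈ (y k).support, n ∉ (y k').support := by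
    intro k k' hne n hn hn'
    rcases lt_or_gt_of_ne hne with h | h
    · exact lt_irrefl _ (hy k k' h n hn n hn')
    · exact lt_irrefl _ (hy k' k h n hn' n hn)
  refine ciSup_le fun i => ?_
  have hc0 : ∀ a : ℕ+ →₀ ℝ, c0Norm (Finsupp.mapDomain p a) ≤
      tnorm P (∑ k ∈ a.support, a k • y k) := by
    intro a
    refine ciSup_le fun n => ?_
    by_cases hn : n ∈ Set.range p
    · obtain ⟨k, rfl⟩ := hn
      rw [Finsupp.mapDomain_apply hp.injective]
      refine le_trans ?_ (tnorm_restrict_le P {n | ∃ k' ∈ ({k} : Set ℕ+), n ∈ (y k').support} _)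
      rw [restrict_blocks hdisj]
      have : ∑ k' ∈ (restrict {k} a).support, restrict {k} a k' • y k' = a k • y k := by
        rw [Finset.sum_subset (s₂ := {k})]
        · simp [restrict_apply]
        · intro x hx
          by_contra hne
          have h1 : restrict {k} a x = 0 := by
            rw [restrict_apply, if_neg]
            simpa using hne
          exact (Finsupp.mem_support_iff.1 hx) h1
        · intro x _ hx
          have : restrict {k} a x = 0 := by simpa using hx
          rw [this, zero_smul]
      rw [this, tnorm_smul, hy1, mul_one]
    · rw [Finsupp.mapDomain_of_notMem_range _ _ hn, abs_zero]
      exact tnorm_nonneg P _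
  induction i generalizing a with
  | zero => exact hc0 a
  | succ i ih =>
    refine step_le (hc0 a) ?_
    rintro _ ⟨n, K, E, hE, rfl⟩
    -- Each `E s` is lifted to the supports of the blocks with `p k ∈ E s`. The minima do not
    -- decrease, so spreading applies with the old minima as anchors.
    set F : Fin K → Set ℕ+ := fun s => {n | ∃ k ∈ p ⁻¹' E s, n ∈ (y k).support}
    have hF : AdaptedOn n (P.σ n) Finset.univ F := by
      have hsep := hE.adaptedOn.2
      obtain ⟨⟨m, hm, hA⟩, -⟩ := hE
      refine adaptedOn_of_spread hA m ?_ (fun s _ _ => Finset.mem_image_of_mem m (by simp)) ?_ ?_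
      · intro s hs t ht _ _ hst
        by_contra hne
        refine Set.disjoint_left.1 (hsep s hs t ht hne).disjoint (hm s).1 ?_
        rw [hst]; exact (hm t).1
      · rintro s - x ⟨k, hk, hx⟩
        exact ((hm s).2 hk).trans (hpy k x hx)
      · intro s hs t ht hne
        have h := hsep s hs t ht hne
        cases hσ : P.σ n with
        | M =>
          refine Set.disjoint_left.2 ?_
          rintro x ⟨k, hk, hx⟩ ⟨k', hk', hx'⟩
          by_cases hkk : k = k'
          · subst hkk
            exact Set.disjoint_left.1 h.disjoint hk hk'
          · exact hdisj k k' hkk x hx hx'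
        | U =>
          rw [hσ] at h
          rcases h with h | h
          · refine Or.inl ?_
            rintro x ⟨k, hk, hx⟩ x' ⟨k', hk', hx'⟩
            exact hy k k' (hp.lt_iff_lt.1 (h _ hk _ hk')) x hx x' hx'
          · refine Or.inr ?_
            rintro x ⟨k, hk, hx⟩ x' ⟨k', hk', hx'⟩
            exact hy k' k (hp.lt_iff_lt.1 (h _ hk _ hk')) x' hx' x hx
    refine le_trans (mul_le_mul_of_nonneg_left (Finset.sum_le_sum fun s _ => ?_) (P.θ_pos n).le)
      (hF.norm_le P _)
    rw [restrict_mapDomain hp.injective, restrict_blocks hdisj]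
    exact ih _

/-! ## Blocks with large lower estimates -/

/-- A fast growing block sequence, with the minima and bounds of the supports. -/
structure IsFastBlockSeq (z : ℕ → ℕ+ →₀ ℝ) (m q : ℕ → ℕ+) : Prop where
  least : ∀ i, IsLeast ((z i).support : Set ℕ+) (m i)
  le : ∀ i, ∀ n ∈ (z i).support, n ≤ q i
  sparse : ∀ i i', i < i' → 8 * q i ≤ m i'

lemma PNat.lt_eight_mul (n : ℕ+) : n < 8 * n := by
  rw [← PNat.coe_lt_coe]
  push_cast
  have := n.pos
  have : ((8 : ℕ+) : ℕ) = 8 := rfl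
  omega

section

variable {z : ℕ → ℕ+ →₀ ℝ} {m q : ℕ → ℕ+}

lemma IsFastBlockSeq.m_le_q (h : IsFastBlockSeq z m q) (i : ℕ) : m i ≤ q i :=
  h.le i _ (h.least i).1

lemma IsFastBlockSeq.q_lt_m (h : IsFastBlockSeq z m q) {i i' : ℕ} (hi : i < i') : q i < m i' :=
  (PNat.lt_eight_mul _).trans_le (h.sparse i i' hi)

lemma IsFastBlockSeq.strictMono (h : IsFastBlockSeq z m q) : StrictMono m := fun _ _ hi =>
  (h.m_le_q _).trans_lt (h.q_lt_m hi)

lemma IsFastBlockSeq.precedes (h : IsFastBlockSeq z m q) {i i' : ℕ} (hi : i < i') :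
    Precedes (z i).support (z i').support := fun a ha _ hb =>
  ((h.le i a ha).trans_lt (h.q_lt_m hi)).trans_le ((h.least i').2 hb)

lemma IsFastBlockSeq.disjoint (h : IsFastBlockSeq z m q) {i i' : ℕ} (hi : i ≠ i') {n : ℕ+}
    (hn : n ∈ (z i).support) : n ∉ (z i').support := fun hn' => by
  rcases lt_or_gt_of_ne hi with h1 | h1
  · exact lt_irrefl _ (h.precedes h1 n hn n hn')
  · exact lt_irrefl _ (h.precedes h1 n hn' n hn)

/-- The restriction of a combination of blocks to a part of one of them. -/
lemma IsFastBlockSeq.restrict_combination (h : IsFastBlockSeq z m q) {J : Finset ℕ} (b : ℕ → ℝ) {i : ℕ}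
    (hi : i ∈ J) {E : Set ℕ+} (hE : E ⊆ (z i).support) :
    restrict E (∑ i ∈ J, b i • z i) = b i • restrict E (z i) := by
  rw [restrict_sum, Finset.sum_eq_single i, restrict_smul]
  · intro i' _ hne
    rw [restrict_smul, restrict_eq_zero, smul_zero]
    exact fun n hn hnE => h.disjoint hne hn (hE hnE)
  · intro h'; exact absurd hi h'

end

lemma exists_fastBlockSeq {V : Set (ℕ+ →₀ ℝ)}
    (hV : ∀ N : ℕ+, ∃ v ∈ V, v ≠ 0 ∧ ∀ n ∈ v.support, N < n) (N : ℕ+) :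
    ∃ z m q, IsFastBlockSeq z m q ∧ (∀ i, z i ∈ V) ∧ ∀ i, N < m i := by
  have : ∀ N : ℕ+, ∃ (v : ℕ+ →₀ ℝ) (a c : ℕ+), v ∈ V ∧ IsLeast (v.support : Set ℕ+) a ∧
      (∀ n ∈ v.support, n ≤ c) ∧ N < a := by
    intro N
    obtain ⟨v, hv, hne, hN⟩ := hV N
    have hs : v.support.Nonempty := Finsupp.support_nonempty_iff.2 hne
    exact ⟨v, v.support.min' hs, v.support.max' hs, hv, v.support.isLeast_min' hs,
      fun n hn => v.support.le_max' n hn, hN _ (v.support.min'_mem hs)⟩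
  choose v a c h1 h2 h3 h4 using this
  let Ns : ℕ → ℕ+ := fun i => Nat.rec N (fun _ n => 8 * c n) i
  have hac : ∀ n, a n ≤ c n := fun n => h3 n _ (h2 n).1
  have hstep : ∀ i, 8 * c (Ns i) < a (Ns (i + 1)) := fun i => h4 _
  have hmono : StrictMono fun i => a (Ns i) := strictMono_nat_of_lt_succ fun i =>
    ((hac _).trans_lt (PNat.lt_eight_mul _)).trans (hstep i)
  refine ⟨fun i => v (Ns i), fun i => a (Ns i), fun i => c (Ns i), ⟨fun i => h2 _, fun i => h3 _,
    fun i i' hi => ?_⟩, fun i => h1 _, fun i => ?_⟩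
  · exact (hstep i).le.trans (hmono.monotone hi)
  · exact (h4 N).trans_le (hmono.monotone (Nat.zero_le i))

/-- `v` has successive parts, with minima in `S_{rL}`, whose norms add up to `c⁻ʳ` at least. -/
def HasParts (P : Params) (L : ℕ) (c : ℝ) (r : ℕ) (v : ℕ+ →₀ ℝ) : Prop :=
  ∃ 𝓔 : Finset (Set ℕ+), AdaptedOn (r * L) Mode.U 𝓔 id ∧
    (∀ E ∈ 𝓔, E.Nonempty ∧ E ⊆ v.support) ∧ c⁻¹ ^ r ≤ ∑ E ∈ 𝓔, tnorm P (restrict E v)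

lemma hasParts_zero (P : Params) (L : ℕ) (c : ℝ) {v : ℕ+ →₀ ℝ} (hv : tnorm P v = 1) :
    HasParts P L c 0 v := by
  have hne : v.support.Nonempty := by
    rw [Finsupp.support_nonempty_iff]
    rintro rfl
    rw [tnorm_zero] at hv
    exact zero_ne_one hv
  refine ⟨{↑v.support}, ⟨⟨{v.support.min' hne}, ?_, ?_⟩, ?_⟩, ?_, ?_⟩
  · rw [zero_mul]; simp [schreier]
  · intro E hE m hm
    obtain rfl : E = v.support := by simpa using hE
    simpa using hm.unique (v.support.isLeast_min' hne)
  · intro E hE F hF hne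
    rw [Finset.mem_singleton] at hE hF
    exact absurd (hE.trans hF.symm) hne
  · intro E hE
    obtain rfl : E = v.support := by simpa using hE
    exact ⟨hne, subset_rfl⟩
  · rw [Finset.sum_singleton, restrict_eq_self (by simp), hv, pow_zero]

/-- Successive parts are adapted in either mode and for every order `n ≥ r * L`, so the implicit
equation bounds their sum by `(θ n)⁻¹`. -/
lemma HasParts.pow_le {P : Params} {L : ℕ} {c : ℝ} {r : ℕ} {v : ℕ+ →₀ ℝ}
    (h : HasParts P L c r v) (hv : tnorm P v = 1) {n : ℕ+} (hn : r * L ≤ n) :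
    P.θ n * c⁻¹ ^ r ≤ 1 := by
  obtain ⟨𝓔, ⟨⟨A, hA, hmin⟩, hsep⟩, -, hsum⟩ := h
  have had : AdaptedOn n (P.σ n) 𝓔 id :=
    ⟨⟨A, schreier_mono hn hA, hmin⟩, fun i hi j hj hij => (hsep i hi j hj hij).of_unmodified⟩
  rw [← hv]
  exact (mul_le_mul_of_nonneg_left hsum (P.θ_pos n).le).trans (had.norm_le P v)

/-- Combining vectors with parts. -/
lemma HasParts.combine {P : Params} {L : ℕ} {c : ℝ} (hc : 0 < c) {r : ℕ} {z : ℕ → ℕ+ →₀ ℝ}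
    {m q : ℕ → ℕ+} (hz : IsFastBlockSeq z m q) (hparts : ∀ i, HasParts P L c r (z i))
    {J : Finset ℕ} {b : ℕ → ℝ} (hb : ∀ i ∈ J, 0 < b i) (hsum : ∑ i ∈ J, b i = 1)
    (hJ : J.image m ∈ schreier L) {t : ℝ} (ht : 0 < t) (htc : t ≤ c) :
    HasParts P L c (r + 1) (t⁻¹ • ∑ i ∈ J, b i • z i) := by
  classical
  choose 𝓔 hadapt hE hle using hparts
  have hsub : ∀ i, ∀ E ∈ 𝓔 i, E ⊆ (z i).support := fun i E h => (hE i E h).2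
  have hne : ∀ i, ∀ E ∈ 𝓔 i, E.Nonempty := fun i E h => (hE i E h).1
  have hrestr : ∀ i ∈ J, ∀ E ∈ 𝓔 i, restrict E (t⁻¹ • ∑ i ∈ J, b i • z i) =
      (t⁻¹ * b i) • restrict E (z i) := by
    intro i hi E hEi
    rw [restrict_smul, hz.restrict_combination b hi (hsub i E hEi), smul_smul]
  refine ⟨J.biUnion 𝓔, ⟨?_, ?_⟩, ?_, ?_⟩
  · choose A hA hmin using fun i => (hadapt i).1
    refine ⟨J.biUnion fun i => A i ∩ (z i).support, ?_, ?_⟩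
    · rw [Nat.succ_mul]
      refine schreier_biUnion_mem (hz.strictMono.strictMonoOn _) hJ
        (fun i _ => schreier_subset (hA i) Finset.inter_subset_left) ?_ ?_
      · intro i _ x hx
        exact (hz.least i).2 (Finset.mem_inter.1 hx).2
      · intro i _ i' _ hii a ha a' ha'
        exact hz.precedes hii a (Finset.mem_inter.1 ha).2 a' (Finset.mem_inter.1 ha').2
    · intro E hE a ha
      obtain ⟨i, hi, hEi⟩ := Finset.mem_biUnion.1 hE
      exact Finset.mem_biUnion.2 ⟨i, hi, Finset.mem_inter.2
        ⟨hmin i E hEi a ha, hsub i E hEi ha.1⟩⟩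
  · intro E hE F hF hne
    obtain ⟨i, hi, hEi⟩ := Finset.mem_biUnion.1 hE
    obtain ⟨i', hi', hFi⟩ := Finset.mem_biUnion.1 hF
    rcases lt_trichotomy i i' with h | rfl | h
    · exact Or.inl fun a ha a' ha' => hz.precedes h a (hsub _ _ hEi ha) a' (hsub _ _ hFi ha')
    · exact (hadapt i).2 E hEi F hFi hne
    · exact Or.inr fun a ha a' ha' => hz.precedes h a' (hsub _ _ hFi ha') a (hsub _ _ hEi ha)
  · intro E hE
    obtain ⟨i, hi, hEi⟩ := Finset.mem_biUnion.1 hE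
    refine ⟨hne i E hEi, fun n hn => ?_⟩
    have h1 : restrict E (t⁻¹ • ∑ i ∈ J, b i • z i) n = (t⁻¹ * b i) * z i n := by
      rw [hrestr i hi E hEi]
      simp [restrict_apply, hn]
    have h2 : z i n ≠ 0 := by simpa using hsub i E hEi hn
    have h3 : (t⁻¹ • ∑ i ∈ J, b i • z i) n = (t⁻¹ * b i) * z i n := by
      rw [← h1, restrict_apply, if_pos hn]
    refine Finset.mem_coe.2 (Finsupp.mem_support_iff.2 ?_)
    rw [h3]
    exact mul_ne_zero (mul_pos (inv_pos.2 ht) (hb i hi)).ne' h2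
  · rw [Finset.sum_biUnion]
    · have h1 : ∀ i ∈ J, t⁻¹ * b i * c⁻¹ ^ r ≤
          ∑ E ∈ 𝓔 i, tnorm P (restrict E (t⁻¹ • ∑ i ∈ J, b i • z i)) := by
        intro i hi
        have h2 : ∀ E ∈ 𝓔 i, tnorm P (restrict E (t⁻¹ • ∑ i ∈ J, b i • z i)) =
            (t⁻¹ * b i) * tnorm P (restrict E (z i)) := by
          intro E hEi
          rw [hrestr i hi E hEi, tnorm_smul, abs_of_pos (mul_pos (inv_pos.2 ht) (hb i hi))]
        rw [Finset.sum_congr rfl h2, ← Finset.mul_sum]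
        exact mul_le_mul_of_nonneg_left (hle i) (mul_pos (inv_pos.2 ht) (hb i hi)).le
      refine le_trans ?_ (Finset.sum_le_sum h1)
      rw [← Finset.sum_mul, ← Finset.mul_sum, hsum, mul_one, pow_succ, mul_comm]
      exact mul_le_mul_of_nonneg_right (inv_anti₀ ht htc) (by positivity)
    -- Nonemptiness of the parts makes the families of different blocks disjoint as collections of
    -- sets.
    · intro i hi i' hi' hii
      refine Finset.disjoint_left.2 fun E h1 h2 => ?_
      obtain ⟨n, hn⟩ := hne i E h1
      exact hz.disjoint hii (hsub i E h1 hn) (hsub i' E h2 hn)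

/-- In every block subspace there are normalized vectors, arbitrarily far out, whose successive
sequences have a lower `ℓ¹`-estimate with constant `c` on the sets of `S_L`. -/
theorem exists_lower_l1 (P : Params) {L : ℕ} {c : ℝ} (hc : 0 < c) {r₀ : ℕ} {n : ℕ+}
    (hn : r₀ * L ≤ n) (hθ : c ^ r₀ < P.θ n) (Y : Submodule ℝ (ℕ+ →₀ ℝ))
    (hY : ∀ N : ℕ+, ∃ v ∈ Y, v ≠ 0 ∧ ∀ n ∈ v.support, N < n) :
    ∃ (V : Set (ℕ+ →₀ ℝ)) (N₀ : ℕ+), (∀ v ∈ V, v ∈ Y ∧ tnorm P v = 1) ∧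
      (∀ N : ℕ+, ∃ v ∈ V, v ≠ 0 ∧ ∀ n ∈ v.support, N < n) ∧
      ∀ z m q, IsFastBlockSeq z m q → (∀ i, z i ∈ V) → (∀ i, N₀ < m i) →
        ∀ (J : Finset ℕ) (b : ℕ → ℝ), (∀ i, 0 ≤ b i) → ∑ i ∈ J, b i = 1 →
          J.image m ∈ schreier L → c ≤ tnorm P (∑ i ∈ J, b i • z i) := by
  classical
  have hne : ∀ v, tnorm P v = 1 → v ≠ 0 := by
    rintro v hv rfl
    rw [tnorm_zero] at hv
    exact zero_ne_one hv
  set Far : ℕ → Prop := fun r => ∀ N : ℕ+, ∃ v ∈ Y, tnorm P v = 1 ∧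
    (∀ n ∈ v.support, N < n) ∧ HasParts P L c r v with hFar
  have h0 : Far 0 := by
    intro N
    obtain ⟨v, hv, hv0, hN⟩ := hY N
    have hpos : tnorm P v ≠ 0 := fun h => hv0 ((tnorm_eq_zero_iff P v).1 h)
    have h1 : tnorm P ((tnorm P v)⁻¹ • v) = 1 := by
      rw [tnorm_smul, abs_of_nonneg (inv_nonneg.2 (tnorm_nonneg P v)), inv_mul_cancel₀ hpos]
    exact ⟨_, Y.smul_mem _ hv, h1, fun n hn => hN n (Finsupp.support_smul hn),
      hasParts_zero P L c h1⟩
  have hr : ¬ Far r₀ := by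
    intro h
    obtain ⟨v, -, hv, -, hp⟩ := h 1
    have h1 := hp.pow_le hv hn
    have h2 : c ^ r₀ * c⁻¹ ^ r₀ = 1 := by rw [← mul_pow, mul_inv_cancel₀ hc.ne', one_pow]
    have h3 : c ^ r₀ * c⁻¹ ^ r₀ < P.θ n * c⁻¹ ^ r₀ :=
      mul_lt_mul_of_pos_right hθ (pow_pos (inv_pos.2 hc) _)
    linarith
  -- A level that is reached arbitrarily far out while the next one is not.
  obtain ⟨r, hr1, hr2⟩ : ∃ r, Far r ∧ ¬ Far (r + 1) := by
    by_contra! hcon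
    exact hr (Nat.rec h0 (fun r h => hcon r h) r₀)
  simp only [hFar] at hr2
  push Not at hr2
  obtain ⟨N₀, hN₀⟩ := hr2
  refine ⟨{v | v ∈ Y ∧ tnorm P v = 1 ∧ HasParts P L c r v}, N₀, fun v hv => ⟨hv.1, hv.2.1⟩, ?_, ?_⟩
  · intro N
    obtain ⟨v, h1, h2, h3, h4⟩ := hr1 N
    exact ⟨v, ⟨h1, h2, h4⟩, hne v h2, h3⟩
  · intro z m q hz hzV hm J b hb hsum hJ
    -- `HasParts.combine` needs positive coefficients, since its parts must lie in the support of
    -- the combination.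
    set J' := J.filter fun i => 0 < b i
    have hzero : ∀ i ∈ J, i ∉ J' → b i = 0 := fun i hi hi' => by
      by_contra h
      exact hi' (Finset.mem_filter.2 ⟨hi, lt_of_le_of_ne (hb i) (Ne.symm h)⟩)
    have hsub : J' ⊆ J := Finset.filter_subset _ _
    have e1 : ∑ i ∈ J, b i • z i = ∑ i ∈ J', b i • z i :=
      (Finset.sum_subset hsub fun i hi hi' => by rw [hzero i hi hi', zero_smul]).symm
    have e2 : ∑ i ∈ J', b i = 1 :=
      (Finset.sum_subset hsub fun i hi hi' => hzero i hi hi').trans hsum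
    have hJ' : J'.image m ∈ schreier L := schreier_subset hJ (Finset.image_subset_image hsub)
    rw [e1]
    set w := ∑ i ∈ J', b i • z i with hw
    -- If the norm were below `c`, the normalized combination would reach level `r + 1` beyond `N₀`.
    by_contra! hlt
    have hpos : 0 < tnorm P w := by
      obtain ⟨i, hi⟩ : J'.Nonempty := by
        rw [Finset.nonempty_iff_ne_empty]
        rintro h
        rw [h] at e2
        simp at e2
      refine lt_of_lt_of_le ?_ (tnorm_restrict_le P ((z i).support : Set ℕ+) w)
      rw [hz.restrict_combination b hi subset_rfl, restrict_eq_self (by simp), tnorm_smul, (hzV i).2.1,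
        mul_one]
      exact abs_pos.2 (Finset.mem_filter.1 hi).2.ne'
    have hwY : w ∈ Y := Y.sum_mem fun i _ => Y.smul_mem _ (hzV i).1
    refine hN₀ ((tnorm P w)⁻¹ • w) (Y.smul_mem _ hwY) ?_ ?_ ?_
    · rw [tnorm_smul, abs_of_pos (inv_pos.2 hpos), inv_mul_cancel₀ hpos.ne']
    · intro n hn
      have hn' : n ∈ w.support := Finsupp.support_smul hn
      obtain ⟨i, hi, hni⟩ := Finset.mem_biUnion.1 (Finsupp.support_finsetSum hn')
      exact (hm i).trans_le ((hz.least i).2 (Finsupp.support_smul hni))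
    · exact HasParts.combine hc hz (fun i => (hzV i).2.2)
        (fun i hi => (Finset.mem_filter.1 hi).2) e2 hJ' hpos hlt.le

/-! ## Splitting vectors into sets which start early -/

/-- The sums `∑ ‖F x‖` over finite disjoint families of subsets of `E` meeting `[1, m]`. -/
def splitSums (P : Params) (x : ℕ+ →₀ ℝ) (m : ℕ+) (E : Set ℕ+) : Set ℝ :=
  {r | ∃ 𝓕 : Finset (Set ℕ+), (∀ F ∈ 𝓕, F ⊆ E ∧ ∃ e ∈ F, e ≤ m) ∧
    (∀ F ∈ 𝓕, ∀ G ∈ 𝓕, F ≠ G → Disjoint F G) ∧ r = ∑ F ∈ 𝓕, tnorm P (restrict F x)}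

/-- The supremum of the sums `∑ ‖F x‖` over disjoint subsets `F` of `E` meeting `[1, m]`. -/
def splitSup (P : Params) (x : ℕ+ →₀ ℝ) (m : ℕ+) (E : Set ℕ+) : ℝ := sSup (splitSums P x m E)

lemma card_le_of_meets {m : ℕ+} {𝓕 : Finset (Set ℕ+)} (h1 : ∀ F ∈ 𝓕, ∃ e ∈ F, e ≤ m)
    (h2 : ∀ F ∈ 𝓕, ∀ G ∈ 𝓕, F ≠ G → Disjoint F G) : 𝓕.card ≤ m := by
  classical
  choose! e he hem using h1
  have hle : 𝓕.card ≤ (Finset.Icc 1 (m : ℕ)).card := by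
    refine Finset.card_le_card_of_injOn (fun F => (e F : ℕ)) (fun F hF => Finset.mem_coe.2
      (Finset.mem_Icc.2 ⟨(e F).pos, PNat.coe_le_coe _ _ |>.2 (hem F hF)⟩)) ?_
    intro F hF G hG hFG
    by_contra hne
    refine Set.disjoint_left.1 (h2 F hF G hG hne) (he F hF) ?_
    rw [PNat.coe_injective hFG]
    exact he G hG
  simpa using hle

section

variable {P : Params} {x : ℕ+ →₀ ℝ} {m : ℕ+}

/-- This is where the presence of a modified family is used. -/
lemma sum_le_of_meets {s : ℕ+} (hs : P.σ s = Mode.M) (hx : ∀ n ∈ x.support, m ≤ n)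
    {𝓕 : Finset (Set ℕ+)} (h1 : ∀ F ∈ 𝓕, ∃ e ∈ F, e ≤ m)
    (h2 : ∀ F ∈ 𝓕, ∀ G ∈ 𝓕, F ≠ G → Disjoint F G) :
    P.θ s * ∑ F ∈ 𝓕, tnorm P (restrict F x) ≤ tnorm P x := by
  classical
  have had : AdaptedOn s (P.σ s) 𝓕 fun F => F ∩ (x.support : Set ℕ+) := by
    have hex : ∀ F : Set ℕ+, (F ∩ (x.support : Set ℕ+)).Nonempty → ∃ a, IsLeast (F ∩ (x.support : Set ℕ+)) a :=
      fun F h => exists_isLeast_pnat h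
    choose! a ha using hex
    refine ⟨⟨(𝓕.filter fun F => (F ∩ (x.support : Set ℕ+)).Nonempty).image a, ?_, ?_⟩, ?_⟩
    -- There are at most `m` sets and their minima on the support are at least `m`, so the minima
    -- already form a member of `S₁`. Disjointness is all that mode `M` asks for besides.
    · refine schreier_mono s.pos ?_
      intro b hb
      obtain ⟨F, hF, rfl⟩ := Finset.mem_image.1 hb
      obtain ⟨hF, hne⟩ := Finset.mem_filter.1 hF
      refine Finset.card_image_le.trans ((Finset.card_filter_le _ _).trans
        ((card_le_of_meets h1 h2).trans ?_))
      exact PNat.coe_le_coe _ _ |>.2 (hx _ (ha F hne).1.2)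
    · intro F hF b hb
      rw [hb.unique (ha F ⟨b, hb.1⟩)]
      exact Finset.mem_image_of_mem a (Finset.mem_filter.2 ⟨hF, ⟨b, hb.1⟩⟩)
    · intro F hF G hG hne
      rw [hs]
      exact (h2 F hF G hG hne).mono Set.inter_subset_left Set.inter_subset_left
  simpa only [restrict_inter_support] using had.norm_le P x

lemma splitSums_le {s : ℕ+} (hs : P.σ s = Mode.M) (hx : ∀ n ∈ x.support, m ≤ n) {E : Set ℕ+}
    {r : ℝ} (hr : r ∈ splitSums P x m E) : r ≤ (P.θ s)⁻¹ * tnorm P x := by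
  obtain ⟨𝓕, h1, h2, rfl⟩ := hr
  rw [← div_eq_inv_mul, le_div_iff₀' (P.θ_pos s)]
  exact sum_le_of_meets hs hx (fun F hF => (h1 F hF).2) h2

lemma zero_mem_splitSums (E : Set ℕ+) : (0 : ℝ) ∈ splitSums P x m E :=
  ⟨∅, by simp, by simp, by simp⟩

lemma splitSup_le {s : ℕ+} (hs : P.σ s = Mode.M) (hx : ∀ n ∈ x.support, m ≤ n) (E : Set ℕ+) :
    splitSup P x m E ≤ (P.θ s)⁻¹ * tnorm P x :=
  csSup_le ⟨0, zero_mem_splitSums E⟩ fun _ hr => splitSums_le hs hx hr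

lemma bddAbove_splitSums (hx : ∀ n ∈ x.support, m ≤ n) (E : Set ℕ+) :
    BddAbove (splitSums P x m E) := by
  obtain ⟨s, hs⟩ := P.exists_modified
  exact ⟨_, fun _ hr => splitSums_le hs hx hr⟩

lemma splitSup_nonneg (hx : ∀ n ∈ x.support, m ≤ n) (E : Set ℕ+) : 0 ≤ splitSup P x m E :=
  le_csSup (bddAbove_splitSums hx E) (zero_mem_splitSums E)

lemma tnorm_restrict_le_splitSup (hx : ∀ n ∈ x.support, m ≤ n) {E : Set ℕ+}
    (hE : ∃ e ∈ E, e ≤ m) : tnorm P (restrict E x) ≤ splitSup P x m E := by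
  refine le_csSup (bddAbove_splitSums hx E) ⟨{E}, ?_, ?_, by simp⟩
  · intro F hF
    obtain rfl := Finset.mem_singleton.1 hF
    exact ⟨subset_rfl, hE⟩
  · intro F hF G hG hne
    rw [Finset.mem_singleton] at hF hG
    exact absurd (hF.trans hG.symm) hne

lemma splitSup_mono (hx : ∀ n ∈ x.support, m ≤ n) {E F : Set ℕ+} (h : E ⊆ F) :
    splitSup P x m E ≤ splitSup P x m F := by
  refine csSup_le ⟨0, zero_mem_splitSums E⟩ ?_
  rintro _ ⟨𝓕, h1, h2, rfl⟩
  exact le_csSup (bddAbove_splitSums hx F)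
    ⟨𝓕, fun G hG => ⟨(h1 G hG).1.trans h, (h1 G hG).2⟩, h2, rfl⟩

/-- Families inside disjoint sets can be merged. This superadditivity, which the norm of a
restriction lacks, is the purpose of taking the supremum over families. -/
lemma splitSup_add_le (hx : ∀ n ∈ x.support, m ≤ n) {E F : Set ℕ+} (h : Disjoint E F) :
    splitSup P x m E + splitSup P x m F ≤ splitSup P x m (E ∪ F) := by
  classical
  have key : ∀ r ∈ splitSums P x m E, ∀ s ∈ splitSums P x m F,
      r + s ≤ splitSup P x m (E ∪ F) := by
    rintro _ ⟨𝓔, h1, h2, rfl⟩ _ ⟨𝓕, h1', h2', rfl⟩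
    have hEF : ∀ A ∈ 𝓔, ∀ B ∈ 𝓕, Disjoint A B := fun A hA B hB =>
      h.mono (h1 A hA).1 (h1' B hB).1
    have hd : Disjoint 𝓔 𝓕 := Finset.disjoint_left.2 fun A hA hA' => by
      obtain ⟨e, he, -⟩ := (h1 A hA).2
      exact Set.disjoint_left.1 (hEF A hA A hA') he he
    refine le_csSup (bddAbove_splitSums hx _) ⟨𝓔 ∪ 𝓕, ?_, ?_, (Finset.sum_union hd).symm⟩
    · intro A hA
      rcases Finset.mem_union.1 hA with hA | hA
      · exact ⟨(h1 A hA).1.trans Set.subset_union_left, (h1 A hA).2⟩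
      · exact ⟨(h1' A hA).1.trans Set.subset_union_right, (h1' A hA).2⟩
    · intro A hA B hB hne
      rcases Finset.mem_union.1 hA with hA | hA <;> rcases Finset.mem_union.1 hB with hB | hB
      · exact h2 A hA B hB hne
      · exact hEF A hA B hB
      · exact (hEF B hB A hA).symm
      · exact h2' A hA B hB hne
  have h1 : ∀ s ∈ splitSums P x m F, splitSup P x m E ≤ splitSup P x m (E ∪ F) - s :=
    fun s hs => csSup_le ⟨0, zero_mem_splitSums E⟩ fun r hr => by linarith [key r hr s hs]
  have h2 : splitSup P x m F ≤ splitSup P x m (E ∪ F) - splitSup P x m E :=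
    csSup_le ⟨0, zero_mem_splitSums F⟩ fun s hs => by linarith [h1 s hs]
  linarith

lemma sum_splitSup_le (hx : ∀ n ∈ x.support, m ≤ n) {ι : Type*} {T : Finset ι}
    {E : ι → Set ℕ+} {F : Set ℕ+} (hE : ∀ i ∈ T, E i ⊆ F)
    (hd : ∀ i ∈ T, ∀ j ∈ T, i ≠ j → Disjoint (E i) (E j)) :
    ∑ i ∈ T, splitSup P x m (E i) ≤ splitSup P x m F := by
  classical
  suffices h : ∑ i ∈ T, splitSup P x m (E i) ≤ splitSup P x m (⋃ i ∈ T, E i) from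
    h.trans (splitSup_mono hx (Set.iUnion₂_subset hE))
  clear hE
  induction T using Finset.induction_on with
  | empty => simpa using splitSup_nonneg hx ∅
  | insert a T ha ih =>
    rw [Finset.sum_insert ha, Finset.set_biUnion_insert]
    have h1 := ih fun i hi j hj => hd i (by simp [hi]) j (by simp [hj])
    have h2 : Disjoint (E a) (⋃ i ∈ T, E i) := by
      rw [Set.disjoint_iUnion₂_right]
      intro i hi
      exact hd a (by simp) i (by simp [hi]) fun h => ha (h ▸ hi)
    linarith [splitSup_add_le (P := P) hx h2]

end

/-! ## The blocks -/

/-- A normalized vector supported after `p`, with a superadditive set function controlling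
its splittings by adapted families of order less than `l`. -/
structure IsSplitBlock (P : Params) (p : ℕ+) (l : ℕ) (η C : ℝ) (y : ℕ+ →₀ ℝ)
    (μ : Set ℕ+ → ℝ) : Prop where
  norm_eq : tnorm P y = 1
  supp : ∀ n ∈ y.support, p < n
  nonneg : ∀ E, 0 ≤ μ E
  le : ∀ E, μ E ≤ C
  super : ∀ (K : ℕ) (E : Fin K → Set ℕ+) (F : Set ℕ+) (T : Finset (Fin K)),
    (∀ i ∈ T, E i ⊆ F) → (∀ i ∈ T, ∀ j ∈ T, i ≠ j → Disjoint (E i) (E j)) →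
    ∑ i ∈ T, μ (E i) ≤ μ F
  norm_le : ∀ E, (∃ e ∈ E, e ≤ p) → tnorm P (restrict E y) ≤ μ E
  light : ∀ (j : ℕ+) (K : ℕ) (E : Fin K → Set ℕ+) (T : Finset (Fin K)), (j : ℕ) < l →
    AdaptedOn j (P.σ j) T E → ∑ i ∈ T, tnorm P (restrict (E i) y) ≤ ∑ i ∈ T, μ (E i) + η

lemma Params.exists_lower_bound (P : Params) (l : ℕ) :
    ∃ t : ℝ, 0 < t ∧ ∀ j : ℕ+, (j : ℕ) < l → t ≤ P.θ j := by
  induction l with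
  | zero => exact ⟨1, one_pos, fun j hj => absurd hj (Nat.not_lt_zero _)⟩
  | succ l ih =>
    obtain ⟨t, ht, h⟩ := ih
    rcases Nat.eq_zero_or_pos l with rfl | hl
    · exact ⟨1, one_pos, fun j hj => absurd j.pos (by omega)⟩
    · refine ⟨min t (P.θ ⟨l, hl⟩), lt_min ht (P.θ_pos _), fun j hj => ?_⟩
      rcases (Nat.lt_succ_iff.1 hj).lt_or_eq with h1 | h1
      · exact (min_le_left _ _).trans (h j h1)
      · have : j = ⟨l, hl⟩ := PNat.eq h1
        rw [this]
        exact min_le_right _ _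

/-- Adapted sets which start inside of the blocks only see a small part of a special convex
combination. -/
lemma IsFastBlockSeq.sum_started_le {z : ℕ → ℕ+ →₀ ℝ} {m q : ℕ → ℕ+}
    (hz : IsFastBlockSeq z m q) {l : ℕ} {η : ℝ} {J : Finset ℕ} {b : ℕ → ℝ}
    (hb : IsSpecialConvex m l η J b) {j : ℕ+} (hj : (j : ℕ) ≤ l) {A : Finset ℕ+}
    (hA : A ∈ schreier j) {I : Finset ℕ} (hIJ : I ⊆ J)
    (hI : ∀ i ∈ I, ∃ a ∈ A, m i < a ∧ a ≤ q i) : ∑ i ∈ I, b i ≤ 2 * η := by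
  classical
  choose! a haA hma haq using hI
  rcases I.eq_empty_or_nonempty with rfl | hne
  · have h0 := hb.small ∅ (by simp) (by simpa using schreier_empty l)
    simp only [Finset.sum_empty] at h0 ⊢
    linarith
  -- The first index has no element of `A` guaranteed far below it and costs one `η` on its own; the
  -- others form a member of `S_j`, by sparseness, and cost the second.
  set k := I.min' hne
  have hk : k ∈ I := Finset.min'_mem _ _
  rw [← Finset.add_sum_erase I b hk]
  have h1 : b k ≤ η := by
    have := hb.small {k} (by simpa using hIJ hk)
      (schreier_mono (Nat.zero_le _) (by simp [schreier]))
    simpa using this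
  have hsub : I.erase k ⊆ I := Finset.erase_subset _ _
  have h2 : (I.erase k).image m ∈ schreier j := by
    refine schreier_sparse (φ := a) (q := q) j.ne_zero hA (fun i _ => hz.m_le_q i)
      (fun i _ i' _ => hz.sparse i i') ?_ (fun i hi => haA i (hsub hi))
      (fun i hi => haq i (hsub hi)) ?_
    · intro c
      refine le_trans (Finset.card_le_one.2 ?_) (by norm_num : 1 ≤ 4)
      intro i hi i' hi'
      obtain ⟨hi, hic⟩ := Finset.mem_filter.1 hi
      obtain ⟨hi', hic'⟩ := Finset.mem_filter.1 hi'
      rcases lt_trichotomy i i' with h | h | h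
      · have := (haq i (hsub hi)).trans_lt ((hz.q_lt_m h).trans (hma i' (hsub hi')))
        rw [hic, hic'] at this
        exact absurd this (lt_irrefl _)
      · exact h
      · have := (haq i' (hsub hi')).trans_lt ((hz.q_lt_m h).trans (hma i (hsub hi)))
        rw [hic, hic'] at this
        exact absurd this (lt_irrefl _)
    · intro i hi
      have hki : k < i := lt_of_le_of_ne (Finset.min'_le _ _ (hsub hi))
        (Finset.ne_of_mem_erase hi).symm
      exact ⟨a k, haA k hk, (mul_le_mul_right (haq k hk) 8).trans (hz.sparse k i hki)⟩
  have h3 := hb.small (I.erase k) (hsub.trans hIJ) (schreier_mono hj h2)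
  linarith

/-- A normalized special convex combination of vectors with a lower `ℓ¹`-estimate. -/
lemma IsFastBlockSeq.isSplitBlock {P : Params} {z : ℕ → ℕ+ →₀ ℝ} {m q : ℕ → ℕ+}
    (hz : IsFastBlockSeq z m q) (hz1 : ∀ i, tnorm P (z i) = 1) {p : ℕ+} (hp : ∀ i, p < m i)
    {l : ℕ} {η η₀ c : ℝ} (hc : 0 < c) (hη : ∀ j : ℕ+, (j : ℕ) < l → 2 * η₀ ≤ c * η * P.θ j)
    {J : Finset ℕ} {b : ℕ → ℝ} (hb : IsSpecialConvex m l η₀ J b)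
    (hw : c ≤ tnorm P (∑ i ∈ J, b i • z i)) {s : ℕ+} (hs : P.σ s = Mode.M) :
    IsSplitBlock P p l η (c⁻¹ * (P.θ s)⁻¹)
      ((tnorm P (∑ i ∈ J, b i • z i))⁻¹ • ∑ i ∈ J, b i • z i)
      (fun E => (tnorm P (∑ i ∈ J, b i • z i))⁻¹ *
        ∑ i ∈ J, b i * splitSup P (z i) (m i) E) := by
  classical
  set w := ∑ i ∈ J, b i • z i with hwdef
  set t := tnorm P w with ht
  have ht0 : 0 < t := hc.trans_le hw
  have hti : 0 < t⁻¹ := inv_pos.2 ht0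
  have htc : t⁻¹ ≤ c⁻¹ := inv_anti₀ hc hw
  have hm : ∀ i, ∀ n ∈ (z i).support, m i ≤ n := fun i n hn => (hz.least i).2 hn
  have hnorm : ∀ E : Set ℕ+, tnorm P (restrict E (t⁻¹ • w)) ≤
      t⁻¹ * ∑ i ∈ J, b i * tnorm P (restrict E (z i)) := by
    intro E
    rw [restrict_smul, tnorm_smul, abs_of_pos hti, hwdef, restrict_sum]
    refine mul_le_mul_of_nonneg_left ((tnorm_sum_le P _ _).trans
      (le_of_eq (Finset.sum_congr rfl fun i _ => ?_))) hti.le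
    rw [restrict_smul, tnorm_smul, abs_of_nonneg (hb.nonneg i)]
  have hv0 : ∀ i E, 0 ≤ splitSup P (z i) (m i) E := fun i E => splitSup_nonneg (hm i) E
  refine ⟨?_, ?_, ?_, ?_, ?_, ?_, ?_⟩
  · rw [tnorm_smul, abs_of_pos hti, inv_mul_cancel₀ ht0.ne']
  · intro n hn
    obtain ⟨i, hi, hni⟩ := Finset.mem_biUnion.1
      (Finsupp.support_finsetSum (Finsupp.support_smul hn))
    exact (hp i).trans_le (hm i n (Finsupp.support_smul hni))
  · exact fun E => mul_nonneg hti.le (Finset.sum_nonneg fun i _ => mul_nonneg (hb.nonneg i) (hv0 i E))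
  · intro E
    refine mul_le_mul htc ?_ (Finset.sum_nonneg fun i _ => mul_nonneg (hb.nonneg i) (hv0 i E))
      (inv_nonneg.2 hc.le)
    calc ∑ i ∈ J, b i * splitSup P (z i) (m i) E ≤ ∑ i ∈ J, b i * (P.θ s)⁻¹ := by
          refine Finset.sum_le_sum fun i _ => mul_le_mul_of_nonneg_left ?_ (hb.nonneg i)
          have := splitSup_le hs (hm i) E
          rwa [hz1, mul_one] at this
      _ = (P.θ s)⁻¹ := by rw [← Finset.sum_mul, hb.sum_eq, one_mul]
  · intro K E F T hE hd
    rw [← Finset.mul_sum, Finset.sum_comm]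
    refine mul_le_mul_of_nonneg_left (Finset.sum_le_sum fun i _ => ?_) hti.le
    rw [← Finset.mul_sum]
    exact mul_le_mul_of_nonneg_left (sum_splitSup_le (hm i) hE hd) (hb.nonneg i)
  · rintro E ⟨e, he, hep⟩
    refine (hnorm E).trans (mul_le_mul_of_nonneg_left (Finset.sum_le_sum fun i _ => ?_) hti.le)
    exact mul_le_mul_of_nonneg_left
      (tnorm_restrict_le_splitSup (hm i) ⟨e, he, hep.trans (hp i).le⟩) (hb.nonneg i)
  · intro j K E T hj had
    obtain ⟨A, hA, hmin⟩ := had.1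
    -- Sets starting by `m i` are controlled by `splitSup`. The others, `B i`, contribute only for
    -- the indices in `I`, where one of them starts inside `z i`.
    set B : ℕ → Finset (Fin K) := fun i => T.filter fun r => ¬ ∃ e ∈ E r, e ≤ m i
    set I : Finset ℕ := J.filter fun i => ∃ r ∈ B i, ∃ e ∈ E r, e ∈ (z i).support
    have hI : ∑ i ∈ I, b i ≤ 2 * η₀ := by
      refine hz.sum_started_le hb hj.le hA (Finset.filter_subset _ _) fun i hi => ?_
      obtain ⟨-, r, hr, e, he, hez⟩ := Finset.mem_filter.1 hi
      obtain ⟨hrT, hr⟩ := Finset.mem_filter.1 hr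
      obtain ⟨a, ha⟩ := exists_isLeast_pnat ⟨e, he⟩
      push Not at hr
      exact ⟨a, hmin r hrT a ha, hr a ha.1, (ha.2 he).trans (hz.le i e hez)⟩
    -- For one index the sets of `B i` give at most `(θ j)⁻¹`. As `I` has weight at most `2 η₀`, the
    -- total loss is at most `2 η₀ / (c θ j) ≤ η`.
    have hbad : ∀ i, ∑ r ∈ B i, tnorm P (restrict (E r) (z i)) ≤ (P.θ j)⁻¹ := by
      intro i
      have := (had.subset (T' := B i) (Finset.filter_subset _ _)).norm_le P (z i)
      rw [hz1] at this
      rw [inv_eq_one_div, le_div_iff₀' (P.θ_pos j)]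
      exact this
    have hi : ∀ i ∈ J, b i * ∑ r ∈ T, tnorm P (restrict (E r) (z i)) ≤
        b i * ∑ r ∈ T, splitSup P (z i) (m i) (E r) + if i ∈ I then b i * (P.θ j)⁻¹ else 0 := by
      intro i hiJ
      rw [← Finset.sum_filter_add_sum_filter_not T fun r => ∃ e ∈ E r, e ≤ m i, mul_add]
      refine add_le_add (mul_le_mul_of_nonneg_left ?_ (hb.nonneg i)) ?_
      · refine (Finset.sum_le_sum fun r hr => tnorm_restrict_le_splitSup (hm i)
          (Finset.mem_filter.1 hr).2).trans ?_
        exact Finset.sum_le_sum_of_subset_of_nonneg (Finset.filter_subset _ _)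
          fun r _ _ => hv0 i _
      · by_cases hiI : i ∈ I
        · rw [if_pos hiI]
          exact mul_le_mul_of_nonneg_left (hbad i) (hb.nonneg i)
        · rw [if_neg hiI, Finset.sum_eq_zero, mul_zero]
          intro r hr
          rw [restrict_eq_zero, tnorm_zero]
          exact fun n hn hnE => hiI (Finset.mem_filter.2 ⟨hiJ, r, hr, n, hnE, hn⟩)
    calc ∑ r ∈ T, tnorm P (restrict (E r) (t⁻¹ • w))
        ≤ ∑ r ∈ T, t⁻¹ * ∑ i ∈ J, b i * tnorm P (restrict (E r) (z i)) :=
          Finset.sum_le_sum fun r _ => hnorm _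
      _ = t⁻¹ * ∑ i ∈ J, b i * ∑ r ∈ T, tnorm P (restrict (E r) (z i)) := by
          rw [← Finset.mul_sum, Finset.sum_comm]
          simp only [Finset.mul_sum]
      _ ≤ t⁻¹ * (∑ i ∈ J, b i * ∑ r ∈ T, splitSup P (z i) (m i) (E r) +
            ∑ i ∈ I, b i * (P.θ j)⁻¹) := by
          refine mul_le_mul_of_nonneg_left ((Finset.sum_le_sum hi).trans (le_of_eq ?_)) hti.le
          rw [Finset.sum_add_distrib, ← Finset.sum_filter]
          congr 2
          ext i
          simp only [Finset.mem_filter, I]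
          tauto
      _ ≤ _ := by
          rw [mul_add]
          refine add_le_add (le_of_eq ?_) ?_
          · rw [← Finset.mul_sum, Finset.sum_comm]
            simp only [Finset.mul_sum]
          · rw [← Finset.sum_mul]
            have hθ := P.θ_pos j
            have h0 : 0 ≤ ∑ i ∈ I, b i := Finset.sum_nonneg fun i _ => hb.nonneg i
            have h1 : (∑ i ∈ I, b i) * (P.θ j)⁻¹ ≤ c * η := by
              rw [← div_eq_mul_inv, div_le_iff₀ hθ]
              exact hI.trans (hη j hj)
            calc t⁻¹ * ((∑ i ∈ I, b i) * (P.θ j)⁻¹)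
                ≤ c⁻¹ * ((∑ i ∈ I, b i) * (P.θ j)⁻¹) :=
                  mul_le_mul_of_nonneg_right htc (mul_nonneg h0 (inv_nonneg.2 hθ.le))
              _ ≤ c⁻¹ * (c * η) := mul_le_mul_of_nonneg_left h1 (inv_nonneg.2 hc.le)
              _ = η := by field_simp

/-- The hypothesis on `(θₙ)`. -/
def ThetaLarge (P : Params) (ε : ℝ) : Prop :=
  ¬ BddAbove {r : ℝ | ∃ n m : ℕ+, ε ^ (m : ℕ) ≤ P.θ n ∧ r = (n : ℝ) / (m : ℝ)}

/-- The bound on `μ` depends on neither `p`, `l` nor `η`; this makes the final equivalence constant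
uniform over the blocks. -/
theorem exists_splitBlock (P : Params) {ε : ℝ} (hε : 0 < ε) (hθ : ThetaLarge P ε)
    (Y : Submodule ℝ (ℕ+ →₀ ℝ)) (hY : ∀ N : ℕ+, ∃ v ∈ Y, v ≠ 0 ∧ ∀ n ∈ v.support, N < n)
    {s : ℕ+} (hs : P.σ s = Mode.M) (p : ℕ+) (l : ℕ) {η : ℝ} (hη : 0 < η) :
    ∃ y ∈ Y, ∃ μ, IsSplitBlock P p l η ((ε / 2)⁻¹ * (P.θ s)⁻¹) y μ := by
  have hc : 0 < ε / 2 := half_pos hε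
  -- Halving `ε` makes the inequality with `θ n` strict. The order `l + 1` is that of the index set
  -- of a special convex combination.
  obtain ⟨n, r₀, hn, hr⟩ : ∃ n r₀ : ℕ+, (r₀ : ℕ) * (l + 1) ≤ n ∧ (ε / 2) ^ (r₀ : ℕ) < P.θ n := by
    obtain ⟨_, ⟨n, m, h, rfl⟩, hlt⟩ := not_bddAbove_iff.1 hθ (l + 1 : ℕ)
    have hm : (0 : ℝ) < (m : ℕ) := by exact_mod_cast m.pos
    refine ⟨n, m, ?_, ?_⟩
    · have h1 := (lt_div_iff₀ hm).1 hlt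
      have h2 : (((l + 1) * (m : ℕ) : ℕ) : ℝ) < (n : ℕ) := by push_cast at h1 ⊢; exact h1
      have h3 := Nat.cast_lt.1 h2
      rw [mul_comm]; exact h3.le
    · exact (pow_lt_pow_left₀ (half_lt_self hε) hc.le m.ne_zero).trans_le h
  obtain ⟨V, N₀, hV, hfar, hlow⟩ := exists_lower_l1 P hc hn hr Y hY
  obtain ⟨z, m, q, hz, hzV, hm⟩ := exists_fastBlockSeq hfar (max p N₀)
  obtain ⟨t, ht, hθt⟩ := P.exists_lower_bound l
  -- With this smallness `2 η₀ = c η t ≤ c η θ j` for all `j < l`, where `c = ε / 2`.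
  obtain ⟨J, b, -, hb⟩ := exists_specialConvex hz.strictMono l (ε / 2 * η * t / 2) (by positivity) 0
  have hw := hlow z m q hz hzV (fun i => (le_max_right _ _).trans_lt (hm i)) J b hb.nonneg
    hb.sum_eq hb.mem
  refine ⟨_, ?_, _, hz.isSplitBlock (fun i => (hV _ (hzV i)).2)
    (fun i => (le_max_left _ _).trans_lt (hm i)) hc (fun j hj => ?_) hb hw hs⟩
  · exact Y.smul_mem _ (Y.sum_mem fun i _ => Y.smul_mem _ (hV _ (hzV i)).1)
  · have := mul_le_mul_of_nonneg_left (hθt j hj) (mul_pos hc hη).le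
    linarith

/-! ### Recursive choice of the blocks -/

lemma sum_half_pow_le_one (T : Finset ℕ+) : ∑ k ∈ T, (1 / 2 : ℝ) ^ (k : ℕ) ≤ 1 := by
  classical
  have h1 : ∑ k ∈ T, (1 / 2 : ℝ) ^ (k : ℕ) =
      1 / 2 * ∑ i ∈ T.image PNat.natPred, (1 / 2 : ℝ) ^ i := by
    rw [Finset.sum_image (PNat.natPred_injective.injOn), Finset.mul_sum]
    refine Finset.sum_congr rfl fun k _ => ?_
    rw [← pow_succ', PNat.natPred_add_one]
  have h2 := summable_geometric_two.sum_le_tsum (T.image PNat.natPred)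
    (fun i _ => by positivity)
  rw [tsum_geometric_two] at h2
  rw [h1]
  linarith

/-- The pair `(p, l)` determines a block. The block then determines the next `p`, by the gap of
ratio eight, and the next `l`, from which on `θ j` makes its `ℓ¹`-norm negligible. Dividing `η` and
`τ` by `p` compensates for the counts, which are at most `p`. -/
theorem exists_splitData (P : Params) {ε : ℝ} (hε : 0 < ε) (hθ : ThetaLarge P ε)
    (Y : Submodule ℝ (ℕ+ →₀ ℝ)) (hY : ∀ N : ℕ+, ∃ v ∈ Y, v ≠ 0 ∧ ∀ n ∈ v.support, N < n)
    {δ : ℝ} (hδ1 : δ < 1) :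
    ∃ (y : ℕ+ → ℕ+ →₀ ℝ) (p q : ℕ+ → ℕ+) (l : ℕ+ → ℕ) (μ : ℕ+ → Set ℕ+ → ℝ) (η τ : ℕ+ → ℝ)
      (C : ℝ), SplitData P y p q l μ η τ ∧ (∀ k, y k ∈ Y) ∧ (∀ k, tnorm P (y k) = 1) ∧
      (∀ k E, μ k E ≤ C) ∧ (∀ k, η k / (1 - δ) * (p k : ℕ) ≤ 1) ∧
      ∀ T : Finset ℕ+, ∑ k ∈ T, ((p k : ℕ) : ℝ) * τ k ≤ 1 := by
  obtain ⟨s, hs⟩ := P.exists_modified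
  have hδ' : 0 < 1 - δ := by linarith
  have hp0 : ∀ p : ℕ+, (0 : ℝ) < (p : ℕ) := fun p => by exact_mod_cast p.pos
  choose v hvY μ hμ using fun (p : ℕ+) (l : ℕ) =>
    exists_splitBlock P hε hθ Y hY hs p l (η := (1 - δ) / (p : ℕ)) (div_pos hδ' (hp0 p))
  have hQ : ∀ p l, ∃ c : ℕ+, p ≤ c ∧ ∀ n ∈ (v p l).support, n ≤ c := by
    intro p l
    obtain ⟨c, hc⟩ := (v p l).support.exists_le
    exact ⟨max p c, le_max_left _ _, fun n hn => (hc n hn).trans (le_max_right _ _)⟩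
  choose Q hpQ hQ using hQ
  have hL : ∀ (k : ℕ) p l, ∃ l' : ℕ, l ≤ l' ∧ ∀ j : ℕ+, l' ≤ j →
      P.θ j * l1Norm (v p l) ≤ (1 / 2) ^ (k + 1) / (p : ℕ) := by
    intro k p l
    have h1 : Tendsto (fun j => P.θ j * l1Norm (v p l)) atTop (𝓝 0) := by
      simpa using P.θ_null.mul_const (l1Norm (v p l))
    have h2 := h1.eventually_le_const
      (show (0 : ℝ) < (1 / 2) ^ (k + 1) / (p : ℕ) from div_pos (by positivity) (hp0 p))
    obtain ⟨M, hM⟩ := eventually_atTop.1 h2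
    exact ⟨max l M, le_max_left _ _, fun j hj => hM j
      (PNat.coe_le_coe _ _ |>.1 ((le_max_right _ _).trans hj))⟩
  choose L hlL hL using hL
  -- Block `k` uses the state at `k.natPred`, so the exponent `k + 1` in `hL` becomes `k`.
  let st : ℕ → ℕ+ × ℕ := fun i =>
    Nat.rec (1, 0) (fun k s => (8 * Q s.1 s.2, L k s.1 s.2)) i
  have hst : ∀ k, st (k + 1) = (8 * Q (st k).1 (st k).2, L k (st k).1 (st k).2) := fun k => rfl
  have hp_mono : Monotone fun k => (st k).1 := monotone_nat_of_le_succ fun k => by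
    rw [hst]; exact (hpQ _ _).trans (PNat.lt_eight_mul _).le
  have hl_mono : Monotone fun k => (st k).2 := monotone_nat_of_le_succ fun k => by
    rw [hst]; exact hlL _ _ _
  have hlt : ∀ {k k' : ℕ+}, k < k' → k.natPred + 1 ≤ k'.natPred := fun h =>
    Nat.succ_le_of_lt (PNat.natPred_lt_natPred.2 h)
  refine ⟨fun k => v (st k.natPred).1 (st k.natPred).2, fun k => (st k.natPred).1,
    fun k => Q (st k.natPred).1 (st k.natPred).2, fun k => (st k.natPred).2,
    fun k => μ (st k.natPred).1 (st k.natPred).2, fun k => (1 - δ) / ((st k.natPred).1 : ℕ),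
    fun k => (1 / 2) ^ (k : ℕ) / ((st k.natPred).1 : ℕ), _, ?_, fun k => hvY _ _,
    fun k => (hμ _ _).norm_eq, fun k => (hμ _ _).le, fun k => ?_, fun T => ?_⟩
  · constructor
    · exact fun k n hn => ⟨(hμ _ _).supp n hn, hQ _ _ n hn⟩
    · exact fun k => hpQ _ _
    · intro k k' h
      have := hp_mono (hlt h)
      simp only [hst] at this
      exact this
    · exact fun k k' h => hl_mono (PNat.natPred_monotone h)
    · intro k k' j h hj
      have h1 := hl_mono (hlt h)
      simp only [hst] at h1
      have := hL k.natPred _ _ j (h1.trans hj)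
      rwa [PNat.natPred_add_one] at this
    · exact fun k => (hμ _ _).nonneg
    · exact fun k => (hμ _ _).super
    · exact fun k => (hμ _ _).norm_le
    · exact fun k j K E T hj had _ => (hμ _ _).light j K E T hj had
    · exact fun k => (div_pos hδ' (hp0 _)).le
    · exact fun k => (div_pos (by positivity) (hp0 _)).le
  · have h1 := (hp0 (st k.natPred).1).ne'
    have h2 := hδ'.ne'
    exact le_of_eq (by field_simp)
  · refine le_trans (le_of_eq (Finset.sum_congr rfl fun k _ => ?_)) (sum_half_pow_le_one T)
    have h1 := (hp0 (st k.natPred).1).ne'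
    field_simp

/-- In every block subspace there are normalized blocks equivalent to a subsequence of the unit
vectors. -/
theorem exists_equivalent_blocks (P : Params) {ε : ℝ} (hε : 0 < ε) (hθ : ThetaLarge P ε)
    (Y : Submodule ℝ (ℕ+ →₀ ℝ)) (hY : ∀ N : ℕ+, ∃ v ∈ Y, v ≠ 0 ∧ ∀ n ∈ v.support, N < n) :
    ∃ (y : ℕ+ → ℕ+ →₀ ℝ) (p : ℕ+ → ℕ+) (B : ℝ), (∀ k, y k ∈ Y) ∧ (∀ k, tnorm P (y k) = 1) ∧
      (∀ k k', k < k' → Precedes (y k).support (y k').support) ∧ StrictMono p ∧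
      ∀ a : ℕ+ →₀ ℝ,
        tnorm P (Finsupp.mapDomain p a) ≤ tnorm P (∑ k ∈ a.support, a k • y k) ∧
        tnorm P (∑ k ∈ a.support, a k • y k) ≤ B * tnorm P (Finsupp.mapDomain p a) := by
  obtain ⟨δ, hδ1, hθδ⟩ := P.exists_bound
  obtain ⟨y, p, q, l, μ, η, τ, C, D, hyY, hy1, hC, hη, hτ⟩ := exists_splitData P hε hθ Y hY hδ1
  have hprec : ∀ k k', k < k' → Precedes (y k).support (y k').support :=
    fun k k' h n hn n' hn' => ((D.supp k n hn).2.trans_lt (D.q_lt_p h)).trans (D.supp k' n' hn').1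
  refine ⟨y, p, 4 * (C + 1) + 1, hyY, hy1, hprec, D.p_strictMono, fun a => ⟨?_, ?_⟩⟩
  · exact tnorm_mapDomain_le P D.p_strictMono (fun k n hn => (D.supp k n hn).1.le) hprec hy1 a
  · exact D.tnorm_sum_le ((P.θ_pos 1).trans_le (hθδ 1)) hδ1 hθδ hC (fun k => (hy1 k).le) hη hτ a

/-! ## The unit vector basis of the completion -/

/-- The inclusion of `c₀₀` into its completion. -/
def emb (P : Params) : (ℕ+ →₀ ℝ) →ₗ[ℝ] Space P :=
  (UniformSpace.Completion.toComplₗᵢ (𝕜 := ℝ) (E := C00 P)).toLinearMap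

lemma norm_emb (P : Params) (x : ℕ+ →₀ ℝ) : ‖emb P x‖ = tnorm P x :=
  UniformSpace.Completion.norm_coe (E := C00 P) x

lemma denseRange_emb (P : Params) : DenseRange (emb P) :=
  UniformSpace.Completion.denseRange_coe (α := C00 P)

lemma emb_single (P : Params) (k : ℕ+) : emb P (Finsupp.single k 1) = unitVector P k := rfl

lemma sum_smul_unitVector (P : Params) (a : ℕ+ →₀ ℝ) :
    ∑ i ∈ a.support, a i • unitVector P i = emb P a := by
  conv_rhs => rw [← Finsupp.sum_single a, Finsupp.sum, map_sum]
  refine Finset.sum_congr rfl fun i _ => ?_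
  rw [← emb_single, ← map_smul, Finsupp.smul_single, smul_eq_mul, mul_one]

lemma sum_smul_unitVector_comp (P : Params) {p : ℕ+ → ℕ+} (a : ℕ+ →₀ ℝ) :
    ∑ i ∈ a.support, a i • unitVector P (p i) = emb P (Finsupp.mapDomain p a) := by
  rw [Finsupp.mapDomain, Finsupp.sum, map_sum]
  refine Finset.sum_congr rfl fun i _ => ?_
  rw [← emb_single, ← map_smul, Finsupp.smul_single, smul_eq_mul, mul_one]

lemma norm_unitVector (P : Params) (k : ℕ+) : ‖unitVector P k‖ = 1 := by
  rw [← emb_single, norm_emb]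
  refine le_antisymm (((good_tnorm P).le_l1 _).trans_eq ?_) ?_
  · rw [l1Norm, Finsupp.support_single k one_ne_zero]
    simp
  · have h := (abs_le_c0Norm (Finsupp.single k 1) k).trans (c0Norm_le_tnorm P _)
    simpa using h

lemma abs_apply_le (P : Params) (k : ℕ+) (x : ℕ+ →₀ ℝ) : ‖Finsupp.lapply (R := ℝ) k x‖ ≤
    1 * ‖emb P x‖ := by
  rw [one_mul, norm_emb, Finsupp.lapply_apply, Real.norm_eq_abs]
  exact (abs_le_c0Norm x k).trans (c0Norm_le_tnorm P x)

/-- The coordinate functionals on the space. -/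
def coordFunctional (P : Params) (k : ℕ+) : StrongDual ℝ (Space P) :=
  (Finsupp.lapply (R := ℝ) k).extendOfNorm (emb P)

lemma coordFunctional_emb (P : Params) (k : ℕ+) (x : ℕ+ →₀ ℝ) :
    coordFunctional P k (emb P x) = x k :=
  LinearMap.extendOfNorm_eq (denseRange_emb P) ⟨1, abs_apply_le P k⟩ x

/-- The partial sum operators of the unit vectors. -/
def partialSum (P : Params) (N : ℕ+) (z : Space P) : Space P :=
  ∑ i ∈ Finset.Iic N, coordFunctional P i z • unitVector P i

lemma continuous_partialSum (P : Params) (N : ℕ+) : Continuous (partialSum P N) := by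
  unfold partialSum
  fun_prop

lemma partialSum_sub (P : Params) (N : ℕ+) (z w : Space P) :
    partialSum P N (z - w) = partialSum P N z - partialSum P N w := by
  simp [partialSum, sub_smul, Finset.sum_sub_distrib]

lemma partialSum_emb (P : Params) (N : ℕ+) (x : ℕ+ →₀ ℝ) :
    partialSum P N (emb P x) = emb P (restrict (Set.Iic N) x) := by
  rw [partialSum, ← sum_smul_unitVector P (restrict (Set.Iic N) x)]
  have h : (restrict (Set.Iic N) x).support ⊆ Finset.Iic N := by
    intro i hi
    by_contra hN
    rw [Finset.mem_Iic] at hN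
    simp [restrict_apply, hN] at hi
  rw [Finset.sum_subset h]
  · refine Finset.sum_congr rfl fun i hi => ?_
    rw [coordFunctional_emb, restrict_apply, if_pos (by simpa using hi)]
  · intro i _ hi
    rw [Finsupp.notMem_support_iff.1 hi, zero_smul]

lemma norm_partialSum_le (P : Params) (N : ℕ+) (z : Space P) : ‖partialSum P N z‖ ≤ ‖z‖ := by
  refine (denseRange_emb P).induction_on z ?_ fun x => ?_
  · exact isClosed_le (continuous_partialSum P N).norm continuous_norm
  · rw [partialSum_emb, norm_emb, norm_emb]
    exact tnorm_restrict_le P _ x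

lemma tendsto_partialSum (P : Params) (z : Space P) :
    Tendsto (fun N => partialSum P N z) atTop (𝓝 z) := by
  rw [Metric.tendsto_atTop]
  intro ε hε
  obtain ⟨x, hx⟩ := (denseRange_emb P).exists_dist_lt z (half_pos hε)
  obtain ⟨N₀, hN₀⟩ := x.support.bddAbove
  refine ⟨N₀, fun N hN => ?_⟩
  have h : partialSum P N (emb P x) = emb P x := by
    rw [partialSum_emb, restrict_eq_self fun k hk => Set.mem_Iic.2 ((hN₀ hk).trans hN)]
  rw [dist_eq_norm] at hx ⊢
  calc ‖partialSum P N z - z‖ = ‖partialSum P N (z - emb P x) - (z - emb P x)‖ := by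
        rw [partialSum_sub, h, sub_sub_sub_cancel_right]
    _ ≤ ‖partialSum P N (z - emb P x)‖ + ‖z - emb P x‖ := norm_sub_le _ _
    _ < ε := by linarith [norm_partialSum_le P N (z - emb P x)]

/-- The unit vectors form a Schauder basis. -/
def unitVectorBasis (P : Params) :
    GeneralSchauderBasis ℕ+ ℝ (Space P) (SummationFilter.conditional ℕ+) where
  basis := unitVector P
  coord := coordFunctional P
  ortho i j := by
    rw [← emb_single, coordFunctional_emb, Finsupp.single_eq_pi_single]
    congr!
  expansion z := by
    rw [HasSum, SummationFilter.conditional_filter_eq_map_Iic, tendsto_map'_iff]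
    exact tendsto_partialSum P z

/-! ## Block bases -/

lemma linearCombination_apply_of_mem {c : ℕ+ → ℕ+ →₀ ℝ}
    (hc : ∀ k l, k < l → Precedes (c k).support (c l).support) (d : ℕ+ →₀ ℝ) {i n : ℕ+}
    (hn : n ∈ (c i).support) : Finsupp.linearCombination ℝ c d n = d i * c i n := by
  rw [Finsupp.linearCombination_apply, Finsupp.sum, Finsupp.finsetSum_apply,
    Finset.sum_eq_single i]
  · rfl
  · intro j _ hj
    have h : c j n = 0 := by
      by_contra h
      have h' : n ∈ (c j).support := Finsupp.mem_support_iff.2 h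
      rcases lt_or_gt_of_ne hj with hlt | hlt
      · exact lt_irrefl _ (hc _ _ hlt n h' n hn)
      · exact lt_irrefl _ (hc _ _ hlt n hn n h')
    rw [Finsupp.smul_apply, h, smul_zero]
  · intro h
    rw [Finsupp.notMem_support_iff.1 h, zero_smul]
    rfl

lemma le_of_mem_support_block {c : ℕ+ → ℕ+ →₀ ℝ} (h0 : ∀ k, c k ≠ 0)
    (hc : ∀ k l, k < l → Precedes (c k).support (c l).support) {k n : ℕ+}
    (hn : n ∈ (c k).support) : k ≤ n := by
  choose m hm using fun k => Finsupp.support_nonempty_iff.2 (h0 k)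
  have hmono : StrictMono fun k => (c k).support.min' ⟨m k, hm k⟩ := fun k l h =>
    hc k l h _ (Finset.min'_mem _ _) _ (Finset.min'_mem _ _)
  exact (hmono.le_apply (x := k)).trans (Finset.min'_le _ _ hn)

/-- A block basis of a block basis, from the supports in the original coordinates. -/
lemma precedes_coefficients {c d : ℕ+ → ℕ+ →₀ ℝ} (h0 : ∀ k, c k ≠ 0)
    (hc : ∀ k l, k < l → Precedes (c k).support (c l).support)
    (hd : ∀ k l, k < l → Precedes (Finsupp.linearCombination ℝ c (d k)).support
      (Finsupp.linearCombination ℝ c (d l)).support) (k l : ℕ+) (hkl : k < l) :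
    Precedes (d k).support (d l).support := by
  intro i hi j hj
  have key : ∀ r s, s ∈ (d r).support → ∀ n ∈ (c s).support,
      n ∈ (Finsupp.linearCombination ℝ c (d r)).support := by
    intro r s hs n hn
    rw [Finsupp.mem_support_iff, linearCombination_apply_of_mem hc _ hn]
    exact mul_ne_zero (Finsupp.mem_support_iff.1 hs) (Finsupp.mem_support_iff.1 hn)
  obtain ⟨n, hn⟩ := Finsupp.support_nonempty_iff.2 (h0 i)
  obtain ⟨n', hn'⟩ := Finsupp.support_nonempty_iff.2 (h0 j)
  have hlt : n < n' := hd k l hkl n (key k i hi n hn) n' (key l j hj n' hn')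
  by_contra hij
  rcases (not_lt.1 hij).lt_or_eq with h | rfl
  · exact lt_asymm hlt (hc j i h n' hn' n hn)
  · exact lt_irrefl n (hd k l hkl n (key k _ hi n hn) n (key l _ hj n hn))

theorem isSubsequentiallyMinimal (P : Params) {ε : ℝ} (hε : 0 < ε) (hθ : ThetaLarge P ε) :
    IsSubsequentiallyMinimal (unitVector P) where
  basis := ⟨unitVectorBasis P, rfl⟩
  norm_eq_one := norm_unitVector P
  block x hx := by
    obtain ⟨⟨c, h0, hc, hxc⟩, -⟩ := hx
    have hxc' : ∀ k, x k = emb P (c k) := fun k => (hxc k).trans (sum_smul_unitVector P _)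
    obtain ⟨y, p, B, hyY, hy1, hyp, hp, hB⟩ := exists_equivalent_blocks P hε hθ
      (LinearMap.range (Finsupp.linearCombination ℝ c)) fun N =>
        -- The support of the `k`-th block starts at `k` or later, so the block of index `N + 1`
        -- lies beyond `N`.
        ⟨c (N + 1), ⟨Finsupp.single (N + 1) 1, by simp⟩, h0 _, fun n hn =>
          (PNat.lt_add_right N 1).trans_le (le_of_mem_support_block h0 hc hn)⟩
    choose d hd using hyY
    have hsum : ∀ a : ℕ+ →₀ ℝ, ∑ n ∈ a.support, a n • emb P (y n) =
        emb P (∑ n ∈ a.support, a n • y n) := fun a => by simp only [map_sum, map_smul]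
    refine ⟨fun k => emb P (y k), ⟨⟨d, fun k hk => ?_, ?_, fun k => ?_⟩, fun k => ?_⟩, p, hp,
      ⟨1, fun a => ?_⟩, ⟨B, fun a => ?_⟩⟩
    · have h := hy1 k
      rw [← hd k, hk, map_zero, tnorm_zero] at h
      exact zero_ne_one h
    · exact precedes_coefficients h0 hc (by simpa only [hd] using hyp)
    · beta_reduce
      rw [← hd k, Finsupp.linearCombination_apply, Finsupp.sum, map_sum]
      exact Finset.sum_congr rfl fun i _ => by rw [map_smul, hxc']
    · rw [norm_emb, hy1]
    · rw [hsum, sum_smul_unitVector_comp, norm_emb, norm_emb, one_mul]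
      exact (hB a).1
    · rw [hsum, sum_smul_unitVector_comp, norm_emb, norm_emb]
      exact (hB a).2

/-- If `sup θₙ^{1/n} = 1`, then the numbers `θₙ` are large in the sense of `ThetaLarge`. -/
theorem thetaLarge_half (P : Params)
    (h : IsLUB (Set.range fun n : ℕ+ => P.θ n ^ (1 / (n : ℝ))) 1) : ThetaLarge P (1 / 2) := by
  rintro ⟨B, hB⟩
  obtain ⟨K, hK⟩ := exists_nat_gt B
  -- Here `c ^ (2 (K + 1)) = 1 / 2`. For `m = ⌊n / (K + 1)⌋ ≥ 1` one has `n ≤ 2 (K + 1) m`, so `θ n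
  -- ≥ cⁿ` implies `θ n ≥ (1 / 2)ᵐ`, while `n / m ≥ K + 1 > B`.
  set c : ℝ := (1 / 2 : ℝ) ^ (1 / ((2 * (K + 1) : ℕ) : ℝ)) with hcdef
  have hc0 : 0 < c := by positivity
  have hc1 : c < 1 := Real.rpow_lt_one (by norm_num) (by norm_num) (by positivity)
  have hcpow : c ^ (2 * (K + 1)) = 1 / 2 := by
    rw [hcdef, one_div ((2 * (K + 1) : ℕ) : ℝ)]
    exact Real.rpow_inv_natCast_pow (by norm_num) (by omega)
  have hroot : ∀ n : ℕ+, P.θ n ^ (1 / (n : ℝ)) < 1 := fun n =>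
    Real.rpow_lt_one (P.θ_pos n).le (P.θ_lt_one n) (by positivity)
  -- A root exceeding the first `K + 1` roots, all of them below one, must have index at least `K +
  -- 1`; this makes `m` positive.
  obtain ⟨n₀, -, hn₀⟩ := (Finset.Iic K.succPNat).exists_max_image
    (fun n : ℕ+ => P.θ n ^ (1 / (n : ℝ))) ⟨K.succPNat, by simp⟩
  obtain ⟨_, ⟨n, rfl⟩, hn⟩ := (lt_isLUB_iff h).1 (max_lt (hroot n₀) hc1)
  have hKn : K + 1 ≤ (n : ℕ) := by
    by_contra hlt
    have hle : n ≤ K.succPNat := by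
      rw [← PNat.coe_le_coe, Nat.succPNat_coe]
      omega
    exact absurd (hn₀ n (by simpa using hle)) (not_le.2 ((le_max_left _ _).trans_lt hn))
  have hm : 0 < (n : ℕ) / (K + 1) := Nat.div_pos hKn (by omega)
  have hdiv := Nat.div_add_mod (n : ℕ) (K + 1)
  have hmod := Nat.mod_lt (n : ℕ) (show 0 < K + 1 by omega)
  set m := (n : ℕ) / (K + 1)
  have hcn : c ^ (n : ℕ) ≤ P.θ n := by
    have h1 : c ≤ P.θ n ^ (1 / (n : ℝ)) := ((le_max_right _ _).trans_lt hn).le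
    calc c ^ (n : ℕ) ≤ (P.θ n ^ (1 / (n : ℝ))) ^ (n : ℕ) := by gcongr
      _ = P.θ n := by
        rw [one_div]
        exact Real.rpow_inv_natCast_pow (P.θ_pos n).le n.ne_zero
  have hle : (n : ℕ) ≤ 2 * (K + 1) * m := by nlinarith
  have hmem : ((n : ℕ) : ℝ) / (m : ℝ) ≤ B := by
    refine hB ⟨n, ⟨m, hm⟩, ?_, rfl⟩
    refine le_trans ?_ hcn
    rw [← hcpow, ← pow_mul]
    exact pow_le_pow_of_le_one hc0.le hc1.le hle
  have hm' : (0 : ℝ) < m := by exact_mod_cast hm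
  rw [div_le_iff₀ hm'] at hmem
  have hge : ((K + 1) * m : ℝ) ≤ (n : ℕ) := by exact_mod_cast (by omega : (K + 1) * m ≤ (n : ℕ))
  nlinarith

end Tsirelson

end

theorem mainTheorem6 (P : Tsirelson.Params) :
    ((∃ ε : ℝ, 0 < ε ∧
        ¬ BddAbove {r : ℝ | ∃ n m : ℕ+, ε ^ (m : ℕ) ≤ P.θ n ∧ r = (n : ℝ) / (m : ℝ)}) →
      Tsirelson.IsSubsequentiallyMinimal (Tsirelson.unitVector P)) ∧
    (IsLUB (Set.range fun n : ℕ+ => P.θ n ^ (1 / (n : ℝ))) 1 →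
      (∃ ε : ℝ, 0 < ε ∧
        ¬ BddAbove {r : ℝ | ∃ n m : ℕ+, ε ^ (m : ℕ) ≤ P.θ n ∧ r = (n : ℝ) / (m : ℝ)}) ∧
      Tsirelson.IsSubsequentiallyMinimal (Tsirelson.unitVector P)) := by
  refine ⟨fun ⟨ε, hε, h⟩ => Tsirelson.isSubsequentiallyMinimal P hε h, fun h => ?_⟩
  have hθ := Tsirelson.thetaLarge_half P h
  exact ⟨⟨1 / 2, by norm_num, hθ⟩, Tsirelson.isSubsequentiallyMinimal P (by norm_num) hθ⟩
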